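/- Let $\alpha\in(1/2,5/4)$ and let $\bar\Omega\in C_c^\infty(\mathbb R^3;\mathbb R^3)$ be divergence-free, axisymmetric and pure-swirl ($\bar\Omega=\bar\Omega^\theta(r,z)e_\theta$ in cylindrical coordinates). Let $$\mathrm{BS}\,\Omega(\xi)=-\int_{\mathbb R^3}\frac{\xi'\times\Omega(\xi-\xi')}{4\pi|\xi'|^3}\,d\xi'$$ be the Biot--Savart operator, let $\bar U=\mathrm{BS}\,\bar\Omega$, and let $\mathbb P$ be the Leray projector, i.e. the orthogonal projection of $L^2(\mathbb R^3;\mathbb C^3)$ onto divergence-free fields. Let $L^2_{aps}$ be the space of complex-valued, divergence-free, axisymmetric pure-swirl fields in $L^2(\mathbb R^3;\mathbb C^3)$. For $\beta>0$ consider the following operators (all expressions being understood in the sense of distributions), where $U=\mathrm{BS}\,\Omega$ in the first one: $$-\boldsymbol L\Omega=\bar U\cdot\nabla\Omega-\Omega\cdot\nabla\bar U+U\cdot\nabla\bar\Omega-\bar\Omega\cdot\nabla U,\qquad D(\boldsymbol L)=\{\Omega\in L^2_{aps}:\bar U\cdot\nabla\Omega\in L^2\},$$ $$-\boldsymbol L_{\alpha,\beta}\Omega=\Big(-1-\frac1{2\alpha}\xi\cdot\nabla+(-\Delta)^\alpha\Big)\Omega-\beta\boldsymbol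 L\Omega,\qquad D(\boldsymbol L_{\alpha,\beta})=\{\Omega\in L^2_{aps}:\Omega\in H^{2\alpha},\ \xi\cdot\nabla\Omega\in L^2\},$$ $$-\boldsymbol T_{\alpha,\beta}U=\Big(\frac1{2\alpha}-1-\frac1{2\alpha}\xi\cdot\nabla\Big)U+\beta\,\mathbb P(\bar U\cdot\nabla U+U\cdot\nabla\bar U)+(-\Delta)^\alpha U,\qquad D(\boldsymbol T_{\alpha,\beta})=\{U\in H^{2\alpha}:\xi\cdot\nabla U\in L^2\}.$$ (i) Let $\beta>0$ and let $\lambda$ be an eigenvalue of $\boldsymbol L_{\alpha,\beta}$ with $\Re\lambda>0$ and $\Re\lambda>1-\frac3{4\alpha}$. Then, for every eigenfunction $\zeta$ of $\boldsymbol L_{\alpha,\beta}$ for $\lambda$, the field $\eta=\mathrm{BS}\,\zeta$ lies in $L^2$ and is an eigenfunction of $\boldsymbol T_{\alpha,\beta}$ for the same eigenvalue: $0\ne\eta\in D(\boldsymbol T_{\alpha,\beta})$ and $\boldsymbol T_{\alpha,\beta}\eta=\lambda\eta$. (ii) In particular, let $\lambda_\infty$ be an unstable eigenvalue of $\boldsymbol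 L$ (an eigenvalue with $\Re\lambda_\infty>0$) and let $0<\varepsilon<\Re\lambda_\infty$. Then there is $\beta_0>0$ such that for every $\beta>\beta_0$ every eigenvalue of $\boldsymbol L_{\alpha,\beta}$ of the form $\lambda_{\alpha,\beta}=\beta\lambda'+1-\frac3{4\alpha}$ with $|\lambda_\infty-\lambda'|<\varepsilon$ is unstable ($\Re\lambda_{\alpha,\beta}>0$) and is an eigenvalue of $\boldsymbol T_{\alpha,\beta}$; moreover, for every eigenfunction $\zeta$ of $\boldsymbol L_{\alpha,\beta}$ for $\lambda_{\alpha,\beta}$, the field $\mathrm{BS}\,\zeta$ lies in $L^2$ and is an eigenfunction of $\boldsymbol T_{\alpha,\beta}$ for $\lambda_{\alpha,\beta}$. -/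

import Mathlib

open MeasureTheory Set
open scoped ENNReal ContDiff FourierTransform SchwartzMap

noncomputable section

/-- Physical space `ℝ³`. -/
abbrev E3 : Type := EuclideanSpace ℝ (Fin 3)

/-- The values `ℂ³` of complex vector fields. -/
abbrev C3 : Type := EuclideanSpace ℂ (Fin 3)

/-- `L²(ℝ³; ℂ³)`. -/
abbrev L2Field : Type := Lp C3 2 (volume : Measure E3)

/-- The `i`-th standard basis vector of `ℝ³`. -/
abbrev basisVec (i : Fin 3) : E3 := EuclideanSpace.single i (1 : ℝ)

/-- Test functions: real-valued, smooth, compactly supported. -/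
def IsTestFunction (φ : E3 → ℝ) : Prop :=
  ContDiff ℝ ∞ φ ∧ HasCompactSupport φ

/-- The classical divergence `∑ᵢ ∂ᵢ bᵢ`. -/
def divergence (b : E3 → E3) (x : E3) : ℝ :=
  ∑ i, fderiv ℝ b x (basisVec i) i

/-- The vector `(V · ∇b)(x) = ∑ᵢ Vᵢ(x) ∂ᵢb(x)` for a differentiable real field `b` and a complex
field `V`. -/
def dotGrad (V : E3 → C3) (b : E3 → E3) (x : E3) : C3 :=
  WithLp.toLp 2 fun j => ∑ i, V x i * ((fderiv ℝ b x (basisVec i) j : ℝ) : ℂ)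

/-- The field `W ∈ L²` is `b · ∇V = ∑ᵢ bᵢ ∂ᵢV` in the sense of distributions, where `b` is a smooth
real field and `V` is locally integrable:
`∫ φ W = - ∫ div (φ b) V` for every test function `φ`. -/
def IsAdvection (b : E3 → E3) (V : E3 → C3) (W : L2Field) : Prop :=
  LocallyIntegrable V volume ∧
    ∀ φ : E3 → ℝ, IsTestFunction φ →
      ∫ x, φ x • W x = - ∫ x, divergence (fun y => φ y • b y) x • V x

/-- The Biot–Savart operator
`BS Ω (ξ) = - ∫ ξ' × Ω (ξ - ξ') / (4 π |ξ'|³) dξ'`, for real (`𝕜 = ℝ`) and complex (`𝕜 = ℂ`)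
fields. -/
def biotSavart {𝕜 : Type} [RCLike 𝕜] (Ω : E3 → EuclideanSpace 𝕜 (Fin 3)) (x : E3) :
    EuclideanSpace 𝕜 (Fin 3) :=
  - ∫ y : E3, (1 / (4 * Real.pi * ‖y‖ ^ 3) : ℝ) •
      (WithLp.toLp 2 (crossProduct (fun i => ((y i : ℝ) : 𝕜)) (fun i => Ω (x - y) i)) :
        EuclideanSpace 𝕜 (Fin 3))

/-- `V` is axisymmetric and pure-swirl: in cylindrical coordinates `V = V^θ(r, z) e_θ`
(almost everywhere), where `r = (x₀² + x₁²)^{1/2}`, `z = x₂` and `e_θ = (-x₁/r, x₀/r, 0)`. -/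
def IsAxisymPureSwirl {𝕜 : Type} [RCLike 𝕜] (V : E3 → EuclideanSpace 𝕜 (Fin 3)) : Prop :=
  ∃ v : ℝ → ℝ → 𝕜, ∀ᵐ x : E3,
    V x 0 = v (√(x 0 ^ 2 + x 1 ^ 2)) (x 2) * ((-(x 1) / √(x 0 ^ 2 + x 1 ^ 2) : ℝ) : 𝕜) ∧
    V x 1 = v (√(x 0 ^ 2 + x 1 ^ 2)) (x 2) * ((x 0 / √(x 0 ^ 2 + x 1 ^ 2) : ℝ) : 𝕜) ∧
    V x 2 = 0

/-- The gradients of test functions, as elements of `L²`. -/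
def testGradients : Set L2Field :=
  {G | ∃ φ : E3 → ℝ, IsTestFunction φ ∧
    ∀ᵐ x : E3, ∀ i, G x i = ((fderiv ℝ φ x (basisVec i) : ℝ) : ℂ)}

/-- The (weakly) divergence-free fields of `L²`: those `U` with `∫ ∇φ · U = 0` for every test
function `φ`. -/
abbrev solenoidal : Submodule ℂ L2Field := (Submodule.span ℂ testGradients)ᗮ

/-- The Leray projector: the orthogonal projection of `L²` onto the divergence-free fields. -/
def lerayProj : L2Field →L[ℂ] L2Field := solenoidal.starProjection

/-- The space `L²_aps` of divergence-free, axisymmetric pure-swirl fields. -/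
def MemL2aps (Ω : L2Field) : Prop :=
  Ω ∈ solenoidal ∧ IsAxisymPureSwirl (fun x => Ω x)

/-- `U ∈ H^s`. -/
def MemHs (s : ℝ) (U : L2Field) : Prop :=
  TemperedDistribution.MemSobolev s 2 (U : 𝓢'(E3, C3))

/-- `V = (-Δ)^α U`. The Fourier transform is normalised with kernel `exp (-2πi x · k)`, so that the
symbol of `(-Δ)^α` is `(2π|k|)^{2α}`. -/
def IsFracLaplacian (α : ℝ) (U V : L2Field) : Prop :=
  ∀ᵐ k : E3, (𝓕 V : L2Field) k = ((2 * Real.pi * ‖k‖) ^ (2 * α) : ℝ) • (𝓕 U : L2Field) k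

/-!
An unbounded operator `A` in `L²` is given by its graph, the relation `A U W` that reads
"`U` belongs to the domain and `A U = W`".
-/

/-- `U` is an eigenvector, with eigenvalue `lam`, of the operator with graph `A`. -/
def IsEigenvector (A : L2Field → L2Field → Prop) (lam : ℂ) (U : L2Field) : Prop :=
  U ≠ 0 ∧ A U (lam • U)

/-- `lam` is an eigenvalue of the operator with graph `A`. -/
def IsEigenvalue (A : L2Field → L2Field → Prop) (lam : ℂ) : Prop :=
  ∃ U, IsEigenvector A lam U

/-- The linearised Euler operator `𝓛` in vorticity form around the vorticity `Ωb`, whose velocity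
is `Ub = BS Ωb`:
`-𝓛 Ω = Ub · ∇Ω - Ω · ∇Ub + U · ∇Ωb - Ωb · ∇U`, `U = BS Ω`,
with domain `{Ω ∈ L²_aps : Ub · ∇Ω ∈ L²}`. Below `A = Ub · ∇Ω` and `B = Ωb · ∇U`; the latter lies in
`L²` for every `Ω ∈ L²`, since `∇U` does. -/
def EulerOp (Ωb : E3 → E3) (Ω W : L2Field) : Prop :=
  MemL2aps Ω ∧
  ∃ A B : L2Field,
    IsAdvection (biotSavart Ωb) (fun x => Ω x) A ∧
    IsAdvection Ωb (biotSavart fun x => Ω x) B ∧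
    ∀ᵐ x : E3, -(W x) =
      A x - dotGrad (fun y => Ω y) (biotSavart Ωb) x
        + dotGrad (biotSavart fun y => Ω y) Ωb x - B x

/-- The linearised Navier–Stokes operator `𝓛_{α,β}` in vorticity form and similarity variables,
around `β Ωb`:
`-𝓛_{α,β} Ω = (-1 - (1/2α) ξ · ∇ + (-Δ)^α) Ω - β 𝓛 Ω`,
with domain `{Ω ∈ L²_aps : Ω ∈ H^{2α}, ξ · ∇Ω ∈ L²}`. Below `X = ξ · ∇Ω`, `F = (-Δ)^α Ω` and
`N = 𝓛 Ω`; the last two exist for every `Ω` in this domain. -/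
def VorticityOp (α β : ℝ) (Ωb : E3 → E3) (Ω W : L2Field) : Prop :=
  MemL2aps Ω ∧ MemHs (2 * α) Ω ∧
  ∃ X F N : L2Field,
    IsAdvection (fun ξ => ξ) (fun x => Ω x) X ∧
    IsFracLaplacian α Ω F ∧
    EulerOp Ωb Ω N ∧
    -W = -Ω - (1 / (2 * α) : ℝ) • X + F - β • N

/-- The linearised Navier–Stokes operator `T_{α,β}` in velocity form and similarity variables,
around `β Ub`, `Ub = BS Ωb`:
`-T_{α,β} U = (1/2α - 1 - (1/2α) ξ · ∇) U + β ℙ (Ub · ∇U + U · ∇Ub) + (-Δ)^α U`,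
with domain `{U ∈ H^{2α} : ξ · ∇U ∈ L²}`. Below `X = ξ · ∇U`, `F = (-Δ)^α U`, `A = Ub · ∇U` and
`N = Ub · ∇U + U · ∇Ub`; the last three exist for every `U` in this domain if `2α ≥ 1`. -/
def VelocityOp (α β : ℝ) (Ωb : E3 → E3) (U W : L2Field) : Prop :=
  MemHs (2 * α) U ∧
  ∃ X F A N : L2Field,
    IsAdvection (fun ξ => ξ) (fun x => U x) X ∧
    IsFracLaplacian α U F ∧
    IsAdvection (biotSavart Ωb) (fun x => U x) A ∧
    (∀ᵐ x : E3, N x = A x + dotGrad (fun y => U y) (biotSavart Ωb) x) ∧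
    -W = (1 / (2 * α) - 1 : ℝ) • U - (1 / (2 * α) : ℝ) • X + β • lerayProj N + F

end

/-!
Write `BS` for the Biot–Savart operator, `Ub = BS Ωb`, `ℙ` for the Leray projector, and
`c = 2α (λ - 1)`. The eigenvalue equation for the vorticity `ζ` reads

  `ξ · ∇ζ = c ζ + R`,  `R = 2α ((-Δ)^α ζ - β 𝓛ζ)`,

with `𝓛` the linearised Euler operator. The point is to show that `η = BS ζ` lies in `L²`. The
Biot–Savart operator divides by `|k|` on the Fourier side, so that `ζ ∈ L²` alone gives no control
of `η` at low frequencies. However, the remainder is the curl of an `L²` field, `R = curl H`, where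

  `H = 2α ((-Δ)^α η - β ℙ (Ub × ζ + η × Ωb))`.

The first term is square integrable because `2α ≥ 1` makes up for the factor `|k|⁻¹`
(`exists_fracLaplacian_velocity`). For the second one, `2α > 1` puts `ζ` in `H¹`, hence `η` is
bounded (`biotSavart_ae_eq_velocity`), and `Ωb` has compact support; that its curl is `𝓛ζ` is the
identity `curl (b × V) = V · ∇b - b · ∇V` for divergence-free fields (`exists_curl_eq_euler`), and
`ℙ` does not change the curl (`cross_fourier_lerayProj`).

Integrating the transport equation along the dilations `ξ ↦ s ξ`, from `s = 1` to `s = ∞`, gives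
`ζ = -∫₁^∞ s^{-c-1} (curl H)(s ·) ds`, whose natural curl primitive is

  `η = -∫₁^∞ s^{-c-2} H (s ·) ds`.

Since `‖H (s ·)‖ = s^{-3/2} ‖H‖` in `L²(ℝ³)`, the integral converges there when
`Re c > -3/2`, that is `Re λ > 1 - 3/(4α)` (`memLp_scaleInt`). This `η` is divergence-free with curl `ζ`
(`exists_velocity_of_curl`), so that its Fourier transform is the Biot–Savart multiplier applied to
that of `ζ`; the Biot–Savart integral has the same Fourier representation
(`biotSavart_eq_fourierInv`, proved by writing the kernel as a superposition of Gaussians), hence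
`η = BS ζ`. By construction `ξ · ∇η = (c + 1) η + H` (`isAdvection_of_scaleInt`), which is the
eigenvalue equation for the velocity, because `Ub · ∇η + η · ∇Ub + Ub × ζ + η × Ωb` is the gradient
of `Ub · η` and is annihilated by `ℙ` (`lerayProj_convection`).

For an eigenvalue `β λ' + 1 - 3/(4α)` with `λ'` close to an unstable eigenvalue of `𝓛`, the real
part exceeds both `0` and `1 - 3/(4α)` as soon as `β` is large, so that the previous statement
applies.
-/

open Filter Topology

noncomputable section

/-! ### Test functions -/

lemma norm_basisVec (j : Fin 3) : ‖basisVec j‖ = 1 := by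
  simp [basisVec]

/-- The partial derivative `∂ⱼφ`. -/
def partialDeriv (φ : E3 → ℝ) (j : Fin 3) (x : E3) : ℝ :=
  fderiv ℝ φ x (basisVec j)

namespace IsTestFunction

variable {φ : E3 → ℝ}

lemma continuous (hφ : IsTestFunction φ) : Continuous φ := hφ.1.continuous

lemma differentiable (hφ : IsTestFunction φ) : Differentiable ℝ φ :=
  hφ.1.differentiable (by simp)

lemma partialDeriv (hφ : IsTestFunction φ) (j : Fin 3) : IsTestFunction (partialDeriv φ j) := by
  refine ⟨?_, ?_⟩
  · exact (hφ.1.fderiv_right (m := ∞) (by simp)).clm_apply contDiff_const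
  · exact (hφ.2.fderiv ℝ).comp_left (g := fun L : E3 →L[ℝ] ℝ => L (basisVec j)) (by simp)

lemma mul_smooth (hφ : IsTestFunction φ) {b : E3 → ℝ} (hb : ContDiff ℝ ∞ b) :
    IsTestFunction (fun x => φ x * b x) :=
  ⟨hφ.1.mul hb, hφ.2.mul_right⟩

lemma const_mul (hφ : IsTestFunction φ) (a : ℝ) : IsTestFunction (fun x => a * φ x) :=
  ⟨contDiff_const.mul hφ.1, hφ.2.mul_left⟩

lemma add {ψ : E3 → ℝ} (hφ : IsTestFunction φ) (hψ : IsTestFunction ψ) :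
    IsTestFunction (fun x => φ x + ψ x) :=
  ⟨hφ.1.add hψ.1, hφ.2.add hψ.2⟩

lemma memLp (hφ : IsTestFunction φ) (p : ℝ≥0∞) : MemLp φ p volume :=
  hφ.continuous.memLp_of_hasCompactSupport hφ.2

lemma exists_bound (hφ : IsTestFunction φ) : ∃ C, 0 ≤ C ∧ ∀ x, |φ x| ≤ C := by
  obtain ⟨C, hC⟩ := hφ.continuous.bounded_above_of_compact_support hφ.2
  exact ⟨C, (norm_nonneg _).trans (hC 0), hC⟩

lemma integrable_smul (hφ : IsTestFunction φ) {f : E3 → C3} (hf : LocallyIntegrable f volume) :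
    Integrable (fun x => φ x • f x) :=
  hf.integrable_smul_left_of_hasCompactSupport hφ.continuous hφ.2

end IsTestFunction

lemma partialDeriv_mul {φ b : E3 → ℝ} {x : E3} (hφ : DifferentiableAt ℝ φ x)
    (hb : DifferentiableAt ℝ b x) (j : Fin 3) :
    partialDeriv (fun y => φ y * b y) j x =
      φ x * partialDeriv b j x + b x * partialDeriv φ j x := by
  simp [partialDeriv, fderiv_fun_mul hφ hb]

/-! ### Square integrable fields -/

lemma L2Field.locallyIntegrable (f : L2Field) : LocallyIntegrable (fun x => f x) volume :=
  (Lp.memLp f).locallyIntegrable (by norm_num)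

lemma integrable_smul_of_memLp_two {φ : E3 → ℂ} {f : E3 → C3} (hφ : MemLp φ 2 volume)
    (hf : MemLp f 2 volume) : Integrable (fun x => φ x • f x) :=
  memLp_one_iff_integrable.1 (MemLp.smul (p := 2) (q := 2) (r := 1) hf hφ)

lemma integrable_smul_of_memLp_two' {φ : E3 → ℝ} {f : E3 → C3} (hφ : MemLp φ 2 volume)
    (hf : MemLp f 2 volume) : Integrable (fun x => φ x • f x) :=
  memLp_one_iff_integrable.1 (MemLp.smul (p := 2) (q := 2) (r := 1) hf hφ)

/-- The Fourier transform of `L²` is its own transpose, tested with Schwartz functions. -/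
lemma integral_fourier_smul_L2 (φ : 𝓢(E3, ℂ)) (f : L2Field) :
    ∫ x, (𝓕 φ) x • f x = ∫ x, φ x • (𝓕 f : L2Field) x := by
  have h := congrArg (fun T : 𝓢'(E3, C3) => T φ) (Lp.fourier_toTemperedDistribution_eq f)
  simpa using h

/-! ### First order systems with constant coefficients -/

/-- `g = ∑ⱼ ℓⱼ ∂ⱼ f` in the sense of distributions, where the coefficients `ℓⱼ` are constant. Curl,
divergence (as a multiple of a fixed vector), gradient and partial derivatives are of this form. -/
def IsWeakDeriv (ℓ : Fin 3 → C3 →L[ℂ] C3) (f g : E3 → C3) : Prop :=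
  ∀ φ : E3 → ℝ, IsTestFunction φ →
    ∫ x, φ x • g x = - ∫ x, ∑ j, partialDeriv φ j x • ℓ j (f x)

/-- The symbol of the system, up to the factor `2πi`. -/
def weakSymbol (ℓ : Fin 3 → C3 →L[ℂ] C3) (k : E3) (v : C3) : C3 :=
  ∑ j, ((k j : ℝ) : ℂ) • ℓ j v

variable {ℓ : Fin 3 → C3 →L[ℂ] C3}

lemma IsWeakDeriv.congr_ae {f g f' g' : E3 → C3} (h : IsWeakDeriv ℓ f g)
    (hf : f =ᵐ[volume] f') (hg : g =ᵐ[volume] g') : IsWeakDeriv ℓ f' g' := by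
  intro φ hφ
  rw [← integral_congr_ae (f := fun x => φ x • g x), h φ hφ, integral_congr_ae]
  · filter_upwards [hf] with x hx
    simp [hx]
  · filter_upwards [hg] with x hx
    simp [hx]

lemma memLp_comp_clm (L : C3 →L[ℂ] C3) {f : E3 → C3} (hf : MemLp f 2 volume) :
    MemLp (fun x => L (f x)) 2 volume := L.comp_memLp' hf

/-- A weak relation holds for complex-valued test functions. -/
lemma IsWeakDeriv.complex {f g : L2Field} (h : IsWeakDeriv ℓ f g) {φ : E3 → ℂ}
    (hφ : ContDiff ℝ ∞ φ) (hc : HasCompactSupport φ) :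
    ∫ x, φ x • g x = - ∫ x, ∑ j, (fderiv ℝ φ x (basisVec j)) • ℓ j (f x) := by
  have hre : IsTestFunction (fun x => (φ x).re) :=
    ⟨Complex.reCLM.contDiff.comp hφ, hc.comp_left (g := Complex.re) (by simp)⟩
  have him : IsTestFunction (fun x => (φ x).im) :=
    ⟨Complex.imCLM.contDiff.comp hφ, hc.comp_left (g := Complex.im) (by simp)⟩
  have hd : Differentiable ℝ φ := hφ.differentiable (by simp)
  have dre : ∀ j x, partialDeriv (fun x => (φ x).re) j x = (fderiv ℝ φ x (basisVec j)).re := by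
    intro j x
    have := (Complex.reCLM.hasFDerivAt.comp x (hd x).hasFDerivAt).fderiv
    simp only [partialDeriv]
    erw [this]
    simp
  have dim : ∀ j x, partialDeriv (fun x => (φ x).im) j x = (fderiv ℝ φ x (basisVec j)).im := by
    intro j x
    have := (Complex.imCLM.hasFDerivAt.comp x (hd x).hasFDerivAt).fderiv
    simp only [partialDeriv]
    erw [this]
    simp
  have key : ∀ (a : ℂ) (v : C3), a • v = a.re • v + Complex.I • (a.im • v) := by
    intro a v
    rw [← Complex.coe_smul a.re, ← Complex.coe_smul a.im, smul_smul, ← add_smul]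
    congr 1
    rw [mul_comm]
    exact (Complex.re_add_im a).symm
  have i1 : Integrable (fun x => (φ x).re • g x) :=
    hre.integrable_smul (L2Field.locallyIntegrable g)
  have i2 : Integrable (fun x => (φ x).im • g x) :=
    him.integrable_smul (L2Field.locallyIntegrable g)
  have j1 : Integrable (fun x => ∑ j, partialDeriv (fun x => (φ x).re) j x • ℓ j (f x)) :=
    integrable_finsetSum _ fun j _ => integrable_smul_of_memLp_two' ((hre.partialDeriv j).memLp 2)
      (memLp_comp_clm _ (Lp.memLp f))
  have j2 : Integrable (fun x => ∑ j, partialDeriv (fun x => (φ x).im) j x • ℓ j (f x)) :=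
    integrable_finsetSum _ fun j _ => integrable_smul_of_memLp_two' ((him.partialDeriv j).memLp 2)
      (memLp_comp_clm _ (Lp.memLp f))
  have e1 : (fun x => φ x • g x) = fun x => (φ x).re • g x + Complex.I • ((φ x).im • g x) := by
    funext x; exact key _ _
  have e2 : (fun x => ∑ j, (fderiv ℝ φ x (basisVec j)) • ℓ j (f x)) =
      fun x => (∑ j, partialDeriv (fun x => (φ x).re) j x • ℓ j (f x)) +
        Complex.I • ∑ j, partialDeriv (fun x => (φ x).im) j x • ℓ j (f x) := by
    funext x
    simp_rw [dre, dim, Finset.smul_sum, ← Finset.sum_add_distrib]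
    exact Finset.sum_congr rfl fun j _ => key _ _
  have i2' : Integrable (fun x => Complex.I • ((φ x).im • g x)) := i2.smul Complex.I
  have j2' : Integrable (fun x => Complex.I •
      ∑ j, partialDeriv (fun x => (φ x).im) j x • ℓ j (f x)) := j2.smul Complex.I
  rw [e1, e2, integral_add i1 i2', integral_add j1 j2', integral_smul, integral_smul, h _ hre,
    h _ him, smul_neg, neg_add]

/-- A weak relation between `L²` fields holds for Schwartz test functions: truncate. -/
lemma IsWeakDeriv.schwartz {f g : L2Field} (h : IsWeakDeriv ℓ f g) (Φ : 𝓢(E3, ℂ)) :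
    ∫ x, Φ x • g x = - ∫ x, ∑ j, (fderiv ℝ Φ x (basisVec j)) • ℓ j (f x) := by
  -- the test functions `χ (ε x) Φ x` converge to `Φ`, their gradients to that of `Φ`, as `ε → 0`
  let χ : ContDiffBump (0 : E3) := ⟨1, 2, by norm_num, by norm_num⟩
  have χsm : ContDiff ℝ ∞ χ := χ.contDiff
  have χc : HasCompactSupport χ := χ.hasCompactSupport
  obtain ⟨C, hC⟩ := (χsm.continuous_fderiv (by simp)).bounded_above_of_compact_support
    (χc.fderiv ℝ)
  let ε : ℕ → ℝ := fun n => 1 / ((n : ℝ) + 1)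
  have εpos : ∀ n, 0 < ε n := fun n => by positivity
  have εle : ∀ n, ε n ≤ 1 := fun n => by
    simp only [ε]
    rw [div_le_one (by positivity)]
    linarith [(Nat.cast_nonneg n : (0 : ℝ) ≤ n)]
  have ε0 : Tendsto ε atTop (𝓝 0) := tendsto_one_div_add_atTop_nhds_zero_nat
  let φ : ℕ → E3 → ℂ := fun n x => χ (ε n • x) • Φ x
  have Φd : ∀ x, DifferentiableAt ℝ Φ x := fun x => Φ.differentiableAt
  have hχd : ∀ n x, HasFDerivAt (fun x : E3 => χ (ε n • x)) (ε n • fderiv ℝ χ (ε n • x)) x := by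
    intro n x
    have h1 : HasFDerivAt (fun x : E3 => ε n • x) (ε n • ContinuousLinearMap.id ℝ E3) x :=
      (hasFDerivAt_id x).const_smul (ε n)
    have h2 := ((χsm.differentiable (by simp)) (ε n • x)).hasFDerivAt.comp x h1
    exact h2.congr_fderiv (by ext v; simp)
  have hφd : ∀ n x (v : E3), fderiv ℝ (φ n) x v =
      χ (ε n • x) • fderiv ℝ Φ x v + (ε n * fderiv ℝ χ (ε n • x) v) • Φ x := by
    intro n x v
    have h3 := ((hχd n x).smul (Φd x).hasFDerivAt).fderiv
    simp only [φ]
    erw [h3]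
    simp
  have hcomplex : ∀ n, ∫ x, φ n x • g x
      = - ∫ x, ∑ j, (fderiv ℝ (φ n) x (basisVec j)) • ℓ j (f x) := by
    intro n
    refine h.complex ?_ ?_
    · have h1 : ContDiff ℝ ∞ fun x : E3 => χ (ε n • x) := χsm.comp (contDiff_const_smul (ε n))
      have h2 : ContDiff ℝ ∞ (fun x => Φ x) := Φ.smooth ⊤
      exact h1.smul h2
    · have h1 : HasCompactSupport fun x : E3 => χ (ε n • x) :=
        χc.comp_homeomorph (Homeomorph.smulOfNeZero (ε n) (εpos n).ne')
      exact h1.smul_right (f' := fun x => Φ x)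
  have hlim : ∀ x : E3, Tendsto (fun n => χ (ε n • x)) atTop (𝓝 1) := by
    intro x
    have h0 : Tendsto (fun n => ε n • x) atTop (𝓝 0) := by
      simpa using ε0.smul_const x
    have h1 := (χ.continuous.tendsto 0).comp h0
    rwa [χ.one_of_mem_closedBall (by simp [χ.rIn_pos.le])] at h1
  have χ1 : ∀ y, ‖χ y‖ ≤ 1 := fun y => by
    rw [Real.norm_of_nonneg χ.nonneg]; exact χ.le_one
  have L1 : Tendsto (fun n => ∫ x, φ n x • g x) atTop (𝓝 (∫ x, Φ x • g x)) := by
    refine tendsto_integral_of_dominated_convergence (fun x => ‖Φ x • g x‖) ?_ ?_ ?_ ?_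
    · intro n
      refine AEStronglyMeasurable.smul (f := φ n) ?_ (Lp.aestronglyMeasurable g)
      exact ((χ.continuous.comp (continuous_const_smul (ε n))).smul
        Φ.continuous).aestronglyMeasurable
    · exact (integrable_smul_of_memLp_two (Φ.memLp 2 volume) (Lp.memLp g)).norm
    · intro n
      filter_upwards with x
      simp only [φ, norm_smul]
      have := χ1 (ε n • x)
      have h2 : 0 ≤ ‖Φ x‖ * ‖g x‖ := by positivity
      nlinarith
    · filter_upwards with x
      have h1 : Tendsto (fun n => χ (ε n • x) • Φ x) atTop (𝓝 ((1 : ℝ) • Φ x)) :=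
        (hlim x).smul tendsto_const_nhds
      have : Tendsto (fun n => (χ (ε n • x) • Φ x) • g x) atTop (𝓝 (((1 : ℝ) • Φ x) • g x)) :=
        h1.smul tendsto_const_nhds
      simpa [φ] using this
  have L2 : Tendsto (fun n => ∫ x, ∑ j, (fderiv ℝ (φ n) x (basisVec j)) • ℓ j (f x)) atTop
      (𝓝 (∫ x, ∑ j, (fderiv ℝ Φ x (basisVec j)) • ℓ j (f x))) := by
    have cΦ' : ∀ j, Continuous fun x => fderiv ℝ Φ x (basisVec j) := fun j =>
      ((Φ.smooth ⊤).continuous_fderiv (by simp)).clm_apply continuous_const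
    have C0 : 0 ≤ C := (norm_nonneg _).trans (hC 0)
    refine tendsto_integral_of_dominated_convergence
      (fun x => ∑ j, ((‖fderiv ℝ Φ x (basisVec j) • ℓ j (f x)‖) + C * ‖Φ x • ℓ j (f x)‖))
      ?_ ?_ ?_ ?_
    · intro n
      refine Finset.aestronglyMeasurable_fun_sum _ fun j _ => ?_
      refine AEStronglyMeasurable.smul (f := fun x => fderiv ℝ (φ n) x (basisVec j)) ?_
        (memLp_comp_clm (ℓ j) (Lp.memLp f)).1
      simp_rw [hφd]
      have c1 : Continuous fun x : E3 => χ (ε n • x) :=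
        χ.continuous.comp (continuous_const_smul (ε n))
      have c2 : Continuous fun x : E3 => fderiv ℝ χ (ε n • x) (basisVec j) :=
        ((χsm.continuous_fderiv (by simp)).comp (continuous_const_smul (ε n))).clm_apply
          continuous_const
      exact ((c1.smul (cΦ' j)).add ((continuous_const.mul c2).smul
        Φ.continuous)).aestronglyMeasurable
    · refine integrable_finsetSum _ fun j _ => Integrable.add ?_ (Integrable.const_mul ?_ C)
      · have : MemLp (fun x => fderiv ℝ Φ x (basisVec j)) 2 volume :=
          (SchwartzMap.memLp (LineDeriv.lineDerivOp (basisVec j) Φ : 𝓢(E3, ℂ)) 2 volume)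
        exact (integrable_smul_of_memLp_two this (memLp_comp_clm _ (Lp.memLp f))).norm
      · exact (integrable_smul_of_memLp_two (Φ.memLp 2 volume)
          (memLp_comp_clm _ (Lp.memLp f))).norm
    · intro n
      filter_upwards with x
      refine (norm_sum_le _ _).trans (Finset.sum_le_sum fun j _ => ?_)
      rw [hφd, add_smul]
      refine (norm_add_le _ _).trans (add_le_add ?_ ?_)
      · rw [norm_smul, norm_smul, norm_smul, mul_assoc]
        exact mul_le_of_le_one_left (by positivity) (χ1 _)
      · rw [norm_smul, norm_smul, norm_smul, mul_assoc, norm_mul]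
        have h1 : ‖fderiv ℝ χ (ε n • x) (basisVec j)‖ ≤ C := by
          refine (ContinuousLinearMap.le_opNorm _ _).trans ?_
          rw [norm_basisVec]
          simpa using hC (ε n • x)
        have h2 : ‖ε n‖ ≤ 1 := by rw [Real.norm_of_nonneg (εpos n).le]; exact εle n
        have : ‖ε n‖ * ‖fderiv ℝ χ (ε n • x) (basisVec j)‖ ≤ C := by
          nlinarith [norm_nonneg (ε n), norm_nonneg (fderiv ℝ χ (ε n • x) (basisVec j))]
        gcongr
    · filter_upwards with x
      refine tendsto_finsetSum _ fun j _ => ?_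
      refine Tendsto.smul_const ?_ _
      simp_rw [hφd]
      have h1 := (hlim x).smul_const (fderiv ℝ Φ x (basisVec j))
      have h2 : Tendsto (fun n => ε n * fderiv ℝ χ (ε n • x) (basisVec j)) atTop (𝓝 0) := by
        refine squeeze_zero_norm (a := fun n => ε n * C) ?_ (by simpa using ε0.mul_const C)
        intro n
        rw [norm_mul, Real.norm_of_nonneg (εpos n).le]
        refine mul_le_mul_of_nonneg_left ?_ (εpos n).le
        refine (ContinuousLinearMap.le_opNorm _ _).trans ?_
        rw [norm_basisVec]
        simpa using hC (ε n • x)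
      simpa using h1.add (h2.smul_const (Φ x))
  have L3 := L2.neg
  simp_rw [← hcomplex] at L3
  exact tendsto_nhds_unique L1 L3

lemma integrable_schwartz_smul (ψ : 𝓢(E3, ℂ)) (f : L2Field) (L : C3 →L[ℂ] C3) :
    Integrable (fun x => ψ x • L (f x)) :=
  integrable_smul_of_memLp_two (ψ.memLp 2 volume) (memLp_comp_clm L (Lp.memLp f))

/-- The derivatives of `𝓕 ψ` are Fourier transforms of Schwartz functions,
`∂ⱼ (𝓕 ψ) = 𝓕 (-2πi xⱼ ψ)`. -/
lemma exists_fderiv_fourier_eq (ψ : 𝓢(E3, ℂ)) (j : Fin 3) : ∃ χ : 𝓢(E3, ℂ),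
    (∀ x, χ x = -((2 * Real.pi * Complex.I : ℂ) * ((x j : ℝ) : ℂ)) * ψ x) ∧
    ∀ x, fderiv ℝ (𝓕 ψ : 𝓢(E3, ℂ)) x (basisVec j) = (𝓕 χ : 𝓢(E3, ℂ)) x := by
  have htg : (fun x : E3 => inner ℝ x (basisVec j)).HasTemperateGrowth := by fun_prop
  refine ⟨-(2 * Real.pi * Complex.I : ℂ) •
    SchwartzMap.smulLeftCLM ℂ (fun x : E3 => inner ℝ x (basisVec j)) ψ, fun x => ?_, fun x => ?_⟩
  · rw [smul_apply, SchwartzMap.smulLeftCLM_apply_apply htg]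
    simp [basisVec, EuclideanSpace.inner_single_right]
    ring
  · rw [← SchwartzMap.lineDerivOp_fourier_eq ψ (basisVec j)]
    rfl

/-- The distributional form of `𝓕 (∑ⱼ ℓⱼ ∂ⱼ f) = 2πi ∑ⱼ kⱼ ℓⱼ 𝓕 f`, tested with the Schwartz
function `ψ`. -/
lemma integral_fderiv_fourier_smul (ψ : 𝓢(E3, ℂ)) (f : L2Field) :
    ∫ x, ∑ j, (fderiv ℝ (𝓕 ψ : 𝓢(E3, ℂ)) x (basisVec j)) • ℓ j (f x) =
      - ∫ k, ψ k • ((2 * Real.pi * Complex.I : ℂ) • weakSymbol ℓ k ((𝓕 f : L2Field) k)) := by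
  choose χ hχ hd using exists_fderiv_fourier_eq ψ
  simp_rw [hd]
  rw [integral_finsetSum _ fun j _ => integrable_schwartz_smul _ f (ℓ j)]
  have h1 : ∀ j, ∫ x, (𝓕 (χ j) : 𝓢(E3, ℂ)) x • ℓ j (f x) =
      ∫ k, χ j k • ℓ j ((𝓕 f : L2Field) k) := by
    intro j
    have e1 : ∫ x, (𝓕 (χ j) : 𝓢(E3, ℂ)) x • ℓ j (f x) =
        ℓ j (∫ x, (𝓕 (χ j) : 𝓢(E3, ℂ)) x • f x) := by
      rw [← ContinuousLinearMap.integral_comp_comm]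
      · simp
      · exact integrable_schwartz_smul _ f (ContinuousLinearMap.id ℂ C3)
    have e2 : ∫ k, χ j k • ℓ j ((𝓕 f : L2Field) k) = ℓ j (∫ k, χ j k • (𝓕 f : L2Field) k) := by
      rw [← ContinuousLinearMap.integral_comp_comm]
      · simp
      · exact integrable_schwartz_smul _ _ (ContinuousLinearMap.id ℂ C3)
    rw [e1, e2, integral_fourier_smul_L2]
  simp_rw [h1]
  rw [← integral_finsetSum _ fun j _ => integrable_schwartz_smul _ _ (ℓ j), ← integral_neg]
  refine integral_congr_ae (ae_of_all _ fun k => ?_)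
  simp only [weakSymbol, Finset.smul_sum, ← Finset.sum_neg_distrib]
  refine Finset.sum_congr rfl fun j _ => ?_
  rw [hχ, smul_smul, smul_smul, ← neg_smul]
  congr 1
  ring

/-- A test function, as a complex-valued Schwartz function. -/
def IsTestFunction.toSchwartz {φ : E3 → ℝ} (hφ : IsTestFunction φ) : 𝓢(E3, ℂ) :=
  HasCompactSupport.toSchwartzMap (f := fun x => (φ x : ℂ))
    (hφ.2.comp_left (g := Complex.ofReal) (by simp)) (Complex.ofRealCLM.contDiff.comp hφ.1)

@[simp] lemma IsTestFunction.toSchwartz_apply {φ : E3 → ℝ} (hφ : IsTestFunction φ) (x : E3) :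
    hφ.toSchwartz x = (φ x : ℂ) := rfl

lemma IsTestFunction.fderiv_toSchwartz {φ : E3 → ℝ} (hφ : IsTestFunction φ) (x v : E3) :
    fderiv ℝ hφ.toSchwartz x v = ((fderiv ℝ φ x v : ℝ) : ℂ) := by
  have := (Complex.ofRealCLM.hasFDerivAt.comp x (hφ.differentiable x).hasFDerivAt).fderiv
  have h2 : (hφ.toSchwartz : E3 → ℂ) = Complex.ofRealCLM ∘ φ := rfl
  rw [h2]
  erw [this]
  simp

lemma L2Field.locallyIntegrable_weakSymbol (f : L2Field) :
    LocallyIntegrable (fun k => weakSymbol ℓ k (f k)) volume := by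
  unfold weakSymbol
  refine locallyIntegrable_finsetSum _ fun j _ => ?_
  have h1 : LocallyIntegrable (fun k => ℓ j (f k)) volume :=
    (memLp_comp_clm (ℓ j) (Lp.memLp f)).locallyIntegrable (by norm_num)
  have h2 : Continuous fun k : E3 => ((k j : ℝ) : ℂ) := by fun_prop
  rw [← locallyIntegrableOn_univ]
  exact (h1.locallyIntegrableOn univ).continuousOn_smul isOpen_univ.isLocallyClosed h2.continuousOn

/-- On the Fourier side a first-order system between `L²` fields is multiplication by its symbol.
-/
lemma IsWeakDeriv.fourier {f g : L2Field} (h : IsWeakDeriv ℓ f g) :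
    ∀ᵐ k, (𝓕 g : L2Field) k =
      (2 * Real.pi * Complex.I : ℂ) • weakSymbol ℓ k ((𝓕 f : L2Field) k) := by
  have hloc : LocallyIntegrable (fun k => (2 * Real.pi * Complex.I : ℂ) •
      weakSymbol ℓ k ((𝓕 f : L2Field) k)) volume :=
    LocallyIntegrable.smul (L2Field.locallyIntegrable_weakSymbol (ℓ := ℓ) (𝓕 f))
      (2 * Real.pi * Complex.I : ℂ)
  refine ae_eq_of_integral_contDiff_smul_eq (L2Field.locallyIntegrable _) hloc fun φ h1 h2 => ?_
  have hφ : IsTestFunction φ := ⟨h1, h2⟩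
  have e1 := integral_fourier_smul_L2 hφ.toSchwartz g
  rw [h.schwartz, integral_fderiv_fourier_smul, neg_neg] at e1
  simpa using e1.symm

lemma isWeakDeriv_of_fourier {f g : L2Field}
    (h : ∀ᵐ k, (𝓕 g : L2Field) k =
      (2 * Real.pi * Complex.I : ℂ) • weakSymbol ℓ k ((𝓕 f : L2Field) k)) :
    IsWeakDeriv ℓ f g := by
  intro φ hφ
  have e1 := integral_fourier_smul_L2 (𝓕⁻ hφ.toSchwartz) g
  have e2 := integral_fderiv_fourier_smul (ℓ := ℓ) (𝓕⁻ hφ.toSchwartz) f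
  rw [FourierTransform.fourier_fourierInv_eq] at e1 e2
  simp only [IsTestFunction.fderiv_toSchwartz, IsTestFunction.toSchwartz_apply,
    Complex.coe_smul] at e1 e2
  simp only [partialDeriv]
  rw [e1, e2, neg_neg]
  refine integral_congr_ae ?_
  filter_upwards [h] with k hk
  rw [hk]

/-! ### Vector algebra in `ℂ³` -/

/-- The bilinear cross product on `ℂ³`. -/
def cross (a b : C3) : C3 :=
  WithLp.toLp 2 (crossProduct (WithLp.ofLp a) (WithLp.ofLp b))

/-- The inclusion of `ℝ³` into `ℂ³`. -/
def complexify : E3 →ₗᵢ[ℝ] C3 where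
  toFun a := WithLp.toLp 2 fun i => ((a i : ℝ) : ℂ)
  map_add' a b := by ext i; simp
  map_smul' c a := by ext i; simp
  norm_map' a := by simp [EuclideanSpace.norm_eq]

@[simp] lemma complexify_apply (a : E3) (i : Fin 3) : complexify a i = ((a i : ℝ) : ℂ) := rfl

lemma cross_zero_apply (a b : C3) : cross a b 0 = a 1 * b 2 - a 2 * b 1 := by
  simp [cross, crossProduct]

lemma cross_one_apply (a b : C3) : cross a b 1 = a 2 * b 0 - a 0 * b 2 := by
  simp [cross, crossProduct]

lemma cross_two_apply (a b : C3) : cross a b 2 = a 0 * b 1 - a 1 * b 0 := by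
  simp [cross, crossProduct]

lemma C3.ext {a b : C3} (h0 : a 0 = b 0) (h1 : a 1 = b 1) (h2 : a 2 = b 2) : a = b := by
  ext i
  fin_cases i <;> assumption

lemma norm_coord_le (a : C3) (i : Fin 3) : ‖a i‖ ≤ ‖a‖ := PiLp.norm_apply_le a i

lemma norm_le_sum_coord (a : C3) : ‖a‖ ≤ ‖a 0‖ + ‖a 1‖ + ‖a 2‖ := by
  rw [EuclideanSpace.norm_eq, Fin.sum_univ_three]
  refine Real.sqrt_le_iff.2 ⟨by positivity, ?_⟩
  nlinarith [norm_nonneg (a 0), norm_nonneg (a 1), norm_nonneg (a 2),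
    mul_nonneg (norm_nonneg (a 0)) (norm_nonneg (a 1)),
    mul_nonneg (norm_nonneg (a 0)) (norm_nonneg (a 2)),
    mul_nonneg (norm_nonneg (a 1)) (norm_nonneg (a 2))]

lemma norm_cross_le (a b : C3) : ‖cross a b‖ ≤ 6 * (‖a‖ * ‖b‖) := by
  have h : ∀ i j, ‖a i * b j‖ ≤ ‖a‖ * ‖b‖ := fun i j => by
    rw [norm_mul]
    exact mul_le_mul (norm_coord_le a i) (norm_coord_le b j) (norm_nonneg _) (norm_nonneg _)
  have h2 : ∀ i j k l, ‖a i * b j - a k * b l‖ ≤ 2 * (‖a‖ * ‖b‖) := fun i j k l => by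
    have := norm_sub_le (a i * b j) (a k * b l)
    linarith [h i j, h k l]
  have := norm_le_sum_coord (cross a b)
  rw [cross_zero_apply, cross_one_apply, cross_two_apply] at this
  linarith [h2 1 2 2 1, h2 2 0 0 2, h2 0 1 1 0]

lemma cross_add_right (a b c : C3) : cross a (b + c) = cross a b + cross a c := by
  simp [cross]

lemma cross_smul_right (a b : C3) (s : ℂ) : cross a (s • b) = s • cross a b := by
  simp [cross]

lemma cross_smul_left (a b : C3) (s : ℂ) : cross (s • a) b = s • cross a b := by
  simp [cross]

/-- The cross product as a continuous linear map of its second argument. -/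
def crossL (a : C3) : C3 →L[ℂ] C3 :=
  LinearMap.toContinuousLinearMap
    { toFun := cross a
      map_add' := cross_add_right a
      map_smul' := fun s b => cross_smul_right a b s }

lemma continuous_cross : Continuous fun p : C3 × C3 => cross p.1 p.2 := by
  have h : ∀ i, Continuous fun p : C3 × C3 => cross p.1 p.2 i := by
    intro i
    fin_cases i
    · simp only [Fin.zero_eta, cross_zero_apply]; fun_prop
    · simp only [Fin.mk_one, cross_one_apply]; fun_prop
    · simp only [Fin.reduceFinMk, cross_two_apply]; fun_prop
  exact (PiLp.continuous_toLp 2 _).comp (continuous_pi h)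

lemma aestronglyMeasurable_cross {α : Type*} [MeasurableSpace α] {μ : Measure α}
    {f g : α → C3} (hf : AEStronglyMeasurable f μ) (hg : AEStronglyMeasurable g μ) :
    AEStronglyMeasurable (fun x => cross (f x) (g x)) μ := by
  have h : AEStronglyMeasurable (fun x => (f x, g x)) μ := hf.prodMk hg
  exact Continuous.comp_aestronglyMeasurable (g := fun p : C3 × C3 => cross p.1 p.2)
    (f := fun x => (f x, g x)) continuous_cross h

/-- The coefficients of the curl. -/
def curlSym (j : Fin 3) : C3 →L[ℂ] C3 := crossL (complexify (basisVec j))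

/-- The coefficients of the divergence, the value of the divergence being recorded in the first
component. -/
def divSym (j : Fin 3) : C3 →L[ℂ] C3 :=
  (EuclideanSpace.proj (𝕜 := ℂ) j).smulRight (complexify (basisVec 0))

/-- The coefficients of the gradient of the first component. -/
def gradSym (j : Fin 3) : C3 →L[ℂ] C3 :=
  (EuclideanSpace.proj (𝕜 := ℂ) (0 : Fin 3)).smulRight (complexify (basisVec j))

/-- The coefficients of the partial derivative `∂ᵢ`. -/
def partialSym (i j : Fin 3) : C3 →L[ℂ] C3 :=
  if j = i then ContinuousLinearMap.id ℂ C3 else 0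

lemma curlSym_apply (j : Fin 3) (v : C3) : curlSym j v = cross (complexify (basisVec j)) v := rfl

lemma divSym_apply (j : Fin 3) (v : C3) : divSym j v = v j • complexify (basisVec 0) := rfl

lemma gradSym_apply (j : Fin 3) (v : C3) : gradSym j v = v 0 • complexify (basisVec j) := rfl

lemma complexify_eq_sum (k : E3) :
    complexify k = ∑ j, ((k j : ℝ) : ℂ) • complexify (basisVec j) := by
  refine C3.ext ?_ ?_ ?_ <;> simp [Fin.sum_univ_three, basisVec]

lemma sum_curlSym (a : Fin 3 → ℂ) (v : C3) :
    ∑ j, a j • curlSym j v = cross (WithLp.toLp 2 a) v := by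
  simp only [curlSym_apply, Fin.sum_univ_three]
  refine C3.ext ?_ ?_ ?_ <;>
    simp [cross_zero_apply, cross_one_apply, cross_two_apply, basisVec] <;> ring

lemma weakSymbol_curl (k : E3) (v : C3) : weakSymbol curlSym k v = cross (complexify k) v :=
  sum_curlSym _ v

lemma weakSymbol_div (k : E3) (v : C3) :
    weakSymbol divSym k v = (∑ j, ((k j : ℝ) : ℂ) * v j) • complexify (basisVec 0) := by
  simp only [weakSymbol, divSym_apply, smul_smul, Finset.sum_smul]

lemma weakSymbol_grad (k : E3) (v : C3) : weakSymbol gradSym k v = v 0 • complexify k := by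
  rw [complexify_eq_sum, Finset.smul_sum]
  simp only [weakSymbol, gradSym_apply]
  exact Finset.sum_congr rfl fun j _ => smul_comm _ _ _

lemma weakSymbol_partial (i : Fin 3) (k : E3) (v : C3) :
    weakSymbol (partialSym i) k v = ((k i : ℝ) : ℂ) • v := by
  simp only [weakSymbol, partialSym]
  rw [Finset.sum_eq_single i] <;> simp +contextual

/-- The Fourier transform of the velocity at frequency `k`, as a function of that of the vorticity:
the multiplier `z ↦ i k × z / (2π|k|²)`, which inverts `v ↦ 2πi k × v` on the vectors orthogonal to
`k`. -/
def velocityMultiplier (k : E3) (z : C3) : C3 :=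
  (Complex.I * ((1 / (2 * Real.pi * ‖k‖ ^ 2) : ℝ) : ℂ)) • cross (complexify k) z

lemma norm_velocityMultiplier_le (k : E3) (z : C3) :
    ‖velocityMultiplier k z‖ ≤ ‖k‖⁻¹ * ‖z‖ := by
  rw [velocityMultiplier, norm_smul, norm_mul, Complex.norm_I, one_mul, Complex.norm_real,
    Real.norm_of_nonneg (by positivity)]
  rcases eq_or_ne k 0 with rfl | hk
  · simp
  have hk' : 0 < ‖k‖ := norm_pos_iff.2 hk
  have h := norm_cross_le (complexify k) z
  rw [complexify.norm_map] at h
  calc _ ≤ 1 / (2 * Real.pi * ‖k‖ ^ 2) * (6 * (‖k‖ * ‖z‖)) := by gcongr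
    _ = (3 / Real.pi) * (‖k‖⁻¹ * ‖z‖) := by field_simp; ring
    _ ≤ 1 * (‖k‖⁻¹ * ‖z‖) := by
        gcongr
        rw [div_le_one Real.pi_pos]
        exact Real.pi_gt_three.le
    _ = _ := one_mul _

lemma norm_sq_eq_sum (k : E3) : ‖k‖ ^ 2 = k 0 ^ 2 + k 1 ^ 2 + k 2 ^ 2 := by
  rw [EuclideanSpace.norm_sq_eq, Fin.sum_univ_three]; simp

lemma cross_cross_self (k : E3) (v : C3) : cross (complexify k) (cross (complexify k) v) =
    (∑ j, ((k j : ℝ) : ℂ) * v j) • complexify k - ((‖k‖ ^ 2 : ℝ) : ℂ) • v := by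
  rw [norm_sq_eq_sum]
  refine C3.ext ?_ ?_ ?_ <;>
    simp [cross_zero_apply, cross_one_apply, cross_two_apply, Fin.sum_univ_three] <;> ring

/-- On vectors orthogonal to `k` the velocity multiplier is a right inverse of the symbol of the
curl. -/
lemma cross_velocityMultiplier {k : E3} (hk : k ≠ 0) {z : C3}
    (hz : ∑ j, ((k j : ℝ) : ℂ) * z j = 0) :
    (2 * Real.pi * Complex.I : ℂ) • cross (complexify k) (velocityMultiplier k z) = z := by
  have hk' : ((‖k‖ : ℝ) : ℂ) ≠ 0 := by simpa using hk
  have hpi : (Real.pi : ℂ) ≠ 0 := by simp [Real.pi_ne_zero]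
  rw [velocityMultiplier, cross_smul_right, cross_cross_self, hz, zero_smul, zero_sub, smul_neg,
    smul_neg, smul_smul, smul_smul, ← neg_smul]
  convert one_smul ℂ z using 2
  push_cast
  field_simp
  simp

/-- On vectors orthogonal to `k` the velocity multiplier is a left inverse of the symbol of the
curl. -/
lemma velocityMultiplier_cross {k : E3} (hk : k ≠ 0) {v : C3}
    (hv : ∑ j, ((k j : ℝ) : ℂ) * v j = 0) :
    velocityMultiplier k ((2 * Real.pi * Complex.I : ℂ) • cross (complexify k) v) = v := by
  have h := cross_velocityMultiplier hk hv
  rw [velocityMultiplier, cross_smul_right] at h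
  rwa [velocityMultiplier, cross_smul_right, smul_comm]

lemma dot_velocityMultiplier (k : E3) (z : C3) :
    ∑ j, ((k j : ℝ) : ℂ) * velocityMultiplier k z j = 0 := by
  simp [velocityMultiplier, Fin.sum_univ_three, cross_zero_apply, cross_one_apply, cross_two_apply]
  ring

/-! ### Gaussians -/

/-- A Gamma integral representing `r⁻³` as a superposition of Gaussians in `r`. -/
lemma integral_sqrt_mul_exp {r : ℝ} (hr : 0 < r) :
    ∫ u in Ioi (0 : ℝ), u ^ (1 / 2 : ℝ) * Real.exp (-(Real.pi * r ^ 2 * u)) =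
      1 / (2 * Real.pi * r ^ 3) := by
  have h := Real.integral_rpow_mul_exp_neg_mul_Ioi (a := 3 / 2) (r := Real.pi * r ^ 2)
    (by norm_num) (by positivity)
  have hG : Real.Gamma (3 / 2) = √Real.pi / 2 := by
    have := Real.Gamma_add_one (s := 1 / 2) (by norm_num)
    rw [Real.Gamma_one_half_eq] at this
    rw [show (3 / 2 : ℝ) = 1 / 2 + 1 by norm_num, this]
    ring
  have e : (3 / 2 - 1 : ℝ) = 1 / 2 := by norm_num
  rw [e] at h
  rw [h, hG]
  have e2 : (1 / (Real.pi * r ^ 2)) ^ (3 / 2 : ℝ) = 1 / (Real.pi * √Real.pi * r ^ 3) := by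
    rw [show (3 / 2 : ℝ) = 1 + 1 / 2 by norm_num, Real.rpow_add (by positivity), Real.rpow_one,
      ← Real.sqrt_eq_rpow, Real.sqrt_div zero_le_one, Real.sqrt_mul Real.pi_pos.le,
      Real.sqrt_sq hr.le, Real.sqrt_one]
    field_simp
  rw [e2]
  have : √Real.pi ≠ 0 := by positivity
  field_simp

lemma integrable_sqrt_mul_exp {r : ℝ} (hr : 0 < r) :
    Integrable (fun u : ℝ => u ^ (1 / 2 : ℝ) * Real.exp (-(Real.pi * r ^ 2 * u)))
      (volume.restrict (Ioi 0)) :=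
  .of_integral_ne_zero (by rw [integral_sqrt_mul_exp hr]; positivity)

/-- The substitution `v = u⁻¹` in `∫₀^∞ e^{-a v} dv`; it represents `|k|⁻²` as a superposition of
Gaussians. -/
lemma integral_inv_sq_mul_exp {a : ℝ} (ha : 0 < a) :
    ∫ u in Ioi (0 : ℝ), u ^ (-2 : ℝ) * Real.exp (-(a * u⁻¹)) = 1 / a := by
  have h := integral_comp_rpow_Ioi (fun v : ℝ => Real.exp (-(a * v))) (p := -1) (by norm_num)
  have h1 : ∫ v in Ioi (0 : ℝ), Real.exp (-(a * v)) = 1 / a := by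
    have := integral_exp_neg_mul_rpow (p := 1) (b := a) (by norm_num) ha
    simp only [Real.rpow_one, neg_mul] at this
    rw [this]
    simp [Real.rpow_neg_one, one_add_one_eq_two]
  rw [← h1, ← h]
  refine setIntegral_congr_fun measurableSet_Ioi fun u hu => ?_
  simp only [abs_neg, abs_one, one_mul, smul_eq_mul, Real.rpow_neg_one]
  norm_num

lemma integrable_inv_sq_mul_exp {a : ℝ} (ha : 0 < a) :
    Integrable (fun u : ℝ => u ^ (-2 : ℝ) * Real.exp (-(a * u⁻¹))) (volume.restrict (Ioi 0)) :=
  .of_integral_ne_zero (by rw [integral_inv_sq_mul_exp ha]; positivity)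

lemma integrable_norm_pow_mul_gaussian (n : ℕ) {b : ℝ} (hb : 0 < b) :
    Integrable (fun v : E3 => ‖v‖ ^ n * Real.exp (-b * ‖v‖ ^ 2)) := by
  rw [integrable_fun_norm_addHaar volume (f := fun r : ℝ => r ^ n * Real.exp (-b * r ^ 2))]
  have h := integrableOn_rpow_mul_exp_neg_mul_sq hb (s := (2 + n : ℕ))
    (by have : (0 : ℝ) ≤ (2 + n : ℕ) := Nat.cast_nonneg _; linarith)
  refine h.congr_fun (fun r _ => ?_) measurableSet_Ioi
  simp only [Real.rpow_natCast, finrank_euclideanSpace, Fintype.card_fin, smul_eq_mul]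
  ring

/-- A modulated Gaussian. -/
def modGaussian (u : ℝ) (x v : E3) : ℂ :=
  Complex.exp (-((Real.pi / u : ℝ) : ℂ) * (‖v‖ : ℂ) ^ 2
    + 2 * Real.pi * Complex.I * ((inner ℝ x v : ℝ) : ℂ))

lemma norm_modGaussian (u : ℝ) (x v : E3) :
    ‖modGaussian u x v‖ = Real.exp (-(Real.pi / u) * ‖v‖ ^ 2) := by
  rw [modGaussian, Complex.norm_exp]
  congr 1
  have h1 : (-((Real.pi / u : ℝ) : ℂ) * (‖v‖ : ℂ) ^ 2) =
      ((-(Real.pi / u) * ‖v‖ ^ 2 : ℝ) : ℂ) := by push_cast; ring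
  have h2 : (2 * Real.pi * Complex.I * ((inner ℝ x v : ℝ) : ℂ)) =
      ((2 * Real.pi * inner ℝ x v : ℝ) : ℂ) * Complex.I := by push_cast; ring
  rw [h1, h2, Complex.add_re, Complex.ofReal_re, Complex.re_ofReal_mul]
  simp

lemma modGaussian_eq (u : ℝ) (x v : E3) : modGaussian u x v =
    ((Real.exp (-(Real.pi * ‖v‖ ^ 2 * u⁻¹)) : ℝ) : ℂ) * Real.fourierChar (inner ℝ v x) := by
  rw [modGaussian, Complex.exp_add, Real.fourierChar_apply, real_inner_comm]
  push_cast
  congr 2 <;> ring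

lemma continuous_modGaussian (u : ℝ) (x : E3) : Continuous (modGaussian u x) := by
  unfold modGaussian
  fun_prop

lemma fourier_modGaussian {u : ℝ} (hu : 0 < u) (x w : E3) :
    𝓕 (modGaussian u x) w =
      ((u ^ (3 / 2 : ℝ) * Real.exp (-(Real.pi * u) * ‖x - w‖ ^ 2) : ℝ) : ℂ) := by
  have h := fourier_gaussian_innerProductSpace' (b := ((Real.pi / u : ℝ) : ℂ))
    (by rw [Complex.ofReal_re]; positivity) x w
  refine Eq.trans h ?_
  have e1 : ((Real.pi : ℂ) / ((Real.pi / u : ℝ) : ℂ)) = ((u : ℝ) : ℂ) := by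
    push_cast
    field_simp [Real.pi_ne_zero, hu.ne']
  rw [e1]
  have e2 : ((Module.finrank ℝ E3 : ℂ) / 2) = ((3 / 2 : ℝ) : ℂ) := by simp
  rw [e2, ← Complex.ofReal_cpow hu.le]
  push_cast
  congr 2
  field_simp

lemma integrable_norm_pow_mul_modGaussian (n : ℕ) {u : ℝ} (hu : 0 < u) (x : E3) :
    Integrable (fun v => ‖v‖ ^ n * ‖modGaussian u x v‖) := by
  simp_rw [norm_modGaussian]
  exact integrable_norm_pow_mul_gaussian n (by positivity)

lemma integrable_modGaussian {u : ℝ} (hu : 0 < u) (x : E3) : Integrable (modGaussian u x) := by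
  have := integrable_norm_pow_mul_modGaussian 0 hu x
  simp only [pow_zero, one_mul] at this
  exact (integrable_norm_iff (continuous_modGaussian u x).aestronglyMeasurable).1 this

lemma memLp_coord_mul_gaussian {b : ℝ} (hb : 0 < b) (j : Fin 3) {ψ : E3 → ℂ} (hψ : Continuous ψ)
    (h : ∀ v, ‖ψ v‖ ≤ Real.exp (-b * ‖v‖ ^ 2)) :
    Integrable (fun v : E3 => ((v j : ℝ) : ℂ) * ψ v) ∧
      MemLp (fun v : E3 => ((v j : ℝ) : ℂ) * ψ v) 2 volume := by
  have hc : Continuous (fun v : E3 => ((v j : ℝ) : ℂ) * ψ v) := by fun_prop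
  have hn : ∀ v : E3, ‖((v j : ℝ) : ℂ) * ψ v‖ ≤ ‖v‖ * Real.exp (-b * ‖v‖ ^ 2) := by
    intro v
    rw [norm_mul, Complex.norm_real]
    exact mul_le_mul (PiLp.norm_apply_le v j) (h v) (norm_nonneg _) (norm_nonneg _)
  constructor
  · refine (integrable_norm_pow_mul_gaussian 1 hb).mono' hc.aestronglyMeasurable
      (ae_of_all _ fun v => ?_)
    simpa using hn v
  · rw [memLp_two_iff_integrable_sq_norm hc.aestronglyMeasurable]
    refine (integrable_norm_pow_mul_gaussian 2 (b := 2 * b) (by positivity)).mono'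
      (by fun_prop) (ae_of_all _ fun v => ?_)
    rw [Real.norm_of_nonneg (by positivity)]
    calc _ ≤ (‖v‖ * Real.exp (-b * ‖v‖ ^ 2)) ^ 2 := by gcongr; exact hn v
      _ = _ := by rw [mul_pow, ← Real.exp_nat_mul]; congr 2; push_cast; ring

lemma fourier_coord_mul_modGaussian {u : ℝ} (hu : 0 < u) (x w : E3) (j : Fin 3) :
    𝓕 (fun v : E3 => ((v j : ℝ) : ℂ) * modGaussian u x v) w =
      Complex.I *
        ((u ^ (5 / 2 : ℝ) * ((x - w) j * Real.exp (-(Real.pi * u) * ‖x - w‖ ^ 2)) : ℝ) : ℂ) := by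
  have h1 : Integrable (fun v => ‖v‖ * ‖modGaussian u x v‖) := by
    simpa using integrable_norm_pow_mul_modGaussian 1 hu x
  have h := Real.hasFDerivAt_fourier (integrable_modGaussian hu x) h1 w
  have hd : HasFDerivAt (fun w : E3 => -(Real.pi * u) * ‖x - w‖ ^ 2)
      ((2 * Real.pi * u) • innerSL ℝ (x - w)) w := by
    have h0 : HasFDerivAt (fun w : E3 => x - w) (-ContinuousLinearMap.id ℝ E3) w :=
      (hasFDerivAt_id w).const_sub x
    refine (h0.norm_sq.const_mul (-(Real.pi * u))).congr_fderiv ?_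
    ext v
    simp
    ring
  have hd2 := Complex.ofRealCLM.hasFDerivAt.comp w (hd.exp.const_mul (u ^ (3 / 2 : ℝ)))
  have hfun : (𝓕 (modGaussian u x)) = fun w : E3 =>
      ((u ^ (3 / 2 : ℝ) * Real.exp (-(Real.pi * u) * ‖x - w‖ ^ 2) : ℝ) : ℂ) :=
    funext fun w => fourier_modGaussian hu x w
  rw [hfun] at h
  have he := congrArg (fun L : E3 →L[ℝ] ℂ => L (basisVec j)) (h.unique hd2)
  have hint : Integrable (VectorFourier.fourierSMulRight (innerSL ℝ) (modGaussian u x)) := by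
    refine (h1.const_mul (2 * Real.pi * ‖innerSL (E := E3) ℝ‖)).mono'
      ((continuous_modGaussian u x).aestronglyMeasurable.fourierSMulRight) (ae_of_all _ fun v => ?_)
    refine (VectorFourier.norm_fourierSMulRight_le _ _ _).trans (le_of_eq (by ring))
  have e1 : 𝓕 (VectorFourier.fourierSMulRight (innerSL ℝ) (modGaussian u x)) w (basisVec j) =
      -(2 * Real.pi * Complex.I) * 𝓕 (fun v : E3 => ((v j : ℝ) : ℂ) * modGaussian u x v) w := by
    rw [Real.fourier_continuousLinearMap_apply hint]
    simp only [Real.fourier_eq]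
    rw [← integral_const_mul]
    refine integral_congr_ae (ae_of_all _ fun v => ?_)
    have hv : innerSL ℝ v (basisVec j) = v j := by
      simp [basisVec, EuclideanSpace.inner_single_right]
    simp only [VectorFourier.fourierSMulRight_apply, hv, Circle.smul_def, smul_eq_mul,
      Complex.real_smul]
    ring
  rw [e1] at he
  have hv : innerSL ℝ (x - w) (basisVec j) = (x - w) j := by
    rw [innerSL_apply_apply, basisVec, EuclideanSpace.inner_single_right]
    simp
  have e2 : (Complex.ofRealCLM ∘SL (u ^ (3 / 2 : ℝ) • Real.exp (-(Real.pi * u) * ‖x - w‖ ^ 2) •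
      (2 * Real.pi * u) • innerSL ℝ (x - w))) (basisVec j) = ((u ^ (3 / 2 : ℝ) *
        (Real.exp (-(Real.pi * u) * ‖x - w‖ ^ 2) * ((2 * Real.pi * u) * (x - w) j)) : ℝ) : ℂ) := by
    rw [← hv]
    rfl
  rw [e2] at he
  have h52 : u ^ (5 / 2 : ℝ) = u ^ (3 / 2 : ℝ) * u := by
    rw [show (5 / 2 : ℝ) = 3 / 2 + 1 by norm_num, Real.rpow_add hu, Real.rpow_one]
  have hpi : (2 * Real.pi * Complex.I : ℂ) ≠ 0 := by simp [Real.pi_ne_zero]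
  refine mul_left_cancel₀ (neg_ne_zero.2 hpi) (he.trans ?_)
  rw [h52]
  push_cast
  linear_combination (2 * Real.pi * (u : ℂ) * (((x - w) j : ℝ) : ℂ) * ((u ^ (3 / 2 : ℝ) : ℝ) : ℂ) *
    Complex.exp (-(Real.pi * u) * (‖x - w‖ : ℂ) ^ 2)) * Complex.I_sq

/-- The Fourier transform is its own transpose on `L²`, tested with an integrable and square
integrable function whose Fourier integral is square integrable. -/
lemma integral_fourierIntegral_smul_L2 {ψ : E3 → ℂ} (h1 : Integrable ψ) (h2 : MemLp ψ 2 volume)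
    (h3 : MemLp (𝓕 ψ) 2 volume) (f : L2Field) :
    ∫ x, 𝓕 ψ x • f x = ∫ k, ψ k • (𝓕 f : L2Field) k := by
  have key : ∀ {χ : E3 → ℂ} (hχ : MemLp χ 2 volume) (f : L2Field), ∫ x, χ x • f x =
      (ContinuousLinearMap.lsmul ℂ ℂ : ℂ →L[ℂ] C3 →L[ℂ] C3).lpPairing volume 2 2 (hχ.toLp χ) f := by
    intro χ hχ f
    rw [ContinuousLinearMap.lpPairing_eq_integral]
    refine integral_congr_ae ?_
    filter_upwards [hχ.coeFn_toLp] with x hx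
    simp [hx]
  refine DenseRange.induction_on (p := fun f : L2Field => ∫ x, 𝓕 ψ x • f x =
    ∫ k, ψ k • (𝓕 f : L2Field) k) (SchwartzMap.denseRange_toLpCLM (p := 2) ENNReal.ofNat_ne_top) f
    ?_ ?_
  · refine isClosed_eq ?_ ?_
    · simp_rw [key h3]
      fun_prop
    · simp_rw [key h2]
      exact (ContinuousLinearMap.continuous _).comp (FourierTransform.continuous_fourier)
  · intro g
    have e1 : ∫ x, 𝓕 ψ x • ((SchwartzMap.toLpCLM ℝ C3 2 volume g : L2Field) : E3 → C3) x =
        ∫ x, 𝓕 ψ x • g x := by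
      refine integral_congr_ae ?_
      filter_upwards [g.coeFn_toLp 2 volume] with x hx
      simp [hx]
    have e2 : ∫ x, ψ x • ((𝓕 (SchwartzMap.toLpCLM ℝ C3 2 volume g : L2Field) : L2Field) : E3 → C3) x
        = ∫ x, ψ x • 𝓕 (g : E3 → C3) x := by
      refine integral_congr_ae ?_
      have := (𝓕 g).coeFn_toLp 2 volume
      rw [← SchwartzMap.toLp_fourier_eq] at this
      filter_upwards [this] with x hx
      rw [SchwartzMap.toLpCLM_apply, hx]
      rfl
    rw [e1, e2]
    simpa using! VectorFourier.integral_fourierIntegral_smul_eq_flip (L := innerₗ E3)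
      (μ := volume) (ν := volume) Real.continuous_fourierChar continuous_inner h1 g.integrable

/-! ### The Biot–Savart operator as a Fourier multiplier -/

lemma memLp_fourier_coord_mul_modGaussian {u : ℝ} (hu : 0 < u) (x : E3) (j : Fin 3) :
    MemLp (𝓕 (fun v : E3 => ((v j : ℝ) : ℂ) * modGaussian u x v)) 2 volume := by
  have hfun : 𝓕 (fun v : E3 => ((v j : ℝ) : ℂ) * modGaussian u x v) = fun w =>
      (Complex.I * ((u ^ (5 / 2 : ℝ) : ℝ) : ℂ)) * (fun y : E3 => ((y j : ℝ) : ℂ) *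
        ((Real.exp (-(Real.pi * u) * ‖y‖ ^ 2) : ℝ) : ℂ)) (x - w) := by
    funext w
    rw [fourier_coord_mul_modGaussian hu]
    push_cast
    ring
  rw [hfun]
  have h : MemLp (fun y : E3 => ((y j : ℝ) : ℂ) *
      ((Real.exp (-(Real.pi * u) * ‖y‖ ^ 2) : ℝ) : ℂ)) 2 volume :=
    (memLp_coord_mul_gaussian (b := Real.pi * u) (by positivity) j
      (ψ := fun y : E3 => ((Real.exp (-(Real.pi * u) * ‖y‖ ^ 2) : ℝ) : ℂ)) (by fun_prop)
      fun v => by rw [Complex.norm_real, Real.norm_of_nonneg (Real.exp_pos _).le]).2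
  exact (h.comp_measurePreserving (Measure.measurePreserving_sub_left volume x)).const_mul _

/-- Parseval for the Biot–Savart integral with its kernel replaced by a single Gaussian:
`y e^{-πu|y|²}` is, up to a constant and a power of `u`,
the Fourier transform of `k e^{-π|k|²/u}`. -/
lemma integral_gaussian_cross {u : ℝ} (hu : 0 < u) (x : E3) (ζ : L2Field) :
    ∫ y, Real.exp (-(Real.pi * ‖y‖ ^ 2 * u)) • cross (complexify y) (ζ (x - y)) =
      ∫ k, (-Complex.I * ((u ^ (-5 / 2 : ℝ) : ℝ) : ℂ) * modGaussian u x k) •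
        cross (complexify k) ((𝓕 ζ : L2Field) k) := by
  set ψ : Fin 3 → E3 → ℂ := fun j v => ((v j : ℝ) : ℂ) * modGaussian u x v with hψ
  have hψ12 : ∀ j, Integrable (ψ j) ∧ MemLp (ψ j) 2 volume := fun j =>
    memLp_coord_mul_gaussian (b := Real.pi / u) (by positivity) j (continuous_modGaussian u x)
      fun v => (norm_modGaussian u x v).le
  have hψ3 : ∀ j, MemLp (𝓕 (ψ j)) 2 volume := memLp_fourier_coord_mul_modGaussian hu x
  have hu5 : (((u ^ (-5 / 2 : ℝ) : ℝ) : ℂ)) * ((u ^ (5 / 2 : ℝ) : ℝ) : ℂ) = 1 := by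
    rw [← Complex.ofReal_mul, ← Real.rpow_add hu]
    norm_num
  -- substitute `w = x - y`, so that `ζ` is evaluated at the variable of integration
  rw [← integral_sub_left_eq_self _ volume x]
  have e1 : ∀ w, Real.exp (-(Real.pi * ‖x - w‖ ^ 2 * u)) •
      cross (complexify (x - w)) (ζ (x - (x - w))) =
      (-Complex.I * ((u ^ (-5 / 2 : ℝ) : ℝ) : ℂ)) • ∑ j, 𝓕 (ψ j) w • curlSym j (ζ w) := by
    intro w
    rw [sub_sub_cancel, sum_curlSym, ← cross_smul_left, ← Complex.coe_smul, ← cross_smul_left]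
    congr 1
    ext j
    simp only [hψ, PiLp.smul_apply, complexify_apply, smul_eq_mul]
    rw [fourier_coord_mul_modGaussian hu, show -(Real.pi * u) * ‖x - w‖ ^ 2 =
      -(Real.pi * ‖x - w‖ ^ 2 * u) by ring, Complex.ofReal_mul (u ^ (5 / 2 : ℝ)),
      Complex.ofReal_mul]
    linear_combination (-((Real.exp (-(Real.pi * ‖x - w‖ ^ 2 * u)) : ℝ) : ℂ) *
      (((x - w) j : ℝ) : ℂ)) * hu5 + (((u ^ (-5 / 2 : ℝ) : ℝ) : ℂ)) * ((u ^ (5 / 2 : ℝ) : ℝ) : ℂ) *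
      ((Real.exp (-(Real.pi * ‖x - w‖ ^ 2 * u)) : ℝ) : ℂ) * (((x - w) j : ℝ) : ℂ) * Complex.I_sq
  have e2 : ∀ k, (-Complex.I * ((u ^ (-5 / 2 : ℝ) : ℝ) : ℂ) * modGaussian u x k) •
        cross (complexify k) ((𝓕 ζ : L2Field) k) =
      (-Complex.I * ((u ^ (-5 / 2 : ℝ) : ℝ) : ℂ)) •
        ∑ j, ψ j k • curlSym j ((𝓕 ζ : L2Field) k) := by
    intro k
    rw [sum_curlSym, ← cross_smul_left, ← cross_smul_left]
    congr 1
    ext j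
    simp only [hψ, PiLp.smul_apply, complexify_apply, smul_eq_mul]
    ring
  simp_rw [e1, e2]
  rw [integral_smul, integral_smul, integral_finsetSum, integral_finsetSum]
  · congr 1
    refine Finset.sum_congr rfl fun j _ => ?_
    have h1 : ∫ w, 𝓕 (ψ j) w • curlSym j (ζ w) = curlSym j (∫ w, 𝓕 (ψ j) w • ζ w) := by
      rw [← ContinuousLinearMap.integral_comp_comm]
      · simp
      · exact integrable_smul_of_memLp_two (hψ3 j) (Lp.memLp ζ)
    have h2 : ∫ k, ψ j k • curlSym j ((𝓕 ζ : L2Field) k) =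
        curlSym j (∫ k, ψ j k • (𝓕 ζ : L2Field) k) := by
      rw [← ContinuousLinearMap.integral_comp_comm]
      · simp
      · exact integrable_smul_of_memLp_two (hψ12 j).2 (Lp.memLp _)
    rw [h1, h2, integral_fourierIntegral_smul_L2 (hψ12 j).1 (hψ12 j).2 (hψ3 j)]
  · exact fun j _ => integrable_smul_of_memLp_two (hψ12 j).2 (memLp_comp_clm _ (Lp.memLp _))
  · exact fun j _ => integrable_smul_of_memLp_two (hψ3 j) (memLp_comp_clm _ (Lp.memLp _))

lemma aestronglyMeasurable_cross_shift (ζ : L2Field) (x : E3) :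
    AEStronglyMeasurable (fun y => cross (complexify y) (ζ (x - y))) volume :=
  aestronglyMeasurable_cross complexify.continuous.aestronglyMeasurable
    ((Lp.aestronglyMeasurable ζ).comp_measurePreserving
      (Measure.measurePreserving_sub_left volume x))

lemma ae_ne_zero : ∀ᵐ y : E3, y ≠ 0 := by
  simp [ae_iff, measure_singleton]

/-- Absolute convergence of a superposition `∫∫ κ(y, u) h(y) du dy`, to justify exchanging the two
integrals: it suffices that `K h` is integrable, where `K = ∫ κ(·, u) du` and `κ ≥ 0`. -/
lemma integrable_kernel_smul {κ : E3 → ℝ → ℝ} {K : E3 → ℝ} {h : E3 → C3}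
    (mκ : Measurable fun p : E3 × ℝ => κ p.1 p.2) (pos : ∀ y, ∀ u ∈ Ioi (0 : ℝ), 0 ≤ κ y u)
    (hi : ∀ y ≠ 0, Integrable (κ y) (volume.restrict (Ioi 0)))
    (hK : ∀ y ≠ 0, ∫ u in Ioi (0 : ℝ), κ y u = K y) (mh : AEStronglyMeasurable h volume)
    (hint : Integrable fun y => K y * ‖h y‖) :
    Integrable (fun p : E3 × ℝ => κ p.1 p.2 • h p.1) (volume.prod (volume.restrict (Ioi 0))) := by
  have mF : AEStronglyMeasurable (fun p : E3 × ℝ => κ p.1 p.2 • h p.1)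
      (volume.prod (volume.restrict (Ioi 0))) := mκ.aestronglyMeasurable.smul mh.comp_fst
  rw [integrable_prod_iff mF]
  constructor
  · filter_upwards [ae_ne_zero] with y hy
    exact (hi y hy).smul_const _
  · refine hint.congr ?_
    filter_upwards [ae_ne_zero] with y hy
    simp only [norm_smul]
    rw [integral_mul_const, setIntegral_congr_fun measurableSet_Ioi
      fun u hu => Real.norm_of_nonneg (pos y u hu), hK y hy]

lemma integrable_mul_norm_cross {K : E3 → ℝ} {f : E3 → C3} {n : ℕ} (mK : Measurable K)
    (hK0 : ∀ y, 0 ≤ K y) (hK : ∀ y ≠ 0, K y ≤ ‖y‖⁻¹ ^ (n + 1)) (mf : AEStronglyMeasurable f volume)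
    (hf : Integrable fun y => ‖y‖⁻¹ ^ n * ‖f y‖) :
    Integrable fun y => K y * ‖cross (complexify y) (f y)‖ := by
  have mc : AEStronglyMeasurable (fun y => cross (complexify y) (f y)) volume :=
    aestronglyMeasurable_cross complexify.continuous.aestronglyMeasurable mf
  refine (hf.const_mul 6).mono' (mK.aestronglyMeasurable.mul mc.norm) ?_
  filter_upwards [ae_ne_zero] with y hy
  have hy' := norm_pos_iff.2 hy
  have h0 := hK0 y
  rw [Real.norm_of_nonneg (by positivity)]
  have hc := norm_cross_le (complexify y) (f y)
  rw [complexify.norm_map] at hc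
  calc K y * ‖cross (complexify y) (f y)‖
      ≤ ‖y‖⁻¹ ^ (n + 1) * (6 * (‖y‖ * ‖f y‖)) :=
        mul_le_mul (hK y hy) hc (norm_nonneg _) (by positivity)
    _ = 6 * (‖y‖⁻¹ ^ n * ‖f y‖) := by
        rw [pow_succ]
        field_simp

/-- The Gaussians whose superposition is the Biot–Savart kernel `1 / (4π|y|³)`. -/
def physKernel (y : E3) (u : ℝ) : ℝ :=
  (1 / 2) * (u ^ (1 / 2 : ℝ) * Real.exp (-(Real.pi * ‖y‖ ^ 2 * u)))

/-- The Fourier side of `physKernel`. -/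
def freqKernel (k : E3) (u : ℝ) : ℝ :=
  u ^ (-2 : ℝ) * Real.exp (-(Real.pi * ‖k‖ ^ 2 * u⁻¹))

lemma integral_physKernel {y : E3} (hy : y ≠ 0) :
    ∫ u in Ioi (0 : ℝ), physKernel y u = 1 / (4 * Real.pi * ‖y‖ ^ 3) := by
  have hy' := norm_pos_iff.2 hy
  simp only [physKernel]
  rw [integral_const_mul, integral_sqrt_mul_exp hy']
  field_simp
  norm_num

lemma integral_freqKernel {k : E3} (hk : k ≠ 0) :
    ∫ u in Ioi (0 : ℝ), freqKernel k u = 1 / (Real.pi * ‖k‖ ^ 2) := by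
  have hk' := norm_pos_iff.2 hk
  exact integral_inv_sq_mul_exp (by positivity)

lemma integrable_physKernel_smul {ζ : L2Field} {x : E3}
    (h1 : Integrable fun y => ‖y‖⁻¹ ^ 2 * ‖ζ (x - y)‖) :
    Integrable (fun p : E3 × ℝ => physKernel p.1 p.2 • cross (complexify p.1) (ζ (x - p.1)))
      (volume.prod (volume.restrict (Ioi 0))) := by
  refine integrable_kernel_smul (h := fun y => cross (complexify y) (ζ (x - y)))
    (K := fun y => 1 / (4 * Real.pi * ‖y‖ ^ 3)) ?_ ?_ ?_ (fun y hy => integral_physKernel hy)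
    (aestronglyMeasurable_cross_shift ζ x) ?_
  · unfold physKernel
    fun_prop
  · intro y u hu
    have : 0 < u := hu
    unfold physKernel
    positivity
  · exact fun y hy => (integrable_sqrt_mul_exp (norm_pos_iff.2 hy)).const_mul (1 / 2 : ℝ)
  · refine integrable_mul_norm_cross (n := 2) (by fun_prop) (fun y => by positivity) ?_
      ((Lp.aestronglyMeasurable ζ).comp_measurePreserving
        (Measure.measurePreserving_sub_left volume x)) h1
    intro y hy
    have hy' := norm_pos_iff.2 hy
    rw [inv_pow, ← one_div]
    refine one_div_le_one_div_of_le (by positivity) ?_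
    have h3 : 0 < ‖y‖ ^ 3 := by positivity
    norm_num
    nlinarith [Real.pi_gt_three]

/-- The phase carried by the frequency `k` at the point `x`. -/
def phase (x k : E3) : ℂ := (Real.fourierChar (inner ℝ k x) : ℂ)

lemma integrable_freqKernel_smul {ζ : L2Field} (x : E3)
    (h2 : Integrable fun k => ‖k‖⁻¹ * ‖(𝓕 ζ : L2Field) k‖) :
    Integrable (fun p : E3 × ℝ => freqKernel p.1 p.2 •
      (Complex.I / 2 * phase x p.1) • cross (complexify p.1) ((𝓕 ζ : L2Field) p.1))
      (volume.prod (volume.restrict (Ioi 0))) := by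
  have mc : AEStronglyMeasurable (fun k => cross (complexify k) ((𝓕 ζ : L2Field) k)) volume :=
    aestronglyMeasurable_cross complexify.continuous.aestronglyMeasurable
      (Lp.aestronglyMeasurable _)
  have cp : Continuous fun k => Complex.I / 2 * phase x k := by
    have := Real.continuous_fourierChar
    unfold phase
    fun_prop
  refine integrable_kernel_smul
    (h := fun k => (Complex.I / 2 * phase x k) • cross (complexify k) ((𝓕 ζ : L2Field) k))
    (K := fun y => 1 / (Real.pi * ‖y‖ ^ 2)) ?_ ?_ ?_ (fun y hy => integral_freqKernel hy)
    (cp.aestronglyMeasurable.smul mc) ?_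
  · unfold freqKernel
    fun_prop
  · intro y u hu
    have : 0 < u := hu
    unfold freqKernel
    positivity
  · intro k hk
    have hk' := norm_pos_iff.2 hk
    exact integrable_inv_sq_mul_exp (by positivity)
  · have h2' : Integrable fun k => ‖k‖⁻¹ ^ 1 * ‖(𝓕 ζ : L2Field) k‖ := by simpa using h2
    have := integrable_mul_norm_cross (K := fun y => 1 / (Real.pi * ‖y‖ ^ 2)) (n := 1)
      (by fun_prop) (fun y => by positivity) ?_ (Lp.aestronglyMeasurable _) h2'
    · refine (this.const_mul (1 / 2)).congr (ae_of_all _ fun k => ?_)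
      simp only [norm_smul, norm_mul, phase, Circle.norm_coe, norm_div, Complex.norm_I]
      norm_num
      ring
    · intro y hy
      have hy' := norm_pos_iff.2 hy
      rw [inv_pow, ← one_div]
      refine one_div_le_one_div_of_le (by positivity) ?_
      have h3 : 0 < ‖y‖ ^ 2 := by positivity
      norm_num
      nlinarith [Real.pi_gt_three]

/-- Gaussian by Gaussian, the Biot–Savart integral equals its Fourier counterpart. -/
lemma integral_physKernel_eq {u : ℝ} (hu : 0 < u) (x : E3) (ζ : L2Field) :
    ∫ y, physKernel y u • cross (complexify y) (ζ (x - y)) =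
      - ∫ k, freqKernel k u •
        (Complex.I / 2 * phase x k) • cross (complexify k) ((𝓕 ζ : L2Field) k) := by
  simp only [physKernel, mul_smul]
  rw [integral_smul, integral_smul, integral_gaussian_cross hu x ζ, ← integral_smul,
    ← integral_smul, ← integral_neg]
  refine integral_congr_ae (ae_of_all _ fun k => ?_)
  simp only [freqKernel, phase]
  rw [modGaussian_eq, ← neg_smul, ← Complex.coe_smul, ← Complex.coe_smul, ← Complex.coe_smul]
  simp only [smul_smul]
  congr 1
  have : u ^ (-2 : ℝ) = u ^ (1 / 2 : ℝ) * u ^ (-5 / 2 : ℝ) := by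
    rw [← Real.rpow_add hu]; norm_num
  rw [this]
  push_cast
  ring

/-- Where the integral converges absolutely, the Biot–Savart velocity is the inverse Fourier
integral of its Fourier transform: the kernel is a superposition of Gaussians. -/
theorem biotSavart_eq_fourierInv (ζ : L2Field) (x : E3)
    (h1 : Integrable fun y => ‖y‖⁻¹ ^ 2 * ‖ζ (x - y)‖)
    (h2 : Integrable fun k => ‖k‖⁻¹ * ‖(𝓕 ζ : L2Field) k‖) :
    biotSavart (fun x => ζ x) x =
      𝓕⁻ (fun k => velocityMultiplier k ((𝓕 ζ : L2Field) k)) x := by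
  have b1 : biotSavart (fun x => ζ x) x = - ∫ y, ∫ u in Ioi (0 : ℝ),
      physKernel y u • cross (complexify y) (ζ (x - y)) := by
    rw [biotSavart]
    congr 1
    refine integral_congr_ae ?_
    filter_upwards [ae_ne_zero] with y hy
    rw [integral_smul_const, integral_physKernel hy]
    rfl
  rw [b1, integral_integral_swap (f := fun y u =>
      physKernel y u • cross (complexify y) (ζ (x - y))) (integrable_physKernel_smul h1),
    setIntegral_congr_fun measurableSet_Ioi fun u hu => integral_physKernel_eq hu x ζ,
    integral_neg, neg_neg, ← integral_integral_swap (f := fun k u => freqKernel k u •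
      (Complex.I / 2 * phase x k) • cross (complexify k) ((𝓕 ζ : L2Field) k))
      (integrable_freqKernel_smul x h2), Real.fourierInv_eq]
  refine integral_congr_ae ?_
  filter_upwards [ae_ne_zero] with k hk
  have hk' := norm_pos_iff.2 hk
  rw [integral_smul_const, integral_freqKernel hk, velocityMultiplier,
    Circle.smul_def, smul_smul, ← Complex.coe_smul, smul_smul, phase]
  congr 1
  push_cast
  field_simp

/-! ### Dilations and the operator `ξ · ∇` -/

/-- The `L¹`-normalised dilation `s⁻³ φ(x/s)`. -/
def dilate (s : ℝ) (φ : E3 → ℝ) (x : E3) : ℝ := s⁻¹ ^ 3 * φ (s⁻¹ • x)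

/-- The test function `div (φ ξ) = 3 φ + ξ · ∇φ`. -/
def eulerAdj (φ : E3 → ℝ) (x : E3) : ℝ := 3 * φ x + fderiv ℝ φ x x

lemma IsTestFunction.dilate {φ : E3 → ℝ} (hφ : IsTestFunction φ) {s : ℝ} (hs : 0 < s) :
    IsTestFunction (dilate s φ) := by
  refine ⟨?_, ?_⟩
  · exact contDiff_const.mul (hφ.1.comp (contDiff_const_smul _))
  · have h1 : HasCompactSupport fun x : E3 => φ (s⁻¹ • x) :=
      hφ.2.comp_homeomorph (Homeomorph.smulOfNeZero s⁻¹ (inv_pos.2 hs).ne')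
    exact h1.mul_left

lemma IsTestFunction.eulerAdj {φ : E3 → ℝ} (hφ : IsTestFunction φ) :
    IsTestFunction (eulerAdj φ) := by
  refine ⟨?_, ?_⟩
  · exact (contDiff_const.mul hφ.1).add
      ((hφ.1.fderiv_right (m := ∞) (by simp)).clm_apply contDiff_id)
  · refine HasCompactSupport.add hφ.2.mul_left ?_
    refine (hφ.2.fderiv ℝ).mono fun x hx => ?_
    contrapose! hx
    simp only [Function.mem_support, not_not] at hx ⊢
    simp [hx]

lemma divergence_smul {φ : E3 → ℝ} {b : E3 → E3} {x : E3} (hφ : DifferentiableAt ℝ φ x)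
    (hb : DifferentiableAt ℝ b x) : divergence (fun y => φ y • b y) x =
      φ x * divergence b x + ∑ i, partialDeriv φ i x * b x i := by
  unfold divergence partialDeriv
  rw [fderiv_fun_smul hφ hb, Finset.mul_sum, ← Finset.sum_add_distrib]
  refine Finset.sum_congr rfl fun i _ => ?_
  simp

lemma fderiv_apply_eq_sum (φ : E3 → ℝ) (x v : E3) :
    fderiv ℝ φ x v = ∑ i, partialDeriv φ i x * v i := by
  have h : v = ∑ i, v i • basisVec i := by
    ext j
    fin_cases j <;> simp [Fin.sum_univ_three, basisVec]
  conv_lhs => rw [h]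
  simp only [map_sum, map_smul, partialDeriv, smul_eq_mul]
  exact Finset.sum_congr rfl fun i _ => mul_comm _ _

/-- Tested with `φ`, the operator `ξ · ∇` has transpose `-div (φ ξ)`. -/
lemma divergence_smul_id {φ : E3 → ℝ} (hφ : IsTestFunction φ) (x : E3) :
    divergence (fun y => φ y • y) x = eulerAdj φ x := by
  rw [divergence_smul (hφ.differentiable x) differentiableAt_fun_id, eulerAdj, fderiv_apply_eq_sum,
    mul_comm 3]
  congr 2
  simp [divergence, basisVec]

lemma fderiv_dilate {φ : E3 → ℝ} (hφ : IsTestFunction φ) (s : ℝ) (x v : E3) :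
    fderiv ℝ (dilate s φ) x v = s⁻¹ ^ 3 * (s⁻¹ * fderiv ℝ φ (s⁻¹ • x) v) := by
  have h0 : HasFDerivAt (fun x : E3 => s⁻¹ • x) (s⁻¹ • ContinuousLinearMap.id ℝ E3) x :=
    (hasFDerivAt_id x).const_smul s⁻¹
  have h1 := ((hφ.differentiable (s⁻¹ • x)).hasFDerivAt.comp x h0).const_mul (s⁻¹ ^ 3)
  have h2 : fderiv ℝ (dilate s φ) x = _ := h1.fderiv
  rw [h2]
  simp

lemma partialDeriv_dilate {φ : E3 → ℝ} (hφ : IsTestFunction φ) (s : ℝ) (j : Fin 3) (x : E3) :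
    partialDeriv (dilate s φ) j x = s⁻¹ * dilate s (partialDeriv φ j) x := by
  simp only [partialDeriv, fderiv_dilate hφ, dilate]
  ring

/-- The adjoint of the Euler operator `ξ · ∇` commutes with dilations. -/
lemma eulerAdj_dilate {φ : E3 → ℝ} (hφ : IsTestFunction φ) (s : ℝ) (x : E3) :
    eulerAdj (dilate s φ) x = dilate s (eulerAdj φ) x := by
  simp only [eulerAdj, fderiv_dilate hφ, dilate, map_smul, smul_eq_mul]
  ring

lemma dilate_one (φ : E3 → ℝ) : dilate 1 φ = φ := by
  funext x; simp [dilate]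

/-- The pairing of a field with the dilates of a test function. -/
def dilPair (φ : E3 → ℝ) (f : E3 → C3) (s : ℝ) : C3 := ∫ x, dilate s φ x • f x

lemma dilPair_eq {φ : E3 → ℝ} {f : E3 → C3} {s : ℝ} (hs : 0 < s) :
    dilPair φ f s = ∫ x, φ x • f (s • x) := by
  have h := Measure.integral_comp_smul volume (fun x : E3 => φ (s⁻¹ • x) • f x) s
  simp only [smul_smul, inv_mul_cancel₀ hs.ne', one_smul] at h
  rw [h, dilPair, ← integral_smul]
  refine integral_congr_ae (ae_of_all _ fun x => ?_)
  have : |((s : ℝ) ^ Module.finrank ℝ E3)⁻¹| = s⁻¹ ^ 3 := by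
    rw [finrank_euclideanSpace, Fintype.card_fin, abs_of_nonneg (by positivity), inv_pow]
  simp only [dilate, this, smul_smul]

lemma integral_comp_smul_E3 (f : E3 → ℝ) {s : ℝ} (hs : 0 < s) :
    ∫ x, f (s • x) = s ^ (-3 : ℝ) * ∫ x, f x := by
  rw [Measure.integral_comp_smul, finrank_euclideanSpace, Fintype.card_fin,
    abs_of_nonneg (by positivity), smul_eq_mul, Real.rpow_neg hs.le]
  norm_cast

lemma L2Field.integrable_sq_norm (f : L2Field) : Integrable fun x => ‖f x‖ ^ 2 :=
  (memLp_two_iff_integrable_sq_norm (Lp.aestronglyMeasurable f)).1 (Lp.memLp f)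

lemma IsTestFunction.integrable_sq {φ : E3 → ℝ} (hφ : IsTestFunction φ) :
    Integrable fun x => φ x ^ 2 :=
  (memLp_two_iff_integrable_sq (hφ.memLp 2).1).1 (hφ.memLp 2)

/-- The decay `O(s^{-3/2})` comes from the scaling of the `L²` norm in dimension three:
`‖f (s ·)‖ = s^{-3/2} ‖f‖`. -/
lemma norm_dilPair_le {φ : E3 → ℝ} (hφ : IsTestFunction φ) (f : L2Field) {s : ℝ} (hs : 0 < s) :
    ‖dilPair φ f s‖ ≤ ((∫ x, φ x ^ 2) + ∫ x, ‖f x‖ ^ 2) * s ^ (-3 / 2 : ℝ) := by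
  rw [dilPair_eq hs]
  have i1 : Integrable fun x => s ^ (-3 / 2 : ℝ) * φ x ^ 2 := hφ.integrable_sq.const_mul _
  have i2 : Integrable fun x => s ^ (3 / 2 : ℝ) * ‖f (s • x)‖ ^ 2 :=
    (((integrable_comp_smul_iff volume (fun x => ‖f x‖ ^ 2) hs.ne').2
      f.integrable_sq_norm)).const_mul _
  have hp : s ^ (-3 / 2 : ℝ) * s ^ (3 / 2 : ℝ) = 1 := by
    rw [← Real.rpow_add hs]; norm_num
  have hle : ‖∫ x, φ x • f (s • x)‖ ≤
      ∫ x, (s ^ (-3 / 2 : ℝ) * φ x ^ 2 + s ^ (3 / 2 : ℝ) * ‖f (s • x)‖ ^ 2) := by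
    refine norm_integral_le_of_norm_le (i1.add i2) (ae_of_all _ fun x => ?_)
    rw [norm_smul, Real.norm_eq_abs]
    have ha : 0 < s ^ (-3 / 2 : ℝ) := by positivity
    have hb : 0 < s ^ (3 / 2 : ℝ) := by positivity
    -- `2ab ≤ t a² + t⁻¹ b²` with the weight `t = s^{-3/2}`
    have h1 : 0 ≤ s ^ (-3 / 2 : ℝ) * (|φ x| - s ^ (3 / 2 : ℝ) * ‖f (s • x)‖) ^ 2 := by positivity
    have h2 : 0 ≤ |φ x| * ‖f (s • x)‖ := by positivity
    have h3 : s ^ (-3 / 2 : ℝ) * (|φ x| - s ^ (3 / 2 : ℝ) * ‖f (s • x)‖) ^ 2 =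
      s ^ (-3 / 2 : ℝ) * φ x ^ 2 + s ^ (3 / 2 : ℝ) * ‖f (s • x)‖ ^ 2 -
        2 * (|φ x| * ‖f (s • x)‖) := by
      rw [← sq_abs (φ x)]
      linear_combination (s ^ (3 / 2 : ℝ) * ‖f (s • x)‖ ^ 2 - 2 * (|φ x| * ‖f (s • x)‖)) * hp
    linarith
  refine hle.trans (le_of_eq ?_)
  rw [integral_add i1 i2, integral_const_mul, integral_const_mul,
    integral_comp_smul_E3 (fun x => ‖f x‖ ^ 2) hs, ← mul_assoc, ← Real.rpow_add hs]
  norm_num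
  ring

lemma hasDerivAt_dilate {φ : E3 → ℝ} (hφ : IsTestFunction φ) {s : ℝ} (hs : 0 < s) (x : E3) :
    HasDerivAt (fun s => dilate s φ x) (-s⁻¹ * dilate s (eulerAdj φ) x) s := by
  have h0 : HasDerivAt (fun s : ℝ => s⁻¹) (-(s ^ 2)⁻¹) s := hasDerivAt_inv hs.ne'
  have h1 : HasDerivAt (fun s : ℝ => s⁻¹ • x) (-(s ^ 2)⁻¹ • x) s := h0.smul_const x
  have h2 : HasDerivAt (fun s : ℝ => φ (s⁻¹ • x)) (fderiv ℝ φ (s⁻¹ • x) (-(s ^ 2)⁻¹ • x)) s :=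
    (hφ.differentiable (s⁻¹ • x)).hasFDerivAt.comp_hasDerivAt s h1
  refine ((h0.fun_pow 3).mul h2).congr_deriv ?_
  simp only [dilate, eulerAdj, map_smul, smul_eq_mul, inv_pow]
  field_simp
  norm_num
  field_simp
  ring

/-- The generator of dilations is `ξ · ∇`: by duality `s d/ds ⟨φ_s, f⟩ = -⟨(div (φ ξ))_s, f⟩`. -/
lemma hasDerivAt_dilPair {φ : E3 → ℝ} (hφ : IsTestFunction φ) (f : L2Field) {s : ℝ} (hs : 0 < s) :
    HasDerivAt (dilPair φ f) (-s⁻¹ • dilPair (eulerAdj φ) f s) s := by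
  obtain ⟨C, hC0, hC⟩ := hφ.eulerAdj.exists_bound
  obtain ⟨R, hR⟩ := hφ.eulerAdj.2.isCompact.isBounded.subset_closedBall (0 : E3)
  set B : Set E3 := Metric.closedBall 0 (2 * s * |R|)
  have hint : Integrable (B.indicator fun x => ((s / 2)⁻¹ ^ 4 * C) * ‖f x‖) := by
    refine IntegrableOn.integrable_indicator ?_ Metric.isClosed_closedBall.measurableSet
    exact ((L2Field.locallyIntegrable f).integrableOn_isCompact
      (isCompact_closedBall _ _)).norm.const_mul _
  have key := hasDerivAt_integral_of_dominated_loc_of_deriv_le (μ := volume) (𝕜 := ℝ)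
    (F := fun s x => dilate s φ x • f x)
    (F' := fun s x => (-s⁻¹ * dilate s (eulerAdj φ) x) • f x) (x₀ := s)
    (bound := B.indicator fun x => ((s / 2)⁻¹ ^ 4 * C) * ‖f x‖)
    (s := Ioo (s / 2) (2 * s)) (Ioo_mem_nhds (by linarith) (by linarith)) ?_ ?_ ?_ ?_ hint ?_
  · refine key.2.congr_deriv ?_
    simp only [mul_smul]
    rw [integral_smul]
    rfl
  · filter_upwards [Ioi_mem_nhds hs] with t ht
    exact (hφ.dilate ht).continuous.aestronglyMeasurable.smul (Lp.aestronglyMeasurable f)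
  · exact (hφ.dilate hs).integrable_smul (L2Field.locallyIntegrable f)
  · exact (((hφ.eulerAdj.dilate hs).const_mul (-s⁻¹)).continuous.aestronglyMeasurable).smul
      (Lp.aestronglyMeasurable f)
  · refine ae_of_all _ fun x t ht => ?_
    have ht0 : 0 < t := by linarith [ht.1]
    rw [norm_smul, norm_mul, norm_neg, dilate, norm_mul, norm_pow,
      Real.norm_of_nonneg (inv_pos.2 ht0).le]
    by_cases hx : t⁻¹ • x ∈ tsupport (eulerAdj φ)
    · have hxB : x ∈ B := by
        have := hR hx
        simp only [B, mem_closedBall_zero_iff, norm_smul, norm_inv,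
          Real.norm_of_nonneg ht0.le] at this ⊢
        rw [inv_mul_le_iff₀ ht0] at this
        have h1 : t * R ≤ t * |R| := by gcongr; exact le_abs_self R
        have h2 : t * |R| ≤ 2 * s * |R| := by gcongr; exact ht.2.le
        linarith
      rw [indicator_of_mem hxB]
      have h1 : t⁻¹ ≤ (s / 2)⁻¹ := inv_anti₀ (by linarith) ht.1.le
      have h2 : ‖eulerAdj φ (t⁻¹ • x)‖ ≤ C := hC _
      calc _ = t⁻¹ ^ 4 * ‖eulerAdj φ (t⁻¹ • x)‖ * ‖f x‖ := by ring
        _ ≤ _ := by gcongr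
    · rw [image_eq_zero_of_notMem_tsupport hx]
      simp only [norm_zero, mul_zero, zero_mul]
      exact indicator_nonneg (fun _ _ => by positivity) _
  · refine ae_of_all _ fun x t ht => ?_
    have ht0 : 0 < t := by linarith [ht.1]
    exact (hasDerivAt_dilate hφ ht0 x).smul_const (f x)

lemma continuousOn_dilPair {φ : E3 → ℝ} (hφ : IsTestFunction φ) (f : L2Field) :
    ContinuousOn (dilPair φ f) (Ioi 0) :=
  fun _ hs => (hasDerivAt_dilPair hφ f hs).continuousAt.continuousWithinAt

lemma norm_ofReal_cpow {s : ℝ} (hs : 0 < s) (b : ℂ) : ‖(s : ℂ) ^ b‖ = s ^ b.re :=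
  Complex.norm_cpow_eq_rpow_re_of_pos hs b

lemma continuousOn_ofReal_cpow (b : ℂ) : ContinuousOn (fun s : ℝ => (s : ℂ) ^ b) (Ioi 0) :=
  fun _ hs => (Complex.continuousAt_ofReal_cpow_const _ _
    (Or.inr (ne_of_gt hs))).continuousWithinAt

lemma integrableOn_cpow_smul_dilPair {φ : E3 → ℝ} (hφ : IsTestFunction φ) (f : L2Field) {b : ℂ}
    (hb : b.re < 1 / 2) :
    IntegrableOn (fun s : ℝ => (s : ℂ) ^ b • dilPair φ f s) (Ioi 1) := by
  have hsub : Ioi (1 : ℝ) ⊆ Ioi 0 := Ioi_subset_Ioi zero_le_one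
  have h1 : IntegrableOn (fun s : ℝ => ((∫ x, φ x ^ 2) + ∫ x, ‖f x‖ ^ 2) *
      s ^ (b.re + (-3 / 2))) (Ioi 1) :=
    (integrableOn_Ioi_rpow_of_lt (by linarith) one_pos).const_mul _
  refine Integrable.mono' h1 ?_ ?_
  · exact (((continuousOn_ofReal_cpow b).smul (continuousOn_dilPair hφ f)).mono
      hsub).aestronglyMeasurable measurableSet_Ioi
  · rw [ae_restrict_iff' measurableSet_Ioi]
    refine ae_of_all _ fun s hs => ?_
    have hs0 : 0 < s := hsub hs
    rw [norm_smul, norm_ofReal_cpow hs0, Real.rpow_add hs0]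
    have := norm_dilPair_le hφ f hs0
    calc _ ≤ s ^ b.re * (((∫ x, φ x ^ 2) + ∫ x, ‖f x‖ ^ 2) * s ^ (-3 / 2 : ℝ)) := by gcongr
      _ = _ := by ring

/-- Integration of `d/ds (s⁻ᵇ ⟨φ_s, f⟩)` over `(1, ∞)`; the boundary term at infinity vanishes
because `⟨φ_s, f⟩ = O(s^{-3/2})`. -/
lemma integral_cpow_smul_dilPair {φ : E3 → ℝ} (hφ : IsTestFunction φ) (f : L2Field) {b : ℂ}
    (hb : -(3 / 2) < b.re) :
    ∫ s in Ioi (1 : ℝ), (s : ℂ) ^ (-b - 1) • (b • dilPair φ f s + dilPair (eulerAdj φ) f s) =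
      ∫ x, φ x • f x := by
  have hre : (-b - 1 : ℂ).re < 1 / 2 := by simp; linarith
  have hd : ∀ s ∈ Ici (1 : ℝ), HasDerivAt (fun s : ℝ => (s : ℂ) ^ (-b) • dilPair φ f s)
      (-((s : ℂ) ^ (-b - 1) • (b • dilPair φ f s + dilPair (eulerAdj φ) f s))) s := by
    intro s hs
    have hs0 : 0 < s := lt_of_lt_of_le one_pos hs
    have h1 : HasDerivAt (fun s : ℝ => (s : ℂ) ^ (-b)) (-b * (s : ℂ) ^ (-b - 1)) s := by
      have := ((hasDerivAt_id (s : ℂ)).cpow_const (c := -b)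
        (Or.inl (by simpa using hs0))).comp_ofReal
      simpa using this
    refine (h1.smul (hasDerivAt_dilPair hφ f hs0)).congr_deriv ?_
    have hsC : (s : ℂ) ≠ 0 := by exact_mod_cast hs0.ne'
    have h2 : (s : ℂ) ^ (-b) = (s : ℂ) ^ (-b - 1) * s := by
      rw [Complex.cpow_sub _ _ hsC, Complex.cpow_one]
      field_simp
    rw [h2, ← Complex.coe_smul, smul_smul, smul_add, smul_smul, neg_add, add_comm, ← neg_smul,
      ← neg_smul]
    congr 2
    · ring
    · push_cast
      field_simp
  have hi : IntegrableOn (fun s : ℝ => -((s : ℂ) ^ (-b - 1) •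
      (b • dilPair φ f s + dilPair (eulerAdj φ) f s))) (Ioi 1) := by
    have i1 := (integrableOn_cpow_smul_dilPair hφ f hre).smul b
    have i2 := integrableOn_cpow_smul_dilPair hφ.eulerAdj f hre
    refine ((i1.add i2).neg).congr (ae_of_all _ fun s => ?_)
    simp only [Pi.neg_apply, Pi.add_apply, Pi.smul_apply, smul_add]
    rw [smul_comm]
  have hlim : Tendsto (fun s : ℝ => (s : ℂ) ^ (-b) • dilPair φ f s) atTop (𝓝 0) := by
    refine squeeze_zero_norm' (a := fun s => ((∫ x, φ x ^ 2) + ∫ x, ‖f x‖ ^ 2) *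
      s ^ (-(b.re + 3 / 2))) ?_ ?_
    · filter_upwards [Ioi_mem_atTop (0 : ℝ)] with s hs
      have hs0 : 0 < s := hs
      rw [norm_smul, norm_ofReal_cpow hs0]
      have := norm_dilPair_le hφ f hs0
      calc _ ≤ s ^ (-b).re * (((∫ x, φ x ^ 2) + ∫ x, ‖f x‖ ^ 2) * s ^ (-3 / 2 : ℝ)) := by gcongr
        _ = ((∫ x, φ x ^ 2) + ∫ x, ‖f x‖ ^ 2) * (s ^ (-b).re * s ^ (-3 / 2 : ℝ)) := by ring
        _ = _ := by
          rw [← Real.rpow_add hs0]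
          congr 2
          simp
          ring
    · simpa using (tendsto_rpow_neg_atTop (by linarith : 0 < b.re + 3 / 2)).const_mul _
  have := integral_Ioi_of_hasDerivAt_of_tendsto' hd hi hlim
  rw [integral_neg, zero_sub, neg_inj] at this
  rw [this]
  simp [dilPair, dilate_one]

/-! ### Solving `ξ · ∇η = (c + 1) η + H` in `L²` -/

/-- The Mellin-type superposition `∫₁^∞ s^{-a} H (s x) ds` of dilates of `H`. -/
def scaleInt (a : ℂ) (H : E3 → C3) (x : E3) : C3 := ∫ s in Ioi (1 : ℝ), (s : ℂ) ^ (-a) • H (s • x)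

lemma stronglyMeasurable_scaleInt_integrand (a : ℂ) (H : L2Field) :
    StronglyMeasurable (Function.uncurry fun (x : E3) (s : ℝ) => (s : ℂ) ^ (-a) • H (s • x)) := by
  have h1 : Measurable fun p : E3 × ℝ => (p.2 : ℂ) ^ (-a) :=
    (Complex.measurable_ofReal.comp measurable_snd).pow_const _
  exact h1.stronglyMeasurable.smul
    ((Lp.stronglyMeasurable H).comp_measurable (measurable_snd.smul measurable_fst))

/-- Tonelli: `∫₁^∞ ∫ s^{-δ} |H (s x)|² dx ds = ∫₁^∞ s^{-δ-3} ds ‖H‖² < ∞`. -/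
lemma integrable_prod_rpow_mul_sq (H : L2Field) {δ : ℝ} (hδ : 0 < δ) :
    Integrable (fun p : E3 × ℝ => p.2 ^ (-δ) * ‖H (p.2 • p.1)‖ ^ 2)
      ((volume : Measure E3).prod (volume.restrict (Ioi 1))) := by
  have hm : StronglyMeasurable (fun p : E3 × ℝ => p.2 ^ (-δ) * ‖H (p.2 • p.1)‖ ^ 2) := by
    have h1 : Measurable fun p : E3 × ℝ => p.2 ^ (-δ) := measurable_snd.pow_const _
    exact h1.stronglyMeasurable.mul
      (((Lp.stronglyMeasurable H).comp_measurable (measurable_snd.smul measurable_fst)).norm.pow 2)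
  rw [integrable_prod_iff' hm.aestronglyMeasurable]
  refine ⟨?_, ?_⟩
  · rw [ae_restrict_iff' measurableSet_Ioi]
    refine ae_of_all _ fun s hs => ?_
    have hs0 : (0 : ℝ) < s := lt_trans one_pos hs
    exact ((integrable_comp_smul_iff volume (fun x => ‖H x‖ ^ 2) hs0.ne').2
      H.integrable_sq_norm).const_mul (s ^ (-δ))
  · have h1 : IntegrableOn (fun s : ℝ => s ^ (-δ + -3) * ∫ x, ‖H x‖ ^ 2) (Ioi 1) :=
      (integrableOn_Ioi_rpow_of_lt (by linarith) one_pos).mul_const _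
    refine h1.congr ?_
    refine (ae_restrict_iff' measurableSet_Ioi).2 (ae_of_all _ fun s hs => ?_)
    have hs0 : (0 : ℝ) < s := lt_trans one_pos hs
    have h2 : ∀ x, ‖s ^ (-δ) * ‖H (s • x)‖ ^ 2‖ = s ^ (-δ) * ‖H (s • x)‖ ^ 2 := fun x =>
      Real.norm_of_nonneg (by positivity)
    simp only [h2]
    rw [integral_const_mul, integral_comp_smul_E3 (fun x => ‖H x‖ ^ 2) hs0, Real.rpow_add hs0]
    ring

/-- Cauchy–Schwarz with the weights `s^{-1-δ}` and `s^{-δ}`, where `δ = Re a - 1/2`. The condition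
`Re a > 1/2` is where the bound on the eigenvalue enters: for the weight `a = c + 2` with
`c = 2α (λ - 1)` it says `Re λ > 1 - 3/(4α)`. -/
lemma memLp_scaleInt {a : ℂ} (ha : 1 / 2 < a.re) (H : L2Field) :
    MemLp (scaleInt a H) 2 volume := by
  -- `s^{-Re a} = s^{(-1-δ)/2} s^{-δ/2}`
  set δ : ℝ := a.re - 1 / 2 with hδ
  have hδ0 : 0 < δ := by linarith
  have hP := integrable_prod_rpow_mul_sq H hδ0
  have hm : StronglyMeasurable (scaleInt a H) :=
    (stronglyMeasurable_scaleInt_integrand a H).integral_prod_right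
  rw [memLp_two_iff_integrable_sq_norm hm.aestronglyMeasurable]
  have hw : IntegrableOn (fun s : ℝ => s ^ (-1 - δ)) (Ioi 1) :=
    integrableOn_Ioi_rpow_of_lt (by linarith) one_pos
  refine Integrable.mono' (hP.integral_prod_left.const_mul (∫ s in Ioi (1 : ℝ), s ^ (-1 - δ)))
    (hm.norm.pow 2).aestronglyMeasurable ?_
  filter_upwards [hP.prod_right_ae] with x hx
  rw [Real.norm_of_nonneg (by positivity)]
  have e1 : ∀ s ∈ Ioi (1 : ℝ), (s ^ ((-1 - δ) / 2)) ^ (2 : ℝ) = s ^ (-1 - δ) := fun s hs => by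
    rw [← Real.rpow_mul (lt_trans one_pos hs).le]; congr 1; ring
  have e2 : ∀ s ∈ Ioi (1 : ℝ), (s ^ (-δ / 2) * ‖H (s • x)‖) ^ (2 : ℝ) =
      s ^ (-δ) * ‖H (s • x)‖ ^ 2 := fun s hs => by
    have hs0 : (0 : ℝ) < s := lt_trans one_pos hs
    rw [Real.mul_rpow (by positivity) (norm_nonneg _), ← Real.rpow_mul hs0.le, Real.rpow_two]
    congr 2; ring
  have hmx : StronglyMeasurable fun s : ℝ => H (s • x) :=
    (Lp.stronglyMeasurable H).comp_measurable (measurable_id.smul_const x)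
  have m1 : AEStronglyMeasurable (fun s : ℝ => s ^ ((-1 - δ) / 2)) (volume.restrict (Ioi 1)) :=
    (measurable_id.pow_const _).aestronglyMeasurable
  have m2 : AEStronglyMeasurable (fun s : ℝ => s ^ (-δ / 2) * ‖H (s • x)‖)
      (volume.restrict (Ioi 1)) :=
    ((measurable_id.pow_const _).stronglyMeasurable.mul hmx.norm).aestronglyMeasurable
  have p1 : MemLp (fun s : ℝ => s ^ ((-1 - δ) / 2)) (ENNReal.ofReal 2)
      (volume.restrict (Ioi 1)) := by
    rw [show ENNReal.ofReal 2 = 2 by norm_num, memLp_two_iff_integrable_sq m1]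
    refine hw.congr ((ae_restrict_iff' measurableSet_Ioi).2 (ae_of_all _ fun s hs => ?_))
    simp only [← e1 s hs, Real.rpow_two]
  have p2 : MemLp (fun s : ℝ => s ^ (-δ / 2) * ‖H (s • x)‖) (ENNReal.ofReal 2)
      (volume.restrict (Ioi 1)) := by
    rw [show ENNReal.ofReal 2 = 2 by norm_num, memLp_two_iff_integrable_sq m2]
    refine Integrable.congr hx ((ae_restrict_iff' measurableSet_Ioi).2 (ae_of_all _ fun s hs => ?_))
    simp only [← e2 s hs, Real.rpow_two]
  have key := integral_mul_le_Lp_mul_Lq_of_nonneg (μ := volume.restrict (Ioi (1 : ℝ)))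
    Real.HolderConjugate.two_two
    ((ae_restrict_iff' measurableSet_Ioi).2 (ae_of_all _ fun s hs =>
      (Real.rpow_nonneg (lt_trans one_pos (mem_Ioi.1 hs)).le _ :
        (0 : ℝ) ≤ s ^ ((-1 - δ) / 2))))
    ((ae_restrict_iff' measurableSet_Ioi).2 (ae_of_all _ fun s hs =>
      (mul_nonneg (Real.rpow_nonneg (lt_trans one_pos (mem_Ioi.1 hs)).le _) (norm_nonneg _) :
        (0 : ℝ) ≤ s ^ (-δ / 2) * ‖H (s • x)‖))) p1 p2
  rw [setIntegral_congr_fun measurableSet_Ioi e1, setIntegral_congr_fun measurableSet_Ioi e2] at key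
  have hnorm : ‖scaleInt a H x‖ ≤
      ∫ s in Ioi (1 : ℝ), s ^ ((-1 - δ) / 2) * (s ^ (-δ / 2) * ‖H (s • x)‖) := by
    refine (norm_integral_le_integral_norm _).trans (le_of_eq ?_)
    refine setIntegral_congr_fun measurableSet_Ioi fun s hs => ?_
    have hs0 : (0 : ℝ) < s := lt_trans one_pos hs
    beta_reduce
    rw [norm_smul, norm_ofReal_cpow hs0, ← mul_assoc, ← Real.rpow_add hs0]
    congr 2
    rw [Complex.neg_re, hδ]; ring
  have hA : 0 ≤ ∫ s in Ioi (1 : ℝ), s ^ (-1 - δ) :=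
    setIntegral_nonneg measurableSet_Ioi fun s hs =>
      Real.rpow_nonneg (lt_trans one_pos (mem_Ioi.1 hs)).le _
  have hB : 0 ≤ ∫ s in Ioi (1 : ℝ), s ^ (-δ) * ‖H (s • x)‖ ^ 2 :=
    setIntegral_nonneg measurableSet_Ioi fun s hs =>
      mul_nonneg (Real.rpow_nonneg (lt_trans one_pos (mem_Ioi.1 hs)).le _) (by positivity)
  calc ‖scaleInt a H x‖ ^ 2 ≤ _ := pow_le_pow_left₀ (norm_nonneg _) (hnorm.trans key) 2
    _ = _ := by
      rw [mul_pow, ← Real.rpow_natCast, ← Real.rpow_mul hA, ← Real.rpow_natCast,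
        ← Real.rpow_mul hB]
      norm_num

/-- Fubini: pairing the superposition of dilates with `φ` amounts to superposing the pairings. -/
lemma integral_smul_scaleInt {a : ℂ} (ha : 1 / 2 < a.re) (H : L2Field) {φ : E3 → ℝ}
    (hφ : IsTestFunction φ) :
    ∫ x, φ x • scaleInt a H x = ∫ s in Ioi (1 : ℝ), (s : ℂ) ^ (-a) • dilPair φ H s := by
  set δ : ℝ := a.re - 1 / 2 with hδ
  have hδ0 : 0 < δ := by linarith
  have hw : IntegrableOn (fun s : ℝ => s ^ (-1 - δ)) (Ioi 1) :=
    integrableOn_Ioi_rpow_of_lt (by linarith) one_pos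
  have hI : Integrable (Function.uncurry fun (x : E3) (s : ℝ) =>
      φ x • ((s : ℂ) ^ (-a) • H (s • x)))
      ((volume : Measure E3).prod (volume.restrict (Ioi 1))) := by
    refine Integrable.mono' ((hφ.integrable_sq.mul_prod hw).add
      (integrable_prod_rpow_mul_sq H hδ0)) ?_ ?_
    · exact ((hφ.continuous.comp continuous_fst).stronglyMeasurable.smul
        (stronglyMeasurable_scaleInt_integrand a H)).aestronglyMeasurable
    · have hae : ∀ᵐ p : E3 × ℝ ∂((volume : Measure E3).prod (volume.restrict (Ioi 1))),
          p.2 ∈ Ioi (1 : ℝ) :=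
        Measure.quasiMeasurePreserving_snd.ae (ae_restrict_mem measurableSet_Ioi)
      filter_upwards [hae] with p hp
      have hs0 : (0 : ℝ) < p.2 := lt_trans one_pos hp
      simp only [Function.uncurry, Pi.add_apply]
      rw [norm_smul, norm_smul, norm_ofReal_cpow hs0, Real.norm_eq_abs]
      have e1 : p.2 ^ (-a).re = p.2 ^ ((-1 - δ) / 2) * p.2 ^ (-δ / 2) := by
        rw [← Real.rpow_add hs0]; congr 1; rw [Complex.neg_re, hδ]; ring
      have e2 : p.2 ^ (-1 - δ) = (p.2 ^ ((-1 - δ) / 2)) ^ 2 := by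
        rw [← Real.rpow_natCast, ← Real.rpow_mul hs0.le]; congr 1; push_cast; ring
      have e3 : p.2 ^ (-δ) = (p.2 ^ (-δ / 2)) ^ 2 := by
        rw [← Real.rpow_natCast, ← Real.rpow_mul hs0.le]; congr 1; push_cast; ring
      rw [e1, e2, e3, ← sq_abs (φ p.1)]
      have h1 : 0 ≤ (|φ p.1| * p.2 ^ ((-1 - δ) / 2)) * (p.2 ^ (-δ / 2) * ‖H (p.2 • p.1)‖) := by
        positivity
      -- `2 |ab| ≤ a² + b²` with `a = |φ| s^{(-1-δ)/2}` and `b = s^{-δ/2} |H (s x)|`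
      nlinarith [sq_nonneg (|φ p.1| * p.2 ^ ((-1 - δ) / 2) - p.2 ^ (-δ / 2) * ‖H (p.2 • p.1)‖)]
  have hsw := integral_integral_swap hI
  have hl : ∀ x, ∫ s in Ioi (1 : ℝ), φ x • ((s : ℂ) ^ (-a) • H (s • x)) =
      φ x • scaleInt a H x := fun x => integral_smul _ _
  simp only [hl] at hsw
  rw [hsw]
  refine setIntegral_congr_fun measurableSet_Ioi fun s hs => ?_
  rw [dilPair_eq (lt_trans one_pos hs), ← integral_smul]
  refine integral_congr_ae (ae_of_all _ fun x => ?_)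
  exact smul_comm _ _ _

/-- If `ξ · ∇f = c f + g` with `Re c > -3/2`, then `f = -∫₁^∞ s^{-c-1} g (s ·) ds`. -/
lemma IsAdvection.integral_smul_eq {c : ℂ} (hc : -(3 / 2) < c.re) {f g X : L2Field}
    (hX : IsAdvection (fun ξ => ξ) (fun x => f x) X) (hXeq : X = c • f + g) {φ : E3 → ℝ}
    (hφ : IsTestFunction φ) :
    ∫ x, φ x • f x = -∫ s in Ioi (1 : ℝ), (s : ℂ) ^ (-c - 1) • dilPair φ g s := by
  rw [← integral_cpow_smul_dilPair hφ f hc, ← integral_neg]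
  refine setIntegral_congr_fun measurableSet_Ioi fun s hs => ?_
  have hs0 : (0 : ℝ) < s := lt_trans one_pos hs
  rw [← smul_neg]
  congr 1
  have h1 := hX.2 _ (hφ.dilate hs0)
  simp only [divergence_smul_id (hφ.dilate hs0), eulerAdj_dilate hφ] at h1
  have h2 : ∫ x, dilate s φ x • X x = c • dilPair φ f s + dilPair φ g s := by
    have hae : ∀ᵐ x, dilate s φ x • X x = c • (dilate s φ x • f x) + dilate s φ x • g x := by
      rw [hXeq]
      filter_upwards [Lp.coeFn_add (c • f) g, Lp.coeFn_smul c f] with x h1 h2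
      rw [h1, Pi.add_apply, h2, Pi.smul_apply, smul_add, smul_comm]
    rw [integral_congr_ae hae, integral_add, integral_smul]
    · rfl
    · exact ((hφ.dilate hs0).integrable_smul f.locallyIntegrable).smul c
    · exact (hφ.dilate hs0).integrable_smul g.locallyIntegrable
  rw [h2] at h1
  rw [← sub_eq_zero]
  have h3 : dilPair (eulerAdj φ) f s = ∫ x, dilate s (eulerAdj φ) x • f x := rfl
  rw [← h3] at h1
  rw [show c • dilPair φ f s + dilPair (eulerAdj φ) f s - -dilPair φ g s =
    (c • dilPair φ f s + dilPair φ g s) + dilPair (eulerAdj φ) f s by abel, h1]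
  abel

/-- The superposition `η = -∫₁^∞ s^{-c-2} H (s ·) ds` solves `ξ · ∇η = (c + 1) η + H`. -/
lemma isAdvection_of_scaleInt {c : ℂ} (hc : -(3 / 2) < c.re) {H η : L2Field}
    (hη : ∀ᵐ x, η x = -scaleInt (c + 2) H x) :
    IsAdvection (fun ξ => ξ) (fun x => η x) ((c + 1) • η + H) := by
  refine ⟨η.locallyIntegrable, fun φ hφ => ?_⟩
  have ha : 1 / 2 < (c + 2).re := by simp; linarith
  have hb : -(3 / 2) < (c + 1).re := by simp; linarith
  have hpair : ∀ ψ : E3 → ℝ, IsTestFunction ψ →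
      ∫ x, ψ x • η x = -∫ s in Ioi (1 : ℝ), (s : ℂ) ^ (-(c + 2)) • dilPair ψ H s := by
    intro ψ hψ
    rw [← integral_smul_scaleInt ha H hψ, ← integral_neg]
    refine integral_congr_ae ?_
    filter_upwards [hη] with x hx
    rw [hx, smul_neg]
  have hre : (-(c + 1) - 1 : ℂ).re < 1 / 2 := by simp; linarith
  have hre' : (-(c + 2) : ℂ).re < 1 / 2 := by simp; linarith
  simp only [divergence_smul_id hφ]
  rw [hpair _ hφ.eulerAdj, neg_neg]
  have hae : ∀ᵐ x, φ x • ((c + 1) • η + H : L2Field) x =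
      (c + 1) • (φ x • η x) + φ x • H x := by
    filter_upwards [Lp.coeFn_add ((c + 1) • η) H, Lp.coeFn_smul (c + 1) η] with x h1 h2
    rw [h1, Pi.add_apply, h2, Pi.smul_apply, smul_add, smul_comm]
  rw [integral_congr_ae hae, integral_add, integral_smul, hpair _ hφ,
    ← integral_cpow_smul_dilPair hφ H hb, smul_neg, ← integral_smul, ← integral_neg,
    ← integral_add]
  · refine setIntegral_congr_fun measurableSet_Ioi fun s hs => ?_
    rw [show -(c + 1) - 1 = -(c + 2) by ring, smul_add, smul_comm]
    abel
  · exact ((integrableOn_cpow_smul_dilPair hφ H hre').smul (c + 1)).neg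
  · refine (((integrableOn_cpow_smul_dilPair hφ H hre).smul (c + 1)).add
      (integrableOn_cpow_smul_dilPair hφ.eulerAdj H hre)).congr (ae_of_all _ fun s => ?_)
    simp only [Pi.add_apply, Pi.smul_apply, smul_add]
    rw [smul_comm]
  · exact (hφ.integrable_smul η.locallyIntegrable).smul (c + 1)
  · exact hφ.integrable_smul H.locallyIntegrable

/-- First-order constant-coefficient operators lower the homogeneity by one: if `Σ ℓⱼ ∂ⱼ H = R`, the
superposition of dilates of `H` with weight `s^{-c-2}` is mapped to that of `R` with weight
`s^{-c-1}`. -/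
lemma IsWeakDeriv.integral_scaleInt {ℓ : Fin 3 → C3 →L[ℂ] C3} {c : ℂ} (hc : -(3 / 2) < c.re)
    {H R η : L2Field} (hη : ∀ᵐ x, η x = -scaleInt (c + 2) H x)
    (hHR : IsWeakDeriv ℓ (fun x => H x) (fun x => R x)) {φ : E3 → ℝ} (hφ : IsTestFunction φ) :
    -∫ x, ∑ j, partialDeriv φ j x • ℓ j (η x) =
      -∫ s in Ioi (1 : ℝ), (s : ℂ) ^ (-c - 1) • dilPair φ R s := by
  have ha : 1 / 2 < (c + 2).re := by simp; linarith
  have hloc (j : Fin 3) (ψ : E3 → ℝ) (hψ : IsTestFunction ψ) (f : L2Field) :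
      ∫ x, ψ x • ℓ j (f x) = ℓ j (∫ x, ψ x • f x) := by
    rw [← ContinuousLinearMap.integral_comp_comm _ (hψ.integrable_smul f.locallyIntegrable)]
    refine integral_congr_ae (ae_of_all _ fun x => ?_)
    exact (((ℓ j).restrictScalars ℝ).map_smul (ψ x) (f x)).symm
  have hint (j : Fin 3) (ψ : E3 → ℝ) (hψ : IsTestFunction ψ) (f : L2Field) :
      Integrable fun x => ψ x • ℓ j (f x) := by
    refine (ContinuousLinearMap.integrable_comp (ℓ j)
      (hψ.integrable_smul f.locallyIntegrable)).congr (ae_of_all _ fun x => ?_)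
    exact ((ℓ j).restrictScalars ℝ).map_smul (ψ x) (f x)
  have hre : (-(c + 2) : ℂ).re < 1 / 2 := by simp; linarith
  have hpair : ∀ ψ : E3 → ℝ, IsTestFunction ψ →
      ∫ x, ψ x • η x = -∫ s in Ioi (1 : ℝ), (s : ℂ) ^ (-(c + 2)) • dilPair ψ H s := by
    intro ψ hψ
    rw [← integral_smul_scaleInt ha H hψ, ← integral_neg]
    refine integral_congr_ae ?_
    filter_upwards [hη] with x hx
    rw [hx, smul_neg]
  have hi (j : Fin 3) : Integrable (fun s : ℝ => (s : ℂ) ^ (-(c + 2)) •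
      dilPair (partialDeriv φ j) H s) (volume.restrict (Ioi 1)) :=
    integrableOn_cpow_smul_dilPair (hφ.partialDeriv j) H hre
  rw [integral_finsetSum _ fun j _ => hint j _ (hφ.partialDeriv j) η]
  congr 1
  simp only [hloc _ _ (hφ.partialDeriv _), hpair _ (hφ.partialDeriv _), map_neg]
  simp only [← ContinuousLinearMap.integral_comp_comm _ (hi _), Finset.sum_neg_distrib]
  rw [← integral_finsetSum _ fun j _ => ContinuousLinearMap.integrable_comp (ℓ j) (hi j),
    ← integral_neg]
  refine setIntegral_congr_fun measurableSet_Ioi fun s hs => ?_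
  have hs0 : (0 : ℝ) < s := lt_trans one_pos hs
  have hsC : (s : ℂ) ≠ 0 := by exact_mod_cast hs0.ne'
  have h1 := hHR _ (hφ.dilate hs0)
  simp only [partialDeriv_dilate hφ] at h1
  have hint2 (j : Fin 3) := hint j _ (((hφ.partialDeriv j).dilate hs0).const_mul s⁻¹) H
  rw [integral_finsetSum _ fun j _ => hint2 j] at h1
  have h2 (j : Fin 3) : ∫ x, (s⁻¹ * dilate s (partialDeriv φ j) x) • ℓ j (H x) =
      s⁻¹ • ℓ j (dilPair (partialDeriv φ j) H s) := by
    simp only [mul_smul]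
    rw [integral_smul, hloc j _ ((hφ.partialDeriv j).dilate hs0)]
    rfl
  simp only [h2] at h1
  have h3 : dilPair φ R s = ∫ x, dilate s φ x • R x := rfl
  rw [h3, h1]
  simp only [map_smul, smul_neg, Finset.smul_sum]
  congr 1
  refine Finset.sum_congr rfl fun j _ => ?_
  rw [← Complex.coe_smul, smul_smul]
  congr 1
  rw [show -(c + 2) = (-c - 1) - 1 by ring, Complex.cpow_sub _ _ hsC, Complex.cpow_one]
  push_cast
  rfl

/-- The velocity built from `H` has curl `ζ` if `ξ · ∇ζ = c ζ + curl H`; stated for every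
first-order operator in place of the curl. -/
lemma IsWeakDeriv.of_scaleInt {ℓ : Fin 3 → C3 →L[ℂ] C3} {c : ℂ} (hc : -(3 / 2) < c.re)
    {H R η ζ X : L2Field} (hη : ∀ᵐ x, η x = -scaleInt (c + 2) H x)
    (hHR : IsWeakDeriv ℓ (fun x => H x) (fun x => R x))
    (hX : IsAdvection (fun ξ => ξ) (fun x => ζ x) X) (hXeq : X = c • ζ + R) :
    IsWeakDeriv ℓ (fun x => η x) (fun x => ζ x) := fun φ hφ => by
  rw [hX.integral_smul_eq hc hXeq hφ, IsWeakDeriv.integral_scaleInt hc hη hHR hφ]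

/-- Homogeneous first-order relations, such as vanishing divergence, pass from `H` to the
superposition of its dilates. -/
lemma IsWeakDeriv.zero_of_scaleInt {ℓ : Fin 3 → C3 →L[ℂ] C3} {c : ℂ} (hc : -(3 / 2) < c.re)
    {H η : L2Field} (hη : ∀ᵐ x, η x = -scaleInt (c + 2) H x)
    (hH : IsWeakDeriv ℓ (fun x => H x) 0) : IsWeakDeriv ℓ (fun x => η x) 0 := fun φ hφ => by
  have h0 : IsWeakDeriv ℓ (fun x => H x) (fun x => (0 : L2Field) x) :=
    IsWeakDeriv.congr_ae hH (ae_of_all _ fun _ => rfl) (Lp.coeFn_zero _ _ _).symm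
  rw [IsWeakDeriv.integral_scaleInt hc hη h0 hφ]
  have h1 : ∀ s, dilPair φ (fun x => (0 : L2Field) x) s = 0 := fun s => by
    simp [dilPair]
  simp only [h1, Pi.zero_apply, smul_zero, integral_zero, neg_zero]

/-! ### Regularity of the Biot–Savart velocity -/

lemma norm_fourierInv_le {F : Type*} [NormedAddCommGroup F] [NormedSpace ℂ F] (g : E3 → F)
    (x : E3) : ‖𝓕⁻ g x‖ ≤ ∫ k, ‖g k‖ :=
  VectorFourier.norm_fourierIntegral_le_integral_norm _ _ _ _ _

lemma continuous_fourierInv {g : E3 → C3} (hg : Integrable g) : Continuous (𝓕⁻ g) :=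
  VectorFourier.fourierIntegral_continuous (L := -innerₗ E3) Real.continuous_fourierChar
    (continuous_inner.neg : Continuous fun p : E3 × E3 => -inner ℝ p.1 p.2) hg

/-- Fourier inversion by duality, for an inverse Fourier integral that need not be in `L²`. -/
lemma integral_fourier_smul_fourierInv (χ : 𝓢(E3, ℂ)) {g : E3 → C3} (hg : Integrable g) :
    ∫ x, (𝓕 χ : 𝓢(E3, ℂ)) x • 𝓕⁻ g x = ∫ k, χ k • g k := by
  have h := VectorFourier.integral_fourierIntegral_smul_eq_flip (L := -innerₗ E3)
    (μ := volume) (ν := volume) Real.continuous_fourierChar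
    (continuous_inner.neg : Continuous fun p : E3 × E3 => -inner ℝ p.1 p.2)
    (𝓕 χ : 𝓢(E3, ℂ)).integrable hg
  have h1 : (-innerₗ E3).flip = -innerₗ E3 := by
    ext x y
    simp [real_inner_comm]
  rw [h1] at h
  have h2 : ∀ k, VectorFourier.fourierIntegral Real.fourierChar volume (-innerₗ E3)
      (𝓕 χ : 𝓢(E3, ℂ)) k = χ k := fun k => by
    have : (𝓕⁻ (𝓕 χ : 𝓢(E3, ℂ)) : 𝓢(E3, ℂ)) k = χ k := by
      rw [FourierTransform.fourierInv_fourier_eq]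
    rw [← this, SchwartzMap.fourierInv_coe]
    rfl
  simp only [h2] at h
  exact h.symm

/-- A field of `L²` whose Fourier transform is integrable is given by the inverse Fourier
integral. -/
lemma ae_eq_fourierInv {f : L2Field} {g : E3 → C3} (hg : Integrable g)
    (hfg : ∀ᵐ k, (𝓕 f : L2Field) k = g k) : ∀ᵐ x, f x = 𝓕⁻ g x := by
  have hloc : LocallyIntegrable (fun x => f x - 𝓕⁻ g x) volume :=
    f.locallyIntegrable.sub (continuous_fourierInv hg).locallyIntegrable
  have h := ae_eq_zero_of_integral_contDiff_smul_eq_zero hloc ?_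
  · filter_upwards [h] with x hx using sub_eq_zero.1 hx
  intro φ h1 h2
  have hφ : IsTestFunction φ := ⟨h1, h2⟩
  have e1 := integral_fourier_smul_L2 (𝓕⁻ hφ.toSchwartz) f
  have e2 := integral_fourier_smul_fourierInv (𝓕⁻ hφ.toSchwartz) hg
  rw [FourierTransform.fourier_fourierInv_eq] at e1 e2
  simp only [IsTestFunction.toSchwartz_apply, Complex.coe_smul] at e1 e2
  simp only [smul_sub]
  rw [integral_sub (hφ.integrable_smul f.locallyIntegrable)
    (hφ.integrable_smul (continuous_fourierInv hg).locallyIntegrable), e1, e2, sub_eq_zero]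
  refine integral_congr_ae ?_
  filter_upwards [hfg] with k hk
  rw [hk]

lemma integrableOn_inv_one_add_sq : IntegrableOn (fun r : ℝ => ((1 + r) ^ 2)⁻¹) (Ioi 0) := by
  have h := integrable_inv_one_add_sq.integrableOn (s := Ioi (0 : ℝ))
  refine Integrable.mono' h ?_ ?_
  · exact (by fun_prop : Measurable fun r : ℝ => ((1 + r) ^ 2)⁻¹).aestronglyMeasurable
  · refine (ae_restrict_iff' measurableSet_Ioi).2 (ae_of_all _ fun r hr => ?_)
    have hr0 : (0 : ℝ) < r := hr
    rw [Real.norm_of_nonneg (by positivity)]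
    refine inv_anti₀ (by positivity) ?_
    nlinarith

/-- The singularity `|k|⁻²` is integrable at the origin of `ℝ³`, and the weight decays like `|k|⁻⁴`
after squaring. -/
lemma memLp_weight : MemLp (fun k : E3 => ‖k‖⁻¹ * (1 + ‖k‖)⁻¹) 2 volume := by
  have hm : Measurable fun k : E3 => ‖k‖⁻¹ * (1 + ‖k‖)⁻¹ := by fun_prop
  rw [memLp_two_iff_integrable_sq hm.aestronglyMeasurable]
  refine (integrable_fun_norm_addHaar (volume : Measure E3)
    (f := fun r : ℝ => (r⁻¹ * (1 + r)⁻¹) ^ 2)).2 ?_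
  refine integrableOn_inv_one_add_sq.congr_fun (fun r hr => ?_) measurableSet_Ioi
  have hr0 : (0 : ℝ) < r := hr
  simp only [finrank_euclideanSpace, Fintype.card_fin, smul_eq_mul]
  field_simp

/-- The near part of the Biot–Savart kernel is integrable. -/
lemma integrable_near_kernel :
    Integrable fun y : E3 => (Iio (1 : ℝ)).indicator (fun r => r⁻¹ ^ 2) ‖y‖ := by
  refine (integrable_fun_norm_addHaar (volume : Measure E3)).2 ?_
  have h : IntegrableOn (fun _ : ℝ => (1 : ℝ)) (Ioo 0 1) :=
    integrableOn_const (by simp) (by simp)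
  have h2 : IntegrableOn ((Iio (1 : ℝ)).indicator fun _ : ℝ => (1 : ℝ)) (Ioi 0) := by
    rw [IntegrableOn, integrable_indicator_iff measurableSet_Iio, IntegrableOn,
      Measure.restrict_restrict measurableSet_Iio, Iio_inter_Ioi]
    exact h
  refine h2.congr_fun (fun r hr => ?_) measurableSet_Ioi
  have hr0 : (0 : ℝ) < r := hr
  by_cases hr1 : r ∈ Iio (1 : ℝ)
  · simp only [indicator_of_mem hr1, finrank_euclideanSpace, Fintype.card_fin, smul_eq_mul]
    field_simp
  · simp only [indicator_of_notMem hr1, smul_zero]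

/-- The far part of the Biot–Savart kernel is square-integrable. -/
lemma memLp_far_kernel :
    MemLp (fun y : E3 => (Ici (1 : ℝ)).indicator (fun r => r⁻¹ ^ 2) ‖y‖) 2 volume := by
  have hm : Measurable fun r : ℝ => (Ici (1 : ℝ)).indicator (fun r => r⁻¹ ^ 2) r :=
    (by fun_prop : Measurable fun r : ℝ => r⁻¹ ^ 2).indicator measurableSet_Ici
  refine (memLp_two_iff_integrable_sq (hm.comp measurable_norm).aestronglyMeasurable).2 ?_
  refine (integrable_fun_norm_addHaar (volume : Measure E3)
    (f := fun r => (Ici (1 : ℝ)).indicator (fun r => r⁻¹ ^ 2) r ^ 2)).2 ?_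
  refine Integrable.mono' ((integrableOn_inv_one_add_sq).const_mul 4) ?_ ?_
  · exact ((measurable_id.pow_const _).smul (hm.pow_const 2)).aestronglyMeasurable
  · refine (ae_restrict_iff' measurableSet_Ioi).2 (ae_of_all _ fun r hr => ?_)
    have hr0 : (0 : ℝ) < r := hr
    simp only [finrank_euclideanSpace, Fintype.card_fin, smul_eq_mul]
    by_cases hr1 : r ∈ Ici (1 : ℝ)
    · have hr1' : (1 : ℝ) ≤ r := hr1
      rw [indicator_of_mem hr1, Real.norm_of_nonneg (by positivity), ← div_eq_mul_inv,
        le_div_iff₀ (by positivity)]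
      have : r ^ (3 - 1) * (r⁻¹ ^ 2) ^ 2 = (r ^ 2)⁻¹ := by norm_num; field_simp
      rw [this, inv_mul_le_iff₀ (by positivity)]
      nlinarith
    · rw [indicator_of_notMem hr1]
      simp
      positivity

lemma inv_sq_eq_near_add_far (y : E3) : ‖y‖⁻¹ ^ 2 =
    (Iio (1 : ℝ)).indicator (fun r => r⁻¹ ^ 2) ‖y‖ +
      (Ici (1 : ℝ)).indicator (fun r => r⁻¹ ^ 2) ‖y‖ := by
  have := congrFun (indicator_self_add_compl (Iio (1 : ℝ)) fun r => r⁻¹ ^ 2) ‖y‖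
  rw [compl_Iio] at this
  exact this.symm

lemma integrable_far_mul (ζ : L2Field) (x : E3) : Integrable fun y : E3 =>
    (Ici (1 : ℝ)).indicator (fun r => r⁻¹ ^ 2) ‖y‖ * ‖ζ (x - y)‖ :=
  memLp_far_kernel.integrable_mul
    ((Lp.memLp ζ).norm.comp_measurePreserving (Measure.measurePreserving_sub_left volume x))

/-- The Biot–Savart integral of a field of `L²` converges absolutely almost everywhere. -/
lemma ae_integrable_biotSavart (ζ : L2Field) :
    ∀ᵐ x, Integrable fun y => ‖y‖⁻¹ ^ 2 * ‖ζ (x - y)‖ := by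
  -- the near kernel and `|ζ|²` are integrable, so that their convolution exists almost everywhere
  filter_upwards [integrable_near_kernel.ae_convolution_exists (ContinuousLinearMap.mul ℝ ℝ)
    ζ.integrable_sq_norm] with x hx
  have h1 : Integrable fun y : E3 =>
      (Iio (1 : ℝ)).indicator (fun r => r⁻¹ ^ 2) ‖y‖ * ‖ζ (x - y)‖ ^ 2 := hx
  have hm : AEStronglyMeasurable (fun y => ‖ζ (x - y)‖) volume :=
    ((Lp.aestronglyMeasurable ζ).comp_measurePreserving
      (Measure.measurePreserving_sub_left volume x)).norm
  have h2 : Integrable fun y : E3 =>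
      (Iio (1 : ℝ)).indicator (fun r => r⁻¹ ^ 2) ‖y‖ * ‖ζ (x - y)‖ := by
    refine Integrable.mono' (integrable_near_kernel.add h1)
      (integrable_near_kernel.aestronglyMeasurable.mul hm) (ae_of_all _ fun y => ?_)
    have h0 : 0 ≤ (Iio (1 : ℝ)).indicator (fun r => r⁻¹ ^ 2) ‖y‖ :=
      indicator_nonneg (fun r _ => by positivity) _
    rw [Real.norm_of_nonneg (by positivity), Pi.add_apply]
    nlinarith [mul_nonneg h0 (sq_nonneg (‖ζ (x - y)‖ - 1)), mul_nonneg h0 (norm_nonneg (ζ (x - y)))]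
  refine (h2.add (integrable_far_mul ζ x)).congr (ae_of_all _ fun y => ?_)
  simp only [Pi.add_apply]
  rw [inv_sq_eq_near_add_far y, add_mul]

/-- The Biot–Savart velocity `𝓕⁻(i k × ζ̂ / (2π|k|²))`, defined everywhere by an inverse Fourier
integral. -/
def velocity (ζ : L2Field) : E3 → C3 :=
  𝓕⁻ fun k => velocityMultiplier k ((𝓕 ζ : L2Field) k)

lemma aestronglyMeasurable_velocityMultiplier (ζ : L2Field) :
    AEStronglyMeasurable (fun k => velocityMultiplier k ((𝓕 ζ : L2Field) k)) volume := by
  have h1 : Measurable fun k : E3 =>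
      Complex.I * ((1 / (2 * Real.pi * ‖k‖ ^ 2) : ℝ) : ℂ) := by fun_prop
  exact h1.aestronglyMeasurable.smul (aestronglyMeasurable_cross
    complexify.continuous.aestronglyMeasurable (Lp.aestronglyMeasurable _))

/-- For `ζ ∈ H¹` the Fourier transform of the velocity is integrable, although it need not be
square integrable near `k = 0`. -/
lemma integrable_inv_mul_norm_fourier {ζ : L2Field}
    (hk : MemLp (fun k => ‖k‖ * ‖(𝓕 ζ : L2Field) k‖) 2 volume) :
    Integrable fun k => ‖k‖⁻¹ * ‖(𝓕 ζ : L2Field) k‖ := by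
  have h1 : MemLp (fun k => ‖(𝓕 ζ : L2Field) k‖ + ‖k‖ * ‖(𝓕 ζ : L2Field) k‖) 2 volume :=
    (Lp.memLp _).norm.add hk
  refine (memLp_weight.integrable_mul h1).congr (ae_of_all _ fun k => ?_)
  simp only [Pi.mul_apply]
  have : 1 + ‖k‖ ≠ 0 := by positivity
  field_simp

lemma integrable_velocityMultiplier {ζ : L2Field}
    (hk : MemLp (fun k => ‖k‖ * ‖(𝓕 ζ : L2Field) k‖) 2 volume) :
    Integrable fun k => velocityMultiplier k ((𝓕 ζ : L2Field) k) :=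
  (integrable_inv_mul_norm_fourier hk).mono' (aestronglyMeasurable_velocityMultiplier ζ)
    (ae_of_all _ fun _ => norm_velocityMultiplier_le _ _)

/-- For `ζ ∈ H¹` the Biot–Savart integral is, almost everywhere, the bounded continuous field
`velocity ζ`. -/
lemma biotSavart_ae_eq_velocity {ζ : L2Field}
    (hk : MemLp (fun k => ‖k‖ * ‖(𝓕 ζ : L2Field) k‖) 2 volume) :
    ∀ᵐ x, biotSavart (fun x => ζ x) x = velocity ζ x := by
  filter_upwards [ae_integrable_biotSavart ζ] with x hx
  exact biotSavart_eq_fourierInv ζ x hx (integrable_inv_mul_norm_fourier hk)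

lemma continuous_velocity {ζ : L2Field}
    (hk : MemLp (fun k => ‖k‖ * ‖(𝓕 ζ : L2Field) k‖) 2 volume) : Continuous (velocity ζ) :=
  continuous_fourierInv (integrable_velocityMultiplier hk)

/-- The velocity is divergence-free. It is only known to be bounded, so that the `L²` theory of
weak derivatives does not apply, and the transposition is done by hand. -/
lemma isWeakDeriv_div_velocity {ζ : L2Field}
    (hk : MemLp (fun k => ‖k‖ * ‖(𝓕 ζ : L2Field) k‖) 2 volume) :
    IsWeakDeriv divSym (velocity ζ) 0 := by
  intro φ hφ
  set g := fun k => velocityMultiplier k ((𝓕 ζ : L2Field) k) with hgdef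
  have hg : Integrable g := integrable_velocityMultiplier hk
  choose χ hχ hd using exists_fderiv_fourier_eq (𝓕⁻ hφ.toSchwartz)
  rw [FourierTransform.fourier_fourierInv_eq] at hd
  simp only [IsTestFunction.fderiv_toSchwartz] at hd
  have h1 : ∀ j, ∫ x, partialDeriv φ j x • velocity ζ x = ∫ k, χ j k • g k := fun j => by
    rw [← integral_fourier_smul_fourierInv (χ j) hg]
    refine integral_congr_ae (ae_of_all _ fun x => ?_)
    simp only
    rw [← hd, Complex.coe_smul]
    rfl
  have hu : LocallyIntegrable (velocity ζ) volume := (continuous_velocity hk).locallyIntegrable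
  have hi : ∀ j, Integrable fun x => partialDeriv φ j x • velocity ζ x := fun j =>
    (hφ.partialDeriv j).integrable_smul hu
  have hχi : ∀ j, Integrable fun k => χ j k • g k := fun j => by
    exact hg.bdd_smul _ (χ j).continuous.aestronglyMeasurable
      (ae_of_all _ fun k => (χ j).toBoundedContinuousFunction.norm_coe_le_norm k)
  have h2 : ∫ x, ∑ j, partialDeriv φ j x • divSym j (velocity ζ x) =
      ∑ j, divSym j (∫ x, partialDeriv φ j x • velocity ζ x) := by
    simp only [← ContinuousLinearMap.integral_comp_comm _ (hi _)]
    rw [← integral_finsetSum _ fun j _ => ContinuousLinearMap.integrable_comp (divSym j) (hi j)]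
    refine integral_congr_ae (ae_of_all _ fun x => Finset.sum_congr rfl fun j _ => ?_)
    exact (((divSym j).restrictScalars ℝ).map_smul _ _).symm
  have h3 : ∑ j, divSym j (∫ k, χ j k • g k) = 0 := by
    simp only [← ContinuousLinearMap.integral_comp_comm _ (hχi _)]
    rw [← integral_finsetSum _ fun j _ => ContinuousLinearMap.integrable_comp (divSym j) (hχi j)]
    refine integral_eq_zero_of_ae (ae_of_all _ fun k => ?_)
    have h4 := dot_velocityMultiplier k ((𝓕 ζ : L2Field) k)
    simp only [divSym_apply, hχ, PiLp.smul_apply, smul_eq_mul, Pi.zero_apply]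
    rw [← Finset.sum_smul]
    have h5 : ∑ j, -((2 * Real.pi * Complex.I : ℂ) * ((k j : ℝ) : ℂ)) *
        (𝓕⁻ hφ.toSchwartz : 𝓢(E3, ℂ)) k * g k j =
        (-(2 * Real.pi * Complex.I) * (𝓕⁻ hφ.toSchwartz : 𝓢(E3, ℂ)) k) *
          ∑ j, ((k j : ℝ) : ℂ) * g k j := by
      rw [Finset.mul_sum]
      exact Finset.sum_congr rfl fun j _ => by ring
    rw [h5, hgdef, h4]
    simp
  rw [h2]
  simp only [h1, h3, Pi.zero_apply, smul_zero, integral_zero, neg_zero]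

/-! ### The background velocity -/

lemma fourierInv_clm_comp (L : C3 →L[ℂ] C3) {g : E3 → C3} (hg : Integrable g) (x : E3) :
    𝓕⁻ (fun k => L (g k)) x = L (𝓕⁻ g x) := by
  have hi : Integrable fun k => Real.fourierChar (inner ℝ k x) • g k := by
    have h := (Real.fourierIntegral_convergent_iff (-x)).2 hg
    simpa using h
  rw [Real.fourierInv_eq, Real.fourierInv_eq, ← ContinuousLinearMap.integral_comp_comm L hi]
  refine integral_congr_ae (ae_of_all _ fun k => ?_)
  simp only [Circle.smul_def, map_smul]

lemma fderiv_fourierInv_apply {g : E3 → C3} (h0 : Integrable g)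
    (h1 : Integrable fun k => ‖k‖ * ‖g k‖) (x v : E3) :
    fderiv ℝ (𝓕⁻ g) x v =
      𝓕⁻ (fun k => (2 * Real.pi * Complex.I * ((inner ℝ k v : ℝ) : ℂ)) • g k) x := by
  have hd := (VectorFourier.hasFDerivAt_fourierIntegral (-innerSL ℝ) h0 h1 x).fderiv
  have e : (𝓕⁻ g) = VectorFourier.fourierIntegral Real.fourierChar volume
    (-innerSL ℝ (E := E3)).toLinearMap₁₂ g := rfl
  have hm : Integrable (VectorFourier.fourierSMulRight (-innerSL ℝ (E := E3)) g) := by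
    refine Integrable.mono' (h1.const_mul (2 * Real.pi * ‖(-innerSL ℝ (E := E3))‖))
      h0.aestronglyMeasurable.fourierSMulRight (ae_of_all _ fun k => ?_)
    rw [← mul_assoc]
    exact VectorFourier.norm_fourierSMulRight_le _ _ _
  rw [e, hd, Real.fourierIntegral_continuousLinearMap_apply' hm]
  simp only [VectorFourier.fourierSMulRight_apply]
  refine congrArg (fun f : E3 → C3 => (𝓕⁻ f : E3 → C3) x) (funext fun k => ?_)
  simp only [neg_apply, neg_smul, smul_neg, neg_neg]
  rw [mul_smul (2 * (Real.pi : ℂ) * Complex.I), Complex.coe_smul]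
  rfl

lemma norm_fderiv_fourierInv_le {g : E3 → C3} (h0 : Integrable g)
    (h1 : Integrable fun k => ‖k‖ * ‖g k‖) (x v : E3) :
    ‖fderiv ℝ (𝓕⁻ g) x v‖ ≤ (2 * Real.pi * ∫ k, ‖k‖ * ‖g k‖) * ‖v‖ := by
  rw [fderiv_fourierInv_apply h0 h1]
  refine (norm_fourierInv_le _ _).trans ?_
  rw [← integral_const_mul, ← integral_mul_const]
  refine integral_mono_of_nonneg (ae_of_all _ fun k => norm_nonneg _)
    ((h1.const_mul _).mul_const _) (ae_of_all _ fun k => ?_)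
  simp only [norm_smul, norm_mul, Complex.norm_I, Complex.norm_real, Complex.norm_ofNat,
    Real.norm_of_nonneg Real.pi_pos.le, mul_one]
  have := norm_inner_le_norm (𝕜 := ℝ) k v
  calc _ ≤ 2 * Real.pi * (‖k‖ * ‖v‖) * ‖g k‖ := by gcongr
    _ = _ := by ring

/-- A classical first-order system applied to an inverse Fourier integral acts through its symbol.
-/
lemma sum_fderiv_fourierInv (ℓ : Fin 3 → C3 →L[ℂ] C3) {g : E3 → C3} (h0 : Integrable g)
    (h1 : Integrable fun k => ‖k‖ * ‖g k‖) (x : E3) :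
    ∑ j, ℓ j (fderiv ℝ (𝓕⁻ g) x (basisVec j)) =
      𝓕⁻ (fun k => (2 * Real.pi * Complex.I : ℂ) • weakSymbol ℓ k (g k)) x := by
  have hi (j : Fin 3) : Integrable fun k : E3 =>
      (2 * Real.pi * Complex.I * ((inner ℝ k (basisVec j) : ℝ) : ℂ)) • g k := by
    refine Integrable.mono' (h1.const_mul (2 * Real.pi)) ?_ (ae_of_all _ fun k => ?_)
    · have hc : Continuous fun k : E3 =>
          2 * Real.pi * Complex.I * ((inner ℝ k (basisVec j) : ℝ) : ℂ) := by fun_prop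
      exact hc.aestronglyMeasurable.smul h0.aestronglyMeasurable
    · simp only [norm_smul, norm_mul, Complex.norm_I, Complex.norm_real, Complex.norm_ofNat,
        Real.norm_of_nonneg Real.pi_pos.le, mul_one]
      have := norm_inner_le_norm (𝕜 := ℝ) k (basisVec j)
      rw [norm_basisVec, mul_one] at this
      calc _ ≤ 2 * Real.pi * ‖k‖ * ‖g k‖ := by gcongr
        _ = _ := by ring
  simp only [fderiv_fourierInv_apply h0 h1, ← fourierInv_clm_comp _ (hi _)]
  simp only [Real.fourierInv_eq]
  rw [← integral_finsetSum]
  · refine integral_congr_ae (ae_of_all _ fun k => ?_)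
    simp only [weakSymbol, Finset.smul_sum, map_smul]
    refine Finset.sum_congr rfl fun j _ => ?_
    rw [smul_smul]
    congr 2
    simp [basisVec, EuclideanSpace.inner_single_right]
  · intro j _
    have h := (Real.fourierIntegral_convergent_iff (-x)).2
      (ContinuousLinearMap.integrable_comp (ℓ j) (hi j))
    simpa using h

lemma contDiff_fourierInv {g : E3 → C3}
    (h : ∀ n : ℕ, Integrable fun k => ‖k‖ ^ n * ‖g k‖) : ContDiff ℝ ∞ (𝓕⁻ g) :=
  VectorFourier.contDiff_fourierIntegral (N := ⊤) (-innerSL ℝ) fun n _ => h n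

lemma complexify_biotSavart (Ω : E3 → E3) (x : E3) :
    complexify (biotSavart Ω x) = biotSavart (fun y => complexify (Ω y)) x := by
  rw [biotSavart, biotSavart, map_neg, ← LinearIsometry.integral_comp_comm]
  congr 1
  refine integral_congr_ae (ae_of_all _ fun y => ?_)
  simp only [map_smul]
  congr 1
  refine C3.ext ?_ ?_ ?_ <;> simp [cross_apply]

/-- The real part of a complex vector. -/
def reField : C3 →L[ℝ] E3 :=
  LinearMap.toContinuousLinearMap
    { toFun := fun v => WithLp.toLp 2 fun i => (v i).re
      map_add' := fun a b => by ext i; simp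
      map_smul' := fun a b => by ext i; simp }

lemma reField_complexify (a : E3) : reField (complexify a) = a := by
  ext i; simp [reField]

section Background

variable {Ωb : E3 → E3}

/-- A smooth compactly supported real field, as a complex Schwartz field. -/
def fieldToSchwartz (h1 : ContDiff ℝ ∞ Ωb) (h2 : HasCompactSupport Ωb) : 𝓢(E3, C3) :=
  HasCompactSupport.toSchwartzMap (f := fun x => complexify (Ωb x))
    (h2.comp_left (g := complexify) (map_zero _)) (complexify.contDiff.comp h1)

lemma fieldToSchwartz_apply (h1 : ContDiff ℝ ∞ Ωb) (h2 : HasCompactSupport Ωb) (x : E3) :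
    fieldToSchwartz h1 h2 x = complexify (Ωb x) := rfl

lemma fderiv_complexify_comp {b : E3 → E3} {x : E3} (hb : DifferentiableAt ℝ b x) (v : E3) :
    fderiv ℝ (fun y => complexify (b y)) x v = complexify (fderiv ℝ b x v) := by
  have h := (complexify.toContinuousLinearMap.hasFDerivAt.comp x hb.hasFDerivAt).fderiv
  have e : (fun y => complexify (b y)) = complexify.toContinuousLinearMap ∘ b := rfl
  rw [e, h]
  rfl

lemma sum_divSym_complexify (b : E3 → E3) (x : E3) :
    ∑ j, divSym j (complexify (fderiv ℝ b x (basisVec j))) =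
      ((divergence b x : ℝ) : ℂ) • complexify (basisVec 0) := by
  simp only [divSym_apply, complexify_apply, ← Finset.sum_smul, divergence]
  push_cast
  rfl

lemma fourierInv_fourier_schwartz (W : 𝓢(E3, C3)) (x : E3) :
    𝓕⁻ (fun k => (𝓕 W : 𝓢(E3, C3)) k) x = W x := by
  have : (𝓕⁻ (𝓕 W : 𝓢(E3, C3)) : 𝓢(E3, C3)) x = W x := by
    rw [FourierTransform.fourierInv_fourier_eq]
  rw [← this, SchwartzMap.fourierInv_coe]

/-- The divergence-free background vorticity has a Fourier transform orthogonal to `k`. -/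
lemma dot_fourier_eq_zero (h1 : ContDiff ℝ ∞ Ωb) (h2 : HasCompactSupport Ωb)
    (hdiv : ∀ x, divergence Ωb x = 0) :
    ∀ᵐ k : E3, ∑ j, ((k j : ℝ) : ℂ) * (𝓕 (fieldToSchwartz h1 h2) : 𝓢(E3, C3)) k j = 0 := by
  set W := fieldToSchwartz h1 h2 with hW
  set g : E3 → C3 := fun k =>
    (2 * Real.pi * Complex.I : ℂ) • weakSymbol divSym k ((𝓕 W : 𝓢(E3, C3)) k) with hg
  have i0 : Integrable fun k => (𝓕 W : 𝓢(E3, C3)) k := (𝓕 W : 𝓢(E3, C3)).integrable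
  have i1 : Integrable fun k => ‖k‖ * ‖(𝓕 W : 𝓢(E3, C3)) k‖ := by
    simpa using (𝓕 W : 𝓢(E3, C3)).integrable_pow_mul volume 1
  have hz : ∀ x, 𝓕⁻ g x = 0 := fun x => by
    rw [hg, ← sum_fderiv_fourierInv divSym i0 i1]
    have e : 𝓕⁻ (fun k => (𝓕 W : 𝓢(E3, C3)) k) = fun x => complexify (Ωb x) :=
      funext fun x => fourierInv_fourier_schwartz W x
    rw [e]
    simp only [fderiv_complexify_comp (h1.differentiable (by simp) x)]
    rw [sum_divSym_complexify, hdiv]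
    simp
  have gi : Integrable g := by
    have hc : Continuous g := by
      simp only [hg, weakSymbol]
      have := (𝓕 W : 𝓢(E3, C3)).continuous
      fun_prop
    refine Integrable.mono' (i1.const_mul (2 * Real.pi * ∑ j, ‖divSym j‖))
      hc.aestronglyMeasurable (ae_of_all _ fun k => ?_)
    simp only [hg, norm_smul, norm_mul, Complex.norm_I, Complex.norm_real, Complex.norm_ofNat,
        Real.norm_of_nonneg Real.pi_pos.le, mul_one]
    rw [mul_assoc (2 * Real.pi) (∑ j, ‖divSym j‖)]
    gcongr
    rw [weakSymbol, Finset.sum_mul]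
    refine norm_sum_le_of_le _ fun j _ => ?_
    rw [norm_smul, Complex.norm_real]
    have e1 : ‖k j‖ ≤ ‖k‖ := PiLp.norm_apply_le k j
    have e2 := (divSym j).le_opNorm ((𝓕 W : 𝓢(E3, C3)) k)
    calc _ ≤ ‖k‖ * (‖divSym j‖ * ‖(𝓕 W : 𝓢(E3, C3)) k‖) := by gcongr
      _ = _ := by ring
  have hg0 := ae_eq_zero_of_integral_contDiff_smul_eq_zero gi.locallyIntegrable
    fun φ hφ1 hφ2 => by
      have h := integral_fourier_smul_fourierInv (IsTestFunction.toSchwartz ⟨hφ1, hφ2⟩) gi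
      simp only [hz, smul_zero, integral_zero] at h
      exact h.symm
  filter_upwards [hg0] with k hk
  simp only [hg, weakSymbol_div] at hk
  have h := congrArg (fun v : C3 => v 0) hk
  simpa [basisVec, Real.pi_ne_zero] using h

/-- The Fourier transform of the velocity of the background vorticity. -/
def backgroundHat (h1 : ContDiff ℝ ∞ Ωb) (h2 : HasCompactSupport Ωb) (k : E3) : C3 :=
  velocityMultiplier k ((𝓕 (fieldToSchwartz h1 h2) : 𝓢(E3, C3)) k)

lemma memLp_norm_mul_schwartz (W : 𝓢(E3, C3)) : MemLp (fun k => ‖k‖ * ‖W k‖) 2 volume := by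
  have hm : Continuous fun k => ‖k‖ * ‖W k‖ := by have := W.continuous; fun_prop
  rw [memLp_two_iff_integrable_sq hm.aestronglyMeasurable]
  have h := (W.integrable_pow_mul volume 2).bdd_mul (c := ‖W.toBoundedContinuousFunction‖)
    (f := fun k => ‖W k‖) W.continuous.norm.aestronglyMeasurable
    (ae_of_all _ fun k => by
      rw [norm_norm]; exact W.toBoundedContinuousFunction.norm_coe_le_norm k)
  refine h.congr (ae_of_all _ fun k => ?_)
  simp only
  ring

lemma ae_fourier_toLp (W : 𝓢(E3, C3)) :
    ∀ᵐ k, (𝓕 (W.toLp 2) : L2Field) k = (𝓕 W : 𝓢(E3, C3)) k := by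
  rw [SchwartzMap.toLp_fourier_eq]
  exact (𝓕 W : 𝓢(E3, C3)).coeFn_toLp 2 volume

lemma memLp_norm_mul_fourier_toLp (W : 𝓢(E3, C3)) :
    MemLp (fun k => ‖k‖ * ‖(𝓕 (W.toLp 2) : L2Field) k‖) 2 volume := by
  refine (memLp_congr_ae ?_).2 (memLp_norm_mul_schwartz (𝓕 W))
  filter_upwards [ae_fourier_toLp W] with k hk
  rw [hk]

lemma integrable_pow_mul_backgroundHat (h1 : ContDiff ℝ ∞ Ωb) (h2 : HasCompactSupport Ωb)
    (n : ℕ) : Integrable fun k => ‖k‖ ^ n * ‖backgroundHat h1 h2 k‖ := by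
  set W := fieldToSchwartz h1 h2 with hW
  have hae : ∀ᵐ k, velocityMultiplier k ((𝓕 (W.toLp 2) : L2Field) k) = backgroundHat h1 h2 k := by
    filter_upwards [ae_fourier_toLp W] with k hk
    rw [hk, backgroundHat]
  have h0 : Integrable (backgroundHat h1 h2) :=
    (integrable_velocityMultiplier (memLp_norm_mul_fourier_toLp W)).congr hae
  rcases n with _ | n
  · simpa using h0.norm
  · have hm : AEStronglyMeasurable (fun k => ‖k‖ ^ (n + 1) * ‖backgroundHat h1 h2 k‖) volume :=
      (continuous_norm.pow _).aestronglyMeasurable.mul h0.aestronglyMeasurable.norm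
    refine ((𝓕 W : 𝓢(E3, C3)).integrable_pow_mul volume n).mono' hm ?_
    filter_upwards [ae_ne_zero] with k hk
    rw [Real.norm_of_nonneg (by positivity)]
    have := norm_velocityMultiplier_le k ((𝓕 W : 𝓢(E3, C3)) k)
    have hk' : ‖k‖ ≠ 0 := norm_ne_zero_iff.2 hk
    calc _ ≤ ‖k‖ ^ (n + 1) * (‖k‖⁻¹ * ‖(𝓕 W : 𝓢(E3, C3)) k‖) := by
          gcongr
          exact this
      _ = _ := by field_simp; ring

/-- The background velocity as an inverse Fourier integral, at every point. -/
lemma complexify_biotSavart_eq (h1 : ContDiff ℝ ∞ Ωb) (h2 : HasCompactSupport Ωb) (x : E3) :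
    complexify (biotSavart Ωb x) = 𝓕⁻ (backgroundHat h1 h2) x := by
  set W := fieldToSchwartz h1 h2 with hW
  have hWx : ∀ᵐ y, (W.toLp 2 : L2Field) y = W y := W.coeFn_toLp 2 volume
  have hshift : ∀ᵐ y, (W.toLp 2 : L2Field) (x - y) = W (x - y) :=
    (Measure.measurePreserving_sub_left volume x).quasiMeasurePreserving.ae hWx
  have e1 : biotSavart (fun y => complexify (Ωb y)) x =
      biotSavart (fun y => (W.toLp 2 : L2Field) y) x := by
    rw [biotSavart, biotSavart]
    congr 1
    refine integral_congr_ae ?_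
    filter_upwards [hshift] with y hy
    simp only [hy]
    rfl
  rw [complexify_biotSavart, e1, biotSavart_eq_fourierInv]
  · refine Real.fourierInv_congr_ae ?_ x
    filter_upwards [ae_fourier_toLp W] with k hk
    rw [hk, backgroundHat]
  · have hn : Integrable fun y : E3 =>
        (Iio (1 : ℝ)).indicator (fun r => r⁻¹ ^ 2) ‖y‖ * ‖W (x - y)‖ := by
      refine integrable_near_kernel.mul_bdd (c := ‖W.toBoundedContinuousFunction‖)
        (W.continuous.comp (continuous_const.sub continuous_id)).norm.aestronglyMeasurable
        (ae_of_all _ fun y => ?_)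
      rw [norm_norm]
      exact W.toBoundedContinuousFunction.norm_coe_le_norm (x - y)
    refine (hn.add (integrable_far_mul (W.toLp 2) x)).congr ?_
    filter_upwards [hshift] with y hy
    simp only [Pi.add_apply]
    rw [inv_sq_eq_near_add_far y, add_mul, hy]
  · exact integrable_inv_mul_norm_fourier (memLp_norm_mul_fourier_toLp W)

lemma biotSavart_eq_reField (h1 : ContDiff ℝ ∞ Ωb) (h2 : HasCompactSupport Ωb) :
    biotSavart Ωb = fun x => reField (𝓕⁻ (backgroundHat h1 h2) x) :=
  funext fun x => by rw [← complexify_biotSavart_eq h1 h2, reField_complexify]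

lemma contDiff_biotSavart (h1 : ContDiff ℝ ∞ Ωb) (h2 : HasCompactSupport Ωb) :
    ContDiff ℝ ∞ (biotSavart Ωb) := by
  rw [biotSavart_eq_reField h1 h2]
  exact reField.contDiff.comp (contDiff_fourierInv (integrable_pow_mul_backgroundHat h1 h2))

lemma integrable_backgroundHat (h1 : ContDiff ℝ ∞ Ωb) (h2 : HasCompactSupport Ωb) :
    Integrable (backgroundHat h1 h2) :=
  (integrable_velocityMultiplier (memLp_norm_mul_fourier_toLp (fieldToSchwartz h1 h2))).congr <| by
    filter_upwards [ae_fourier_toLp (fieldToSchwartz h1 h2)] with k hk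
    rw [hk, backgroundHat]

lemma norm_biotSavart_le (h1 : ContDiff ℝ ∞ Ωb) (h2 : HasCompactSupport Ωb) :
    ∃ C, ∀ x, ‖biotSavart Ωb x‖ ≤ C :=
  ⟨_, fun x => by
    rw [← complexify.norm_map, complexify_biotSavart_eq h1 h2]
    exact norm_fourierInv_le _ x⟩

lemma complexify_fderiv_biotSavart (h1 : ContDiff ℝ ∞ Ωb) (h2 : HasCompactSupport Ωb)
    (x v : E3) : complexify (fderiv ℝ (biotSavart Ωb) x v) =
      fderiv ℝ (𝓕⁻ (backgroundHat h1 h2)) x v := by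
  rw [← fderiv_complexify_comp ((contDiff_biotSavart h1 h2).differentiable (by simp) x)]
  rw [funext (complexify_biotSavart_eq h1 h2)]

lemma norm_fderiv_biotSavart_le (h1 : ContDiff ℝ ∞ Ωb) (h2 : HasCompactSupport Ωb) :
    ∃ C, ∀ x i, ‖fderiv ℝ (biotSavart Ωb) x (basisVec i)‖ ≤ C :=
  ⟨2 * Real.pi * ∫ k, ‖k‖ * ‖backgroundHat h1 h2 k‖, fun x i => by
    rw [← complexify.norm_map, complexify_fderiv_biotSavart h1 h2]
    refine (norm_fderiv_fourierInv_le (integrable_backgroundHat h1 h2)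
      (by simpa using integrable_pow_mul_backgroundHat h1 h2 1) x _).trans (le_of_eq ?_)
    rw [norm_basisVec, mul_one]⟩

lemma divergence_biotSavart (h1 : ContDiff ℝ ∞ Ωb) (h2 : HasCompactSupport Ωb) (x : E3) :
    divergence (biotSavart Ωb) x = 0 := by
  have h := sum_divSym_complexify (biotSavart Ωb) x
  simp only [complexify_fderiv_biotSavart h1 h2] at h
  rw [sum_fderiv_fourierInv divSym (integrable_backgroundHat h1 h2)
    (by simpa using integrable_pow_mul_backgroundHat h1 h2 1)] at h
  have h0 : ∀ k, weakSymbol divSym k (backgroundHat h1 h2 k) = 0 := fun k => by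
    rw [weakSymbol_div, backgroundHat, dot_velocityMultiplier, zero_smul]
  simp only [h0, smul_zero, Real.fourierInv_eq, integral_zero] at h
  have h3 := congrArg (fun v : C3 => v 0) h
  simpa [basisVec] using h3.symm

/-- The curl of the background velocity is the background vorticity. -/
lemma curl_biotSavart (h1 : ContDiff ℝ ∞ Ωb) (h2 : HasCompactSupport Ωb)
    (hdiv : ∀ x, divergence Ωb x = 0) (x : E3) :
    ∑ j, curlSym j (complexify (fderiv ℝ (biotSavart Ωb) x (basisVec j))) =
      complexify (Ωb x) := by
  simp only [complexify_fderiv_biotSavart h1 h2]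
  rw [sum_fderiv_fourierInv curlSym (integrable_backgroundHat h1 h2)
    (by simpa using integrable_pow_mul_backgroundHat h1 h2 1), ← fieldToSchwartz_apply h1 h2,
    ← fourierInv_fourier_schwartz]
  refine Real.fourierInv_congr_ae ?_ x
  filter_upwards [dot_fourier_eq_zero h1 h2 hdiv, ae_ne_zero] with k hk hk0
  rw [weakSymbol_curl, backgroundHat, cross_velocityMultiplier hk0 hk]

end Background

/-! ### Products with smooth fields -/

lemma IsTestFunction.integrable_smul_clm {φ : E3 → ℝ} (hφ : IsTestFunction φ) {f : E3 → C3}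
    (hf : LocallyIntegrable f volume) (L : C3 →L[ℂ] C3) : Integrable fun x => φ x • L (f x) := by
  refine (ContinuousLinearMap.integrable_comp L (hφ.integrable_smul hf)).congr
    (ae_of_all _ fun x => ?_)
  exact (L.restrictScalars ℝ).map_smul (φ x) (f x)

lemma partialDeriv_coord {b : E3 → E3} {x : E3} (hb : DifferentiableAt ℝ b x) (m j : Fin 3) :
    partialDeriv (fun y => b y m) j x = fderiv ℝ b x (basisVec j) m := by
  have h := ((EuclideanSpace.proj (𝕜 := ℝ) m).hasFDerivAt.comp x hb.hasFDerivAt).fderiv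
  have e : (fun y => b y m) = (EuclideanSpace.proj (𝕜 := ℝ) m) ∘ b := rfl
  rw [partialDeriv, e, h]
  rfl

lemma contDiff_coord {b : E3 → E3} (hb : ContDiff ℝ ∞ b) (m : Fin 3) :
    ContDiff ℝ ∞ fun y => b y m :=
  (EuclideanSpace.proj (𝕜 := ℝ) m).contDiff.comp hb

lemma partialDeriv_mul_coord {φ : E3 → ℝ} (hφ : IsTestFunction φ) {b : E3 → E3}
    (hb : ContDiff ℝ ∞ b) (m j : Fin 3) (x : E3) :
    partialDeriv (fun y => φ y * b y m) j x =
      φ x * fderiv ℝ b x (basisVec j) m + b x m * partialDeriv φ j x := by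
  rw [partialDeriv_mul (hφ.differentiable x) ((contDiff_coord hb m).differentiable (by simp) x),
    partialDeriv_coord (hb.differentiable (by simp) x)]

lemma divergence_smul_eq_sum {φ : E3 → ℝ} (hφ : IsTestFunction φ) {b : E3 → E3}
    (hb : ContDiff ℝ ∞ b) (x : E3) :
    divergence (fun y => φ y • b y) x = ∑ i, partialDeriv (fun y => φ y * b y i) i x := by
  rw [divergence_smul (hφ.differentiable x) (hb.differentiable (by simp) x), divergence,
    Finset.mul_sum, ← Finset.sum_add_distrib]
  refine Finset.sum_congr rfl fun i _ => ?_
  rw [partialDeriv_mul_coord hφ hb]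
  ring

/-- A weakly divergence-free field, tested against scalars. -/
lemma IsWeakDeriv.integral_sum_eq_zero {V : E3 → C3} (hV : IsWeakDeriv divSym V 0) {φ : E3 → ℝ}
    (hφ : IsTestFunction φ) : ∫ x, ∑ j, ((partialDeriv φ j x : ℝ) : ℂ) * V x j = 0 := by
  have h := hV φ hφ
  have e : ∀ x, ∑ j, partialDeriv φ j x • divSym j (V x) =
      (∑ j, ((partialDeriv φ j x : ℝ) : ℂ) * V x j) • complexify (basisVec 0) := fun x => by
    rw [Finset.sum_smul]
    refine Finset.sum_congr rfl fun j _ => ?_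
    rw [divSym_apply, ← Complex.coe_smul, smul_smul]
  simp only [e, Pi.zero_apply, smul_zero, integral_zero] at h
  rw [integral_smul_const, zero_eq_neg] at h
  have h3 := congrArg (fun v : C3 => v 0) h
  simpa [basisVec] using h3

lemma isWeakDeriv_div_zero {V : E3 → C3} (h : ∀ φ, IsTestFunction φ →
    ∫ x, ∑ j, ((partialDeriv φ j x : ℝ) : ℂ) * V x j = 0) : IsWeakDeriv divSym V 0 := by
  intro φ hφ
  have e : ∀ x, ∑ j, partialDeriv φ j x • divSym j (V x) =
      (∑ j, ((partialDeriv φ j x : ℝ) : ℂ) * V x j) • complexify (basisVec 0) := fun x => by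
    rw [Finset.sum_smul]
    refine Finset.sum_congr rfl fun j _ => ?_
    rw [divSym_apply, ← Complex.coe_smul, smul_smul]
  simp only [e, integral_smul_const, h φ hφ, Pi.zero_apply, smul_zero, integral_zero, zero_smul,
    neg_zero]

lemma cross_complexify_eq_sum (a : E3) (v : C3) :
    cross (complexify a) v = ∑ i, a i • curlSym i v := by
  rw [← weakSymbol_curl, weakSymbol]
  exact Finset.sum_congr rfl fun i _ => Complex.coe_smul (a i) _

lemma integrable_coe_mul_coord {ψ : E3 → ℝ} (hψ : IsTestFunction ψ) {V : E3 → C3}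
    (hV : LocallyIntegrable V volume) (j : Fin 3) :
    Integrable fun x => ((ψ x : ℝ) : ℂ) * V x j := by
  have h := ContinuousLinearMap.integrable_comp (EuclideanSpace.proj (𝕜 := ℂ) j)
    (hψ.integrable_smul hV)
  refine h.congr (ae_of_all _ fun x => ?_)
  simp

/-- The identity `curl (b × V) = V · ∇b - b · ∇V` for divergence-free `b` and `V`. -/
lemma isWeakDeriv_curl_cross {b : E3 → E3} (hb : ContDiff ℝ ∞ b)
    (hdivb : ∀ x, divergence b x = 0) {V : E3 → C3} (hV : IsWeakDeriv divSym V 0) {A : L2Field}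
    (hA : IsAdvection b V A) :
    IsWeakDeriv curlSym (fun x => cross (complexify (b x)) (V x))
      (fun x => dotGrad V b x - A x) := by
  intro φ hφ
  have hVl := hA.1
  -- the divergence of `V` is tested with each of the three functions `φ bₘ`
  have hψ (m : Fin 3) : IsTestFunction fun y => φ y * b y m := hφ.mul_smooth (contDiff_coord hb m)
  set s : Fin 3 → E3 → ℂ := fun m x =>
    ∑ j, ((partialDeriv (fun y => φ y * b y m) j x : ℝ) : ℂ) * V x j with hs
  have hs0 (m : Fin 3) : ∫ x, s m x = 0 := hV.integral_sum_eq_zero (hψ m)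
  have hsi (m : Fin 3) : Integrable (s m) :=
    integrable_finsetSum _ fun j _ => integrable_coe_mul_coord ((hψ m).partialDeriv j) hVl j
  have hdt : IsTestFunction fun x => divergence (fun y => φ y • b y) x := by
    have : (fun x => divergence (fun y => φ y • b y) x) = fun x =>
        partialDeriv (fun y => φ y * b y 0) 0 x + partialDeriv (fun y => φ y * b y 1) 1 x +
          partialDeriv (fun y => φ y * b y 2) 2 x := funext fun x => by
      rw [divergence_smul_eq_sum hφ hb, Fin.sum_univ_three]
    rw [this]
    exact (((hψ 0).partialDeriv 0).add ((hψ 1).partialDeriv 1)).add ((hψ 2).partialDeriv 2)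
  -- the pointwise identity behind `curl (b × V) = V · ∇b - b · ∇V`, up to terms of integral zero
  have hpt : ∀ x, φ x • (dotGrad V b x - A x) =
      ((∑ m, s m x • complexify (basisVec m)) - φ x • A x -
        divergence (fun y => φ y • b y) x • V x) -
      ∑ j, partialDeriv φ j x • curlSym j (cross (complexify (b x)) (V x)) := fun x => by
    have e1 : ∑ j, partialDeriv φ j x • curlSym j (cross (complexify (b x)) (V x)) =
        cross (WithLp.toLp 2 fun j => ((partialDeriv φ j x : ℝ) : ℂ))
          (cross (complexify (b x)) (V x)) := by
      rw [← sum_curlSym fun j => ((partialDeriv φ j x : ℝ) : ℂ)]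
      refine Finset.sum_congr rfl fun j _ => ?_
      exact (Complex.coe_smul (partialDeriv φ j x)
        (curlSym j (cross (complexify (b x)) (V x)))).symm
    have e2 : divergence (fun y => φ y • b y) x = ∑ i, partialDeriv φ i x * b x i := by
      rw [divergence_smul (hφ.differentiable x) (hb.differentiable (by simp) x), hdivb]
      simp
    rw [e1, e2]
    simp only [hs, partialDeriv_mul_coord hφ hb]
    refine C3.ext ?_ ?_ ?_ <;>
      simp [dotGrad, Fin.sum_univ_three, basisVec, cross_zero_apply, cross_one_apply,
        cross_two_apply] <;> ring
  have i1 : Integrable fun x => ∑ m, s m x • complexify (basisVec m) :=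
    integrable_finsetSum _ fun m _ => (hsi m).smul_const (complexify (basisVec m))
  have i2 : Integrable fun x => φ x • A x := hφ.integrable_smul A.locallyIntegrable
  have i3 : Integrable fun x => divergence (fun y => φ y • b y) x • V x := hdt.integrable_smul hVl
  have i4 : Integrable fun x =>
      ∑ j, partialDeriv φ j x • curlSym j (cross (complexify (b x)) (V x)) := by
    refine integrable_finsetSum _ fun j _ => ?_
    have h := integrable_finsetSum Finset.univ fun i (_ : i ∈ Finset.univ) =>
      ((hφ.partialDeriv j).mul_smooth (contDiff_coord hb i)).integrable_smul_clm hVl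
        ((curlSym j).comp (curlSym i))
    refine h.congr (ae_of_all _ fun x => ?_)
    simp only [cross_complexify_eq_sum, map_sum, Finset.smul_sum, ContinuousLinearMap.comp_apply,
      mul_smul]
    refine Finset.sum_congr rfl fun i _ => ?_
    congr 1
    exact (((curlSym j).restrictScalars ℝ).map_smul _ _).symm
  have i12 : Integrable fun x => (∑ m, s m x • complexify (basisVec m)) - φ x • A x := i1.sub i2
  have i123 : Integrable fun x => (∑ m, s m x • complexify (basisVec m)) - φ x • A x -
      divergence (fun y => φ y • b y) x • V x := i12.sub i3
  simp only [hpt]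
  rw [integral_sub i123 i4, integral_sub i12 i3, integral_sub i1 i2,
    hA.2 φ hφ, integral_finsetSum _ fun m _ => (hsi m).smul_const (complexify (basisVec m))]
  simp only [integral_smul_const, hs0, zero_smul, Finset.sum_const_zero]
  abel

/-- For a field with partial derivatives `Dᵢ ∈ L²`, the distribution `b · ∇η` is `∑ᵢ bᵢ Dᵢ`. -/
lemma isAdvection_of_partial {b : E3 → E3} (hb : ContDiff ℝ ∞ b) {η : L2Field}
    {D : Fin 3 → L2Field} (hD : ∀ i, IsWeakDeriv (partialSym i) (fun x => η x) (fun x => D i x))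
    {A : L2Field} (hA : ∀ᵐ x, A x = ∑ i, b x i • D i x) : IsAdvection b (fun x => η x) A := by
  refine ⟨η.locallyIntegrable, fun φ hφ => ?_⟩
  have hψ (m : Fin 3) : IsTestFunction fun y => φ y * b y m := hφ.mul_smooth (contDiff_coord hb m)
  have e1 : ∫ x, φ x • A x = ∑ i, ∫ x, (φ x * b x i) • D i x := by
    rw [← integral_finsetSum _ fun i _ => (hψ i).integrable_smul (D i).locallyIntegrable]
    refine integral_congr_ae ?_
    filter_upwards [hA] with x hx
    rw [hx, Finset.smul_sum]
    simp only [mul_smul]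
  have e2 (i : Fin 3) : ∀ x, ∑ j, partialDeriv (fun y => φ y * b y i) j x • partialSym i j (η x) =
      partialDeriv (fun y => φ y * b y i) i x • η x := fun x => by
    rw [Finset.sum_eq_single i]
    · simp [partialSym]
    · intro j _ hj
      simp [partialSym, hj]
    · simp
  rw [e1]
  simp only [hD _ _ (hψ _), e2, divergence_smul_eq_sum hφ hb, Finset.sum_smul]
  rw [Finset.sum_neg_distrib,
    integral_finsetSum _ fun i _ => ((hψ i).partialDeriv i).integrable_smul η.locallyIntegrable]

/-- The product rule for `∇ (b · η)`. -/
lemma isWeakDeriv_grad_dot {b : E3 → E3} (hb : ContDiff ℝ ∞ b) {η : L2Field}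
    {D : Fin 3 → L2Field} (hD : ∀ i, IsWeakDeriv (partialSym i) (fun x => η x) (fun x => D i x)) :
    IsWeakDeriv gradSym
      (fun x => (∑ i, ((b x i : ℝ) : ℂ) * η x i) • complexify (basisVec 0))
      (fun x => ∑ j, (∑ i, (((fderiv ℝ b x (basisVec j) i : ℝ) : ℂ) * η x i +
        ((b x i : ℝ) : ℂ) * D j x i)) • complexify (basisVec j)) := by
  intro φ hφ
  have hψ (m : Fin 3) : IsTestFunction fun y => φ y * b y m := hφ.mul_smooth (contDiff_coord hb m)
  have e2 (i j : Fin 3) : ∀ x,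
      ∑ k, partialDeriv (fun y => φ y * b y i) k x • partialSym j k (η x) =
      partialDeriv (fun y => φ y * b y i) j x • η x := fun x => by
    rw [Finset.sum_eq_single j]
    · simp [partialSym]
    · intro k _ hk
      simp [partialSym, hk]
    · simp
  set s : Fin 3 → Fin 3 → E3 → ℂ := fun i j x =>
    ((φ x * b x i : ℝ) : ℂ) * D j x i +
      ((partialDeriv (fun y => φ y * b y i) j x : ℝ) : ℂ) * η x i with hs
  have hsi (i j : Fin 3) : Integrable (s i j) :=
    (integrable_coe_mul_coord (hψ i) (D j).locallyIntegrable i).add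
      (integrable_coe_mul_coord ((hψ i).partialDeriv j) η.locallyIntegrable i)
  have hs0 (i j : Fin 3) : ∫ x, s i j x = 0 := by
    have h := hD j _ (hψ i)
    simp only [e2] at h
    have i1 := (hψ i).integrable_smul (D j).locallyIntegrable
    have i2 := ((hψ i).partialDeriv j).integrable_smul η.locallyIntegrable
    have h2 := congrArg (EuclideanSpace.proj (𝕜 := ℂ) i) (eq_neg_iff_add_eq_zero.1 h)
    rw [map_add, ← ContinuousLinearMap.integral_comp_comm _ i1,
      ← ContinuousLinearMap.integral_comp_comm _ i2, map_zero] at h2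
    rw [hs, integral_add (integrable_coe_mul_coord (hψ i) (D j).locallyIntegrable i)
      (integrable_coe_mul_coord ((hψ i).partialDeriv j) η.locallyIntegrable i), ← h2]
    rfl
  set q : E3 → C3 := fun x => (∑ i, ((b x i : ℝ) : ℂ) * η x i) • complexify (basisVec 0) with hq
  have i2 : Integrable fun x => ∑ j, partialDeriv φ j x • gradSym j (q x) := by
    refine integrable_finsetSum _ fun j _ => ?_
    have h := integrable_finsetSum Finset.univ fun i (_ : i ∈ Finset.univ) =>
      (integrable_coe_mul_coord ((hφ.partialDeriv j).mul_smooth (contDiff_coord hb i))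
        η.locallyIntegrable i).smul_const (complexify (basisVec j))
    refine h.congr (ae_of_all _ fun x => ?_)
    simp only [gradSym_apply, hq, ← Finset.sum_smul]
    rw [← Complex.coe_smul, smul_smul]
    congr 1
    simp only [PiLp.smul_apply, complexify_apply, basisVec, Fin.sum_univ_three, smul_eq_mul]
    simp
    ring
  have i1 (j i : Fin 3) : Integrable fun x => s i j x • complexify (basisVec j) :=
    (hsi i j).smul_const _
  have hpt : ∀ x, φ x • (∑ j, (∑ i, (((fderiv ℝ b x (basisVec j) i : ℝ) : ℂ) * η x i +
        ((b x i : ℝ) : ℂ) * D j x i)) • complexify (basisVec j)) =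
      (∑ j, ∑ i, s i j x • complexify (basisVec j)) -
        ∑ j, partialDeriv φ j x • gradSym j (q x) := fun x => by
    simp only [hs, hq, partialDeriv_mul_coord hφ hb, gradSym_apply]
    refine C3.ext ?_ ?_ ?_ <;>
      simp [Fin.sum_univ_three, basisVec] <;> ring
  simp only [hpt]
  rw [integral_sub (integrable_finsetSum _ fun j _ => integrable_finsetSum _ fun i _ => i1 j i) i2,
    integral_finsetSum _ fun j _ => integrable_finsetSum _ fun i _ => i1 j i]
  simp only [integral_finsetSum _ fun i _ => i1 _ i, integral_smul_const, hs0, zero_smul,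
    Finset.sum_const_zero, zero_sub]

/-! ### The Leray projector in Fourier variables -/

lemma exists_fourier_eq {g : E3 → C3} (hg : MemLp g 2 volume) :
    ∃ V : L2Field, ∀ᵐ k, (𝓕 V : L2Field) k = g k := by
  refine ⟨𝓕⁻ (hg.toLp g), ?_⟩
  rw [FourierTransform.fourier_fourierInv_eq]
  exact hg.coeFn_toLp

lemma L2Field.ext_fourier {f g : L2Field}
    (h : ∀ᵐ k, (𝓕 f : L2Field) k = (𝓕 g : L2Field) k) : f = g := by
  have h1 : (𝓕 f : L2Field) = 𝓕 g := Lp.ext h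
  have e (f : L2Field) : (𝓕⁻ (𝓕 f : L2Field) : L2Field) = f :=
    FourierTransform.fourierInv_fourier_eq f
  rw [← e f, h1, e]

lemma coe_fourier_zero : ∀ᵐ k : E3, (𝓕 (0 : L2Field) : L2Field) k = 0 := by
  rw [FourierTransform.fourier_zero]
  exact Lp.coeFn_zero _ _ _

/-- A field of `L²` is orthogonal to the gradients of test functions iff its divergence vanishes
weakly. -/
lemma mem_solenoidal_iff (V : L2Field) :
    V ∈ solenoidal ↔ IsWeakDeriv divSym (fun x => V x) 0 := by
  have hinner : ∀ G : L2Field, ∀ φ : E3 → ℝ,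
      (∀ᵐ x : E3, ∀ i, G x i = ((fderiv ℝ φ x (basisVec i) : ℝ) : ℂ)) →
      inner ℂ G V = ∫ x, ∑ j, ((partialDeriv φ j x : ℝ) : ℂ) * V x j := by
    intro G φ hG
    rw [L2.inner_def]
    refine integral_congr_ae ?_
    filter_upwards [hG] with x hx
    rw [PiLp.inner_apply]
    refine Finset.sum_congr rfl fun j _ => ?_
    rw [hx j, RCLike.inner_apply, Complex.conj_ofReal, mul_comm]
    rfl
  constructor
  · intro h
    refine isWeakDeriv_div_zero fun φ hφ => ?_
    set g : E3 → C3 := fun x => ∑ i, partialDeriv φ i x • complexify (basisVec i) with hg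
    have hgL : MemLp g 2 volume := by
      refine memLp_finsetSum _ fun i _ => ?_
      refine Continuous.memLp_of_hasCompactSupport ?_ ?_
      · exact (hφ.partialDeriv i).continuous.smul continuous_const
      · exact (hφ.partialDeriv i).2.smul_right
    have hG : ∀ᵐ x : E3, ∀ i, (hgL.toLp g) x i = ((fderiv ℝ φ x (basisVec i) : ℝ) : ℂ) := by
      filter_upwards [hgL.coeFn_toLp] with x hx i
      rw [hx, hg]
      fin_cases i <;> simp [Fin.sum_univ_three, basisVec, partialDeriv]
    rw [← hinner _ φ hG]
    exact (Submodule.mem_orthogonal _ _).1 h _ (Submodule.subset_span ⟨φ, hφ, hG⟩)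
  · intro h
    rw [Submodule.mem_orthogonal]
    intro G hG
    induction hG using Submodule.span_induction with
    | mem G hG =>
      obtain ⟨φ, hφ, hG⟩ := hG
      rw [hinner G φ hG]
      exact h.integral_sum_eq_zero hφ
    | zero => exact inner_zero_left _
    | add a b _ _ ha hb => rw [inner_add_left, ha, hb, add_zero]
    | smul c a _ ha => rw [inner_smul_left, ha, mul_zero]

/-- Divergence-free fields are those whose Fourier transform is pointwise orthogonal to `k`. -/
lemma mem_solenoidal_iff_fourier (V : L2Field) :
    V ∈ solenoidal ↔ ∀ᵐ k : E3, ∑ j, ((k j : ℝ) : ℂ) * (𝓕 V : L2Field) k j = 0 := by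
  have h0 : (fun x => (0 : L2Field) x) =ᵐ[volume] (0 : E3 → C3) := Lp.coeFn_zero _ _ _
  rw [mem_solenoidal_iff]
  constructor
  · intro h
    have h1 : IsWeakDeriv divSym (fun x => V x) (fun x => (0 : L2Field) x) :=
      h.congr_ae (ae_of_all _ fun _ => rfl) h0.symm
    filter_upwards [h1.fourier, coe_fourier_zero] with k hk hk0
    rw [hk0, weakSymbol_div] at hk
    have h3 := congrArg (fun v : C3 => v 0) hk
    simpa [basisVec, Real.pi_ne_zero] using h3
  · intro h
    have h1 : IsWeakDeriv divSym (fun x => V x) (fun x => (0 : L2Field) x) := by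
      refine isWeakDeriv_of_fourier ?_
      filter_upwards [h, coe_fourier_zero] with k hk hk0
      rw [hk0, weakSymbol_div, hk, zero_smul, smul_zero]
    exact h1.congr_ae (ae_of_all _ fun _ => rfl) h0

lemma dot_cross_complexify (k : E3) (v : C3) :
    ∑ j, ((k j : ℝ) : ℂ) * cross (complexify k) v j = 0 := by
  simp [Fin.sum_univ_three, cross_zero_apply, cross_one_apply, cross_two_apply]
  ring

/-- The map `d ↦ k × (k × d)` is negative semidefinite. -/
lemma inner_cross_cross (k : E3) (d : C3) :
    inner ℂ (cross (complexify k) (cross (complexify k) d)) d =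
      -((‖cross (complexify k) d‖ ^ 2 : ℝ) : ℂ) := by
  have h : ((‖cross (complexify k) d‖ ^ 2 : ℝ) : ℂ) =
      inner ℂ (cross (complexify k) d) (cross (complexify k) d) := by
    rw [inner_self_eq_norm_sq_to_K]
    push_cast
    rfl
  rw [h, PiLp.inner_apply, PiLp.inner_apply]
  simp only [Fin.sum_univ_three, cross_zero_apply, cross_one_apply, cross_two_apply,
    RCLike.inner_apply, map_sub, map_mul, complexify_apply, Complex.conj_ofReal]
  ring

/-- The orthogonal complement of the divergence-free fields consists of curl-free fields. It is
enough to test against the divergence-free field with Fourier transform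
`(1 + |k|²)⁻¹ k × (k × D̂)`. -/
lemma cross_fourier_eq_zero_of_mem_orthogonal {D : L2Field} (hD : D ∈ solenoidalᗮ) :
    ∀ᵐ k : E3, cross (complexify k) ((𝓕 D : L2Field) k) = 0 := by
  set w : E3 → ℝ := fun k => (1 + ‖k‖ ^ 2)⁻¹ with hw
  set g : E3 → C3 := fun k =>
    w k • cross (complexify k) (cross (complexify k) ((𝓕 D : L2Field) k)) with hg
  have hwc : Continuous w := by
    refine Continuous.inv₀ (by fun_prop) fun k => by positivity
  have hgm : AEStronglyMeasurable g volume :=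
    hwc.aestronglyMeasurable.smul (aestronglyMeasurable_cross
      complexify.continuous.aestronglyMeasurable (aestronglyMeasurable_cross
        complexify.continuous.aestronglyMeasurable (Lp.aestronglyMeasurable _)))
  have hgL : MemLp g 2 volume := by
    refine MemLp.of_le_mul (c := 36) (Lp.memLp (𝓕 D : L2Field)) hgm (ae_of_all _ fun k => ?_)
    have h1 := norm_cross_le (complexify k) (cross (complexify k) ((𝓕 D : L2Field) k))
    have h2 := norm_cross_le (complexify k) ((𝓕 D : L2Field) k)
    rw [complexify.norm_map] at h1 h2
    rw [hg, norm_smul, Real.norm_of_nonneg (by positivity)]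
    have hp : (0 : ℝ) < 1 + ‖k‖ ^ 2 := by positivity
    rw [hw, inv_mul_le_iff₀ hp]
    calc _ ≤ 6 * (‖k‖ * (6 * (‖k‖ * ‖(𝓕 D : L2Field) k‖))) := h1.trans (by gcongr)
      _ ≤ _ := by nlinarith [norm_nonneg ((𝓕 D : L2Field) k)]
  obtain ⟨V, hV⟩ := exists_fourier_eq hgL
  have hVs : V ∈ solenoidal := by
    rw [mem_solenoidal_iff_fourier]
    filter_upwards [hV] with k hk
    rw [hk, hg]
    have := dot_cross_complexify k (cross (complexify k) ((𝓕 D : L2Field) k))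
    have h2 : ∑ j, ((k j : ℝ) : ℂ) * (w k • cross (complexify k)
        (cross (complexify k) ((𝓕 D : L2Field) k))) j = (w k : ℂ) * ∑ j, ((k j : ℝ) : ℂ) *
          cross (complexify k) (cross (complexify k) ((𝓕 D : L2Field) k)) j := by
      rw [Finset.mul_sum]
      refine Finset.sum_congr rfl fun j _ => ?_
      rw [PiLp.smul_apply, Complex.real_smul]
      ring
    rw [h2, this, mul_zero]
  have h0 : inner ℂ V D = 0 := (Submodule.mem_orthogonal _ _).1 hD V hVs
  have hpt : ∀ᵐ k : E3, inner ℂ ((𝓕 V : L2Field) k) ((𝓕 D : L2Field) k) =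
      ((-(w k * ‖cross (complexify k) ((𝓕 D : L2Field) k)‖ ^ 2) : ℝ) : ℂ) := by
    filter_upwards [hV] with k hk
    rw [hk]
    simp only [hg]
    rw [← Complex.coe_smul, inner_smul_left, inner_cross_cross, Complex.conj_ofReal]
    push_cast
    ring
  have hint : Integrable fun k => w k * ‖cross (complexify k) ((𝓕 D : L2Field) k)‖ ^ 2 := by
    refine ((L2.integrable_inner (𝕜 := ℂ) (𝓕 V : L2Field) (𝓕 D)).re.neg).congr ?_
    filter_upwards [hpt] with k hk
    rw [Pi.neg_apply, hk]
    exact neg_neg _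
  rw [← Lp.inner_fourier_eq, L2.inner_def, integral_congr_ae hpt, integral_complex_ofReal,
    Complex.ofReal_eq_zero, integral_neg, neg_eq_zero,
    integral_eq_zero_iff_of_nonneg (fun k => by positivity) hint] at h0
  filter_upwards [h0] with k hk
  have hp : w k ≠ 0 := by positivity
  simpa [hp] using hk

/-- The Leray projector removes only a gradient, which does not contribute to the curl. -/
lemma cross_fourier_lerayProj (G : L2Field) :
    ∀ᵐ k : E3, cross (complexify k) ((𝓕 (lerayProj G) : L2Field) k) =
      cross (complexify k) ((𝓕 G : L2Field) k) := by
  have h := cross_fourier_eq_zero_of_mem_orthogonal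
    (Submodule.sub_starProjection_mem_orthogonal (K := solenoidal) G)
  have e : (𝓕 (G - solenoidal.starProjection G) : L2Field) = 𝓕 G - 𝓕 (lerayProj G) :=
    map_sub (Lp.fourierTransformₗᵢ E3 C3) _ _
  rw [e] at h
  filter_upwards [h, Lp.coeFn_sub (𝓕 G : L2Field) (𝓕 (lerayProj G))] with k hk hk2
  rw [hk2, Pi.sub_apply, sub_eq_add_neg, cross_add_right, ← neg_one_smul ℂ, cross_smul_right,
    neg_one_smul, ← sub_eq_add_neg, sub_eq_zero] at hk
  exact hk.symm

lemma lerayProj_mem (G : L2Field) : lerayProj G ∈ solenoidal :=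
  Submodule.starProjection_apply_mem _ _

/-- The Leray projector annihilates gradients of potentials in `L²`. -/
lemma lerayProj_grad {q g : L2Field} (h : IsWeakDeriv gradSym (fun x => q x) (fun x => g x)) :
    lerayProj g = 0 := by
  rw [lerayProj, Submodule.starProjection_apply_eq_zero_iff, Submodule.mem_orthogonal]
  intro V hV
  rw [mem_solenoidal_iff_fourier] at hV
  rw [← Lp.inner_fourier_eq, L2.inner_def]
  refine integral_eq_zero_of_ae ?_
  filter_upwards [h.fourier, hV] with k hk hVk
  rw [hk, weakSymbol_grad, smul_smul, inner_smul_right, PiLp.inner_apply]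
  have hc := congrArg (starRingEnd ℂ) hVk
  rw [map_sum, map_zero] at hc
  have : ∑ i, inner ℂ ((𝓕 V : L2Field) k i) (complexify k i) = 0 := by
    rw [← hc]
    refine Finset.sum_congr rfl fun j _ => ?_
    rw [RCLike.inner_apply, map_mul, Complex.conj_ofReal, complexify_apply]
  rw [this, mul_zero]
  rfl

/-! ### The curl structure of the vorticity equation -/

lemma L2Field.coe_real_smul (r : ℝ) (f : L2Field) : ((r : ℂ)) • f = r • f := by
  refine Lp.ext ?_
  filter_upwards [Lp.coeFn_smul (r : ℂ) f, Lp.coeFn_smul r f] with x h1 h2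
  rw [h1, h2, Pi.smul_apply, Pi.smul_apply, Complex.coe_smul]

lemma fourier_smul_add_smul (a b : ℂ) (f g : L2Field) :
    ∀ᵐ k, (𝓕 (a • f + b • g : L2Field) : L2Field) k =
      a • (𝓕 f : L2Field) k + b • (𝓕 g : L2Field) k := by
  have e : (𝓕 (a • f + b • g : L2Field) : L2Field) = a • 𝓕 f + b • 𝓕 g := by
    change Lp.fourierTransformₗᵢ E3 C3 (a • f + b • g) = _
    rw [map_add, map_smul, map_smul]
    rfl
  rw [e]
  filter_upwards [Lp.coeFn_add (a • (𝓕 f : L2Field)) (b • (𝓕 g : L2Field)),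
    Lp.coeFn_smul a (𝓕 f : L2Field), Lp.coeFn_smul b (𝓕 g : L2Field)] with k h1 h2 h3
  rw [h1, Pi.add_apply, h2, h3]
  rfl

lemma IsWeakDeriv.smul_add_smul {ℓ : Fin 3 → C3 →L[ℂ] C3} {f₁ g₁ f₂ g₂ : L2Field} (a b : ℂ)
    (h₁ : IsWeakDeriv ℓ (fun x => f₁ x) (fun x => g₁ x))
    (h₂ : IsWeakDeriv ℓ (fun x => f₂ x) (fun x => g₂ x)) :
    IsWeakDeriv ℓ (fun x => (a • f₁ + b • f₂ : L2Field) x)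
      (fun x => (a • g₁ + b • g₂ : L2Field) x) := by
  refine isWeakDeriv_of_fourier ?_
  filter_upwards [fourier_smul_add_smul a b f₁ f₂, fourier_smul_add_smul a b g₁ g₂, h₁.fourier,
    h₂.fourier] with k e1 e2 e3 e4
  rw [e1, e2, e3, e4]
  simp only [weakSymbol, map_add, map_smul, smul_add, Finset.sum_add_distrib, Finset.smul_sum,
    smul_smul]
  congr 1 <;> refine Finset.sum_congr rfl fun j _ => ?_ <;> congr 1 <;> ring

lemma IsWeakDeriv.sub {ℓ : Fin 3 → C3 →L[ℂ] C3} {f₁ g₁ f₂ g₂ : E3 → C3}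
    (h₁ : IsWeakDeriv ℓ f₁ g₁) (h₂ : IsWeakDeriv ℓ f₂ g₂) (lf₁ : LocallyIntegrable f₁ volume)
    (lg₁ : LocallyIntegrable g₁ volume) (lf₂ : LocallyIntegrable f₂ volume)
    (lg₂ : LocallyIntegrable g₂ volume) :
    IsWeakDeriv ℓ (fun x => f₁ x - f₂ x) (fun x => g₁ x - g₂ x) := by
  intro φ hφ
  have hi {f : E3 → C3} (hf : LocallyIntegrable f volume) :
      Integrable fun x => ∑ j, partialDeriv φ j x • ℓ j (f x) :=
    integrable_finsetSum _ fun j _ => (hφ.partialDeriv j).integrable_smul_clm hf (ℓ j)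
  simp only [smul_sub, map_sub, Finset.sum_sub_distrib]
  rw [integral_sub (hφ.integrable_smul lg₁) (hφ.integrable_smul lg₂), h₁ φ hφ, h₂ φ hφ,
    integral_sub (hi lf₁) (hi lf₂)]
  abel

lemma IsAdvection.congr_ae {b : E3 → E3} {V V' : E3 → C3} {W : L2Field} (h : IsAdvection b V W)
    (hV : V =ᵐ[volume] V') : IsAdvection b V' W := by
  refine ⟨h.1.congr hV, fun φ hφ => ?_⟩
  rw [h.2 φ hφ]
  congr 1
  refine integral_congr_ae ?_
  filter_upwards [hV] with x hx
  rw [hx]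

lemma norm_le_of_isFracLaplacian {α : ℝ} (hα : 1 / 2 < α) {ζ F : L2Field}
    (hF : IsFracLaplacian α ζ F) :
    ∀ᵐ k : E3, ‖k‖ * ‖(𝓕 ζ : L2Field) k‖ ≤ ‖(𝓕 ζ : L2Field) k‖ + ‖(𝓕 F : L2Field) k‖ := by
  filter_upwards [hF] with k hk
  rw [hk, norm_smul, Real.norm_of_nonneg (by positivity)]
  rcases le_or_gt ‖k‖ 1 with h | h
  · have : 0 ≤ (2 * Real.pi * ‖k‖) ^ (2 * α) * ‖(𝓕 ζ : L2Field) k‖ := by positivity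
    nlinarith [norm_nonneg ((𝓕 ζ : L2Field) k)]
  · have h1 : ‖k‖ ≤ 2 * Real.pi * ‖k‖ := by nlinarith [Real.pi_gt_three]
    have h2 : 2 * Real.pi * ‖k‖ ≤ (2 * Real.pi * ‖k‖) ^ (2 * α) :=
      Real.self_le_rpow_of_one_le (by linarith) (by linarith)
    have h3 : ‖k‖ * ‖(𝓕 ζ : L2Field) k‖ ≤
        (2 * Real.pi * ‖k‖) ^ (2 * α) * ‖(𝓕 ζ : L2Field) k‖ := by
      gcongr
      exact h1.trans h2
    linarith [norm_nonneg ((𝓕 ζ : L2Field) k)]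

/-- The domain of the fractional Laplacian of order `2α > 1` is contained in `H¹`. -/
lemma memLp_norm_mul_fourier {α : ℝ} (hα : 1 / 2 < α) {ζ F : L2Field}
    (hF : IsFracLaplacian α ζ F) : MemLp (fun k => ‖k‖ * ‖(𝓕 ζ : L2Field) k‖) 2 volume := by
  refine MemLp.of_le ((Lp.memLp (𝓕 ζ : L2Field)).norm.add (Lp.memLp (𝓕 F : L2Field)).norm) ?_ ?_
  · exact continuous_norm.aestronglyMeasurable.mul (Lp.aestronglyMeasurable _).norm
  · filter_upwards [norm_le_of_isFracLaplacian hα hF] with k hk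
    rw [Real.norm_of_nonneg (by positivity)]
    exact hk.trans (le_abs_self _)

/-- The field `(-Δ)^α BS ζ` lies in `L²`, although `BS ζ` is not yet known to do so: at low
frequencies the symbol `|k|^{2α}` compensates the factor `|k|⁻¹` of the Biot–Savart multiplier
because `2α ≥ 1`, and at high frequencies the multiplier only helps. -/
lemma exists_fracLaplacian_velocity {α : ℝ} (hα : 1 / 2 < α) {ζ F : L2Field}
    (hF : IsFracLaplacian α ζ F) : ∃ Fη : L2Field, ∀ᵐ k : E3, (𝓕 Fη : L2Field) k =
      ((2 * Real.pi * ‖k‖) ^ (2 * α) : ℝ) • velocityMultiplier k ((𝓕 ζ : L2Field) k) := by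
  refine exists_fourier_eq ?_
  have hm : AEStronglyMeasurable (fun k : E3 => ((2 * Real.pi * ‖k‖) ^ (2 * α) : ℝ) •
      velocityMultiplier k ((𝓕 ζ : L2Field) k)) volume := by
    have h1 : Measurable fun k : E3 => ((2 * Real.pi * ‖k‖) ^ (2 * α) : ℝ) := by fun_prop
    exact h1.aestronglyMeasurable.smul (aestronglyMeasurable_velocityMultiplier ζ)
  refine MemLp.of_le (((Lp.memLp (𝓕 ζ : L2Field)).norm.const_mul
    ((2 * Real.pi) ^ (2 * α))).add (Lp.memLp (𝓕 F : L2Field)).norm) hm ?_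
  filter_upwards [hF, ae_ne_zero] with k hk hk0
  refine le_trans ?_ (le_abs_self _)
  have hk0' : 0 < ‖k‖ := norm_pos_iff.2 hk0
  have h0 := norm_velocityMultiplier_le k ((𝓕 ζ : L2Field) k)
  simp only [Pi.add_apply]
  rw [hk, norm_smul, norm_smul, Real.norm_of_nonneg (by positivity)]
  have hz := norm_nonneg ((𝓕 ζ : L2Field) k)
  rcases le_or_gt ‖k‖ 1 with h | h
  · have h1 : (2 * Real.pi * ‖k‖) ^ (2 * α) * ‖k‖⁻¹ ≤ (2 * Real.pi) ^ (2 * α) := by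
      rw [Real.mul_rpow (by positivity) hk0'.le, mul_assoc, ← Real.rpow_neg_one ‖k‖,
        ← Real.rpow_add hk0']
      exact mul_le_of_le_one_right (by positivity)
        (Real.rpow_le_one hk0'.le h (by linarith))
    calc _ ≤ (2 * Real.pi * ‖k‖) ^ (2 * α) * (‖k‖⁻¹ * ‖(𝓕 ζ : L2Field) k‖) := by gcongr
      _ = ((2 * Real.pi * ‖k‖) ^ (2 * α) * ‖k‖⁻¹) * ‖(𝓕 ζ : L2Field) k‖ := by ring
      _ ≤ (2 * Real.pi) ^ (2 * α) * ‖(𝓕 ζ : L2Field) k‖ := by gcongr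
      _ ≤ _ := le_add_of_nonneg_right (by positivity)
  · have h1 : ‖k‖⁻¹ ≤ 1 := inv_le_one_of_one_le₀ h.le
    calc _ ≤ (2 * Real.pi * ‖k‖) ^ (2 * α) * (‖k‖⁻¹ * ‖(𝓕 ζ : L2Field) k‖) := by gcongr
      _ ≤ (2 * Real.pi * ‖k‖) ^ (2 * α) * (1 * ‖(𝓕 ζ : L2Field) k‖) := by gcongr
      _ = (2 * Real.pi * ‖k‖) ^ (2 * α) * ‖(𝓕 ζ : L2Field) k‖ := by ring
      _ ≤ _ := le_add_of_nonneg_left (by positivity)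

lemma dotGrad_eq_sum (V : E3 → C3) (b : E3 → E3) (x : E3) :
    dotGrad V b x = ∑ i, V x i • complexify (fderiv ℝ b x (basisVec i)) := by
  refine C3.ext ?_ ?_ ?_ <;> simp [dotGrad, Fin.sum_univ_three]

lemma norm_dotGrad_le {b : E3 → E3} {C : ℝ} (hC : ∀ x i, ‖fderiv ℝ b x (basisVec i)‖ ≤ C)
    (V : E3 → C3) (x : E3) : ‖dotGrad V b x‖ ≤ 3 * C * ‖V x‖ := by
  rw [dotGrad_eq_sum]
  have h : ∀ i ∈ (Finset.univ : Finset (Fin 3)),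
      ‖V x i • complexify (fderiv ℝ b x (basisVec i))‖ ≤ C * ‖V x‖ := fun i _ => by
    rw [norm_smul, complexify.norm_map, mul_comm]
    have := hC x i
    have h2 := norm_coord_le (V x) i
    have h3 : 0 ≤ C := (norm_nonneg _).trans this
    gcongr
  refine (norm_sum_le_of_le _ h).trans (le_of_eq ?_)
  simp
  ring

lemma aestronglyMeasurable_dotGrad {b : E3 → E3} (hb : ContDiff ℝ ∞ b) {V : E3 → C3}
    (hV : AEStronglyMeasurable V volume) : AEStronglyMeasurable (dotGrad V b) volume := by
  have e : dotGrad V b = fun x => ∑ i, V x i • complexify (fderiv ℝ b x (basisVec i)) :=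
    funext (dotGrad_eq_sum V b)
  rw [e]
  refine Finset.aestronglyMeasurable_fun_sum _ fun i _ => ?_
  have h1 : AEStronglyMeasurable (fun x => V x i) volume :=
    (EuclideanSpace.proj (𝕜 := ℂ) i).continuous.comp_aestronglyMeasurable hV
  have h2 : Continuous fun x => complexify (fderiv ℝ b x (basisVec i)) :=
    complexify.continuous.comp ((hb.continuous_fderiv (by simp)).clm_apply continuous_const)
  exact h1.smul h2.aestronglyMeasurable

lemma memLp_dotGrad {b : E3 → E3} (hb : ContDiff ℝ ∞ b) {C : ℝ}
    (hC : ∀ x i, ‖fderiv ℝ b x (basisVec i)‖ ≤ C) (V : L2Field) :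
    MemLp (dotGrad (fun x => V x) b) 2 volume :=
  MemLp.of_le_mul (Lp.memLp V) (aestronglyMeasurable_dotGrad hb (Lp.aestronglyMeasurable V))
    (ae_of_all _ fun x => norm_dotGrad_le hC _ x)

section Background

variable {Ωb : E3 → E3}

lemma memLp_cross_biotSavart (h1 : ContDiff ℝ ∞ Ωb) (h2 : HasCompactSupport Ωb) (ζ : L2Field) :
    MemLp (fun x => cross (complexify (biotSavart Ωb x)) (ζ x)) 2 volume := by
  obtain ⟨C, hC⟩ := norm_biotSavart_le h1 h2
  refine MemLp.of_le_mul (c := 6 * C) (Lp.memLp ζ) ?_ (ae_of_all _ fun x => ?_)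
  · exact aestronglyMeasurable_cross (complexify.continuous.comp
      (contDiff_biotSavart h1 h2).continuous).aestronglyMeasurable (Lp.aestronglyMeasurable ζ)
  · refine (norm_cross_le _ _).trans ?_
    rw [complexify.norm_map, mul_assoc]
    have := hC x
    gcongr

lemma memLp_cross_vorticity (h1 : ContDiff ℝ ∞ Ωb) (h2 : HasCompactSupport Ωb) {u : E3 → C3}
    (hu : Continuous u) : MemLp (fun x => cross (complexify (Ωb x)) (u x)) 2 volume := by
  refine Continuous.memLp_of_hasCompactSupport ?_ ?_
  · exact continuous_cross.comp ((complexify.continuous.comp h1.continuous).prodMk hu)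
  · refine h2.mono fun x hx => ?_
    contrapose! hx
    simp only [Function.mem_support, not_not] at hx ⊢
    rw [hx, map_zero]
    exact C3.ext (by simp [cross_zero_apply]) (by simp [cross_one_apply])
      (by simp [cross_two_apply])

/-- The linearised Euler operator in curl form: `𝓛ζ = curl (Ub × ζ + η × Ωb)` with `η = BS ζ`. -/
lemma exists_curl_eq_euler (h1 : ContDiff ℝ ∞ Ωb) (h2 : HasCompactSupport Ωb)
    (hdiv : ∀ x, divergence Ωb x = 0) {ζ N : L2Field}
    (hk : MemLp (fun k => ‖k‖ * ‖(𝓕 ζ : L2Field) k‖) 2 volume) (hN : EulerOp Ωb ζ N) :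
    ∃ G : L2Field, (∀ᵐ x, G x = cross (complexify (biotSavart Ωb x)) (ζ x) -
        cross (complexify (Ωb x)) (velocity ζ x)) ∧
      IsWeakDeriv curlSym (fun x => G x) (fun x => N x) := by
  obtain ⟨⟨hsol, -⟩, A, B, hA, hB, hNeq⟩ := hN
  have hBS : (biotSavart fun x => ζ x) =ᵐ[volume] velocity ζ := biotSavart_ae_eq_velocity hk
  have hu := continuous_velocity hk
  have m1 := memLp_cross_biotSavart h1 h2 ζ
  have m2 := memLp_cross_vorticity h1 h2 hu
  refine ⟨(m1.sub m2).toLp _, (m1.sub m2).coeFn_toLp, ?_⟩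
  have c1 := isWeakDeriv_curl_cross (contDiff_biotSavart h1 h2) (divergence_biotSavart h1 h2)
    ((mem_solenoidal_iff ζ).1 hsol) hA
  have c2 := isWeakDeriv_curl_cross h1 hdiv (isWeakDeriv_div_velocity hk) (hB.congr_ae hBS)
  have l2 : LocallyIntegrable (fun x => dotGrad (velocity ζ) Ωb x - B x) volume := by
    refine LocallyIntegrable.sub ?_ B.locallyIntegrable
    refine Continuous.locallyIntegrable ?_
    have e : dotGrad (velocity ζ) Ωb =
        fun x => ∑ i, velocity ζ x i • complexify (fderiv ℝ Ωb x (basisVec i)) :=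
      funext (dotGrad_eq_sum _ _)
    rw [e]
    refine continuous_finsetSum _ fun i _ => ?_
    exact ((EuclideanSpace.proj (𝕜 := ℂ) i).continuous.comp hu).smul (complexify.continuous.comp
      ((h1.continuous_fderiv (by simp)).clm_apply continuous_const))
  have hae : (fun x => (dotGrad (fun y => ζ y) (biotSavart Ωb) x - A x) -
      (dotGrad (velocity ζ) Ωb x - B x)) =ᵐ[volume] fun x => N x := by
    filter_upwards [hNeq, hBS] with x hx hx2
    have e : dotGrad (biotSavart fun y => ζ y) Ωb x = dotGrad (velocity ζ) Ωb x := by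
      rw [dotGrad_eq_sum, dotGrad_eq_sum, hx2]
    rw [e] at hx
    rw [← neg_neg (N x), hx]
    abel
  have l1 : LocallyIntegrable (fun x => dotGrad (fun y => ζ y) (biotSavart Ωb) x - A x)
      volume := by
    refine (N.locallyIntegrable.add l2).congr ?_
    filter_upwards [hae] with x hx
    rw [Pi.add_apply, ← hx]
    abel
  exact (c1.sub c2 (m1.locallyIntegrable (by norm_num)) l1
    (m2.locallyIntegrable (by norm_num)) l2).congr_ae (m1.sub m2).coeFn_toLp.symm hae

end Background

/-! ### From the vorticity eigenvalue equation to the velocity -/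

/-- A criterion for membership in the Bessel potential space in terms of the `L²` Fourier
transform. -/
lemma memHs_of_fourier {s : ℝ} {U V : L2Field}
    (h : ∀ᵐ k : E3, (𝓕 V : L2Field) k = ((1 + ‖k‖ ^ 2) ^ (s / 2) : ℝ) • (𝓕 U : L2Field) k) :
    MemHs s U := by
  rw [MemHs, TemperedDistribution.memSobolev_iff_exists_smulLeftCLM_fourier]
  refine ⟨𝓕 V, ?_⟩
  rw [Lp.fourier_toTemperedDistribution_eq]
  refine DFunLike.ext _ _ fun χ => ?_
  rw [TemperedDistribution.smulLeftCLM_apply_apply, Lp.toTemperedDistribution_apply,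
    Lp.toTemperedDistribution_apply]
  refine integral_congr_ae ?_
  filter_upwards [h] with k hk
  rw [hk, SchwartzMap.smulLeftCLM_apply_apply (by fun_prop), ← Complex.coe_smul, smul_smul,
    smul_eq_mul, mul_comm]

/-- `U ∈ L²` and `(-Δ)^α U ∈ L²` imply `U ∈ H^{2α}`. -/
lemma IsFracLaplacian.memHs {α : ℝ} (hα : 0 < α) {U F : L2Field} (hF : IsFracLaplacian α U F) :
    MemHs (2 * α) U := by
  have hm : AEStronglyMeasurable
      (fun k : E3 => ((1 + ‖k‖ ^ 2) ^ (2 * α / 2) : ℝ) • (𝓕 U : L2Field) k) volume := by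
    have h1 : Measurable fun k : E3 => ((1 + ‖k‖ ^ 2) ^ (2 * α / 2) : ℝ) := by fun_prop
    exact h1.aestronglyMeasurable.smul (Lp.aestronglyMeasurable _)
  have hL : MemLp (fun k : E3 => ((1 + ‖k‖ ^ 2) ^ (2 * α / 2) : ℝ) • (𝓕 U : L2Field) k) 2
      volume := by
    refine MemLp.of_le_mul (c := 2 ^ α) ((Lp.memLp (𝓕 U : L2Field)).norm.add
      (Lp.memLp (𝓕 F : L2Field)).norm) hm ?_
    filter_upwards [hF] with k hk
    simp only [Pi.add_apply]
    rw [hk, norm_smul, norm_smul, Real.norm_of_nonneg (by positivity),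
      Real.norm_of_nonneg (by positivity), Real.norm_of_nonneg (by positivity)]
    have e : 2 * α / 2 = α := by ring
    rw [e]
    rcases le_or_gt ‖k‖ 1 with h | h
    · have h1 : (1 + ‖k‖ ^ 2) ^ α ≤ 2 ^ α := by
        gcongr
        nlinarith [norm_nonneg k]
      calc _ ≤ 2 ^ α * ‖(𝓕 U : L2Field) k‖ := by gcongr
        _ ≤ _ := by gcongr; exact le_add_of_nonneg_right (by positivity)
    · have h1 : (1 + ‖k‖ ^ 2) ^ α ≤ 2 ^ α * (2 * Real.pi * ‖k‖) ^ (2 * α) := by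
        rw [Real.rpow_mul (by positivity), ← Real.mul_rpow (by positivity) (by positivity),
          Real.rpow_two]
        gcongr
        have : ‖k‖ ≤ 2 * Real.pi * ‖k‖ := by nlinarith [Real.pi_gt_three]
        nlinarith
      calc _ ≤ 2 ^ α * (2 * Real.pi * ‖k‖) ^ (2 * α) * ‖(𝓕 U : L2Field) k‖ := by gcongr
        _ = 2 ^ α * ((2 * Real.pi * ‖k‖) ^ (2 * α) * ‖(𝓕 U : L2Field) k‖) := by ring
        _ ≤ _ := by gcongr; exact le_add_of_nonneg_left (by positivity)
  obtain ⟨V, hV⟩ := exists_fourier_eq hL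
  exact memHs_of_fourier hV

/-- The partial derivatives of the velocity lie in `L²`. -/
lemma exists_partial {ζ η : L2Field}
    (hη : ∀ᵐ k, (𝓕 η : L2Field) k = velocityMultiplier k ((𝓕 ζ : L2Field) k)) (i : Fin 3) :
    ∃ D : L2Field, IsWeakDeriv (partialSym i) (fun x => η x) (fun x => D x) := by
  have hc : Continuous fun k : E3 => (2 * Real.pi * Complex.I : ℂ) * ((k i : ℝ) : ℂ) := by fun_prop
  have hL : MemLp (fun k : E3 => ((2 * Real.pi * Complex.I : ℂ) * ((k i : ℝ) : ℂ)) •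
      (𝓕 η : L2Field) k) 2 volume := by
    refine MemLp.of_le_mul (c := 2 * Real.pi) (Lp.memLp (𝓕 ζ : L2Field))
      (hc.aestronglyMeasurable.smul (Lp.aestronglyMeasurable _)) ?_
    filter_upwards [hη, ae_ne_zero] with k hk hk0
    have hk' : 0 < ‖k‖ := norm_pos_iff.2 hk0
    have e1 : ‖k i‖ ≤ ‖k‖ := PiLp.norm_apply_le k i
    have e2 := norm_velocityMultiplier_le k ((𝓕 ζ : L2Field) k)
    simp only [hk, norm_smul, norm_mul, Complex.norm_I, Complex.norm_real, Complex.norm_ofNat,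
        Real.norm_of_nonneg Real.pi_pos.le, mul_one]
    calc _ ≤ 2 * Real.pi * ‖k‖ * (‖k‖⁻¹ * ‖(𝓕 ζ : L2Field) k‖) := by gcongr
      _ = _ := by field_simp
  obtain ⟨D, hD⟩ := exists_fourier_eq hL
  refine ⟨D, isWeakDeriv_of_fourier ?_⟩
  filter_upwards [hD] with k hk
  rw [hk, weakSymbol_partial, smul_smul]

/-- A first-order operator evaluated on a field with derivatives in `L²`. -/
lemma IsWeakDeriv.eq_sum_partial {ℓ : Fin 3 → C3 →L[ℂ] C3} {η ζ : L2Field} {D : Fin 3 → L2Field}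
    (hD : ∀ i, IsWeakDeriv (partialSym i) (fun x => η x) (fun x => D i x))
    (h : IsWeakDeriv ℓ (fun x => η x) (fun x => ζ x)) :
    ∀ᵐ x, ζ x = ∑ j, ℓ j (D j x) := by
  have hloc : LocallyIntegrable (fun x => ∑ j, ℓ j (D j x)) volume :=
    (memLp_finsetSum _ fun j _ => memLp_comp_clm (ℓ j) (Lp.memLp (D j))).locallyIntegrable
      (by norm_num)
  refine ae_eq_of_integral_contDiff_smul_eq ζ.locallyIntegrable hloc fun φ hφ1 hφ2 => ?_
  have hφ : IsTestFunction φ := ⟨hφ1, hφ2⟩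
  have hpull (j : Fin 3) (ψ : E3 → ℝ) (hψ : IsTestFunction ψ) (f : L2Field) :
      ∫ x, ψ x • ℓ j (f x) = ℓ j (∫ x, ψ x • f x) := by
    rw [← ContinuousLinearMap.integral_comp_comm _ (hψ.integrable_smul f.locallyIntegrable)]
    refine integral_congr_ae (ae_of_all _ fun x => ?_)
    exact (((ℓ j).restrictScalars ℝ).map_smul (ψ x) (f x)).symm
  have e (j : Fin 3) : ∫ x, φ x • D j x = -∫ x, partialDeriv φ j x • η x := by
    rw [hD j φ hφ]
    congr 1
    refine integral_congr_ae (ae_of_all _ fun x => ?_)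
    simp only
    rw [Finset.sum_eq_single j]
    · simp [partialSym]
    · intro i _ hi
      simp [partialSym, hi]
    · simp
  rw [h φ hφ, integral_finsetSum _ fun j _ =>
    (hφ.partialDeriv j).integrable_smul_clm η.locallyIntegrable (ℓ j)]
  simp only [Finset.smul_sum]
  rw [integral_finsetSum _ fun j _ => hφ.integrable_smul_clm (D j).locallyIntegrable (ℓ j),
    ← Finset.sum_neg_distrib]
  refine Finset.sum_congr rfl fun j _ => ?_
  rw [hpull j _ (hφ.partialDeriv j), hpull j _ hφ, e, map_neg]

section Background

variable {Ωb : E3 → E3}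

/-- The linearised convection term and `Ub × ζ + η × Ωb` add up to the gradient of `Ub · η`, because
`ζ = curl η` and `Ωb = curl Ub`. -/
lemma lerayProj_convection (h1 : ContDiff ℝ ∞ Ωb) (h2 : HasCompactSupport Ωb)
    (hdiv : ∀ x, divergence Ωb x = 0) {ζ η G : L2Field}
    (hcurl : IsWeakDeriv curlSym (fun x => η x) (fun x => ζ x))
    (hG : ∀ᵐ x, G x = cross (complexify (biotSavart Ωb x)) (ζ x) -
      cross (complexify (Ωb x)) (η x))
    {D : Fin 3 → L2Field} (hD : ∀ i, IsWeakDeriv (partialSym i) (fun x => η x) (fun x => D i x))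
    {N : L2Field} (hN : ∀ᵐ x, N x = (∑ i, biotSavart Ωb x i • D i x) +
      dotGrad (fun y => η y) (biotSavart Ωb) x) :
    lerayProj N = -lerayProj G := by
  have hU := contDiff_biotSavart h1 h2
  have hgrad := isWeakDeriv_grad_dot hU hD
  set q : E3 → C3 := fun x =>
    (∑ i, ((biotSavart Ωb x i : ℝ) : ℂ) * η x i) • complexify (basisVec 0) with hq
  have hqL : MemLp q 2 volume := by
    obtain ⟨C, hC⟩ := norm_biotSavart_le h1 h2
    have hm : AEStronglyMeasurable q volume := by
      refine AEStronglyMeasurable.smul_const ?_ _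
      refine Finset.aestronglyMeasurable_fun_sum _ fun i _ => ?_
      have c1 : Continuous fun x => ((biotSavart Ωb x i : ℝ) : ℂ) :=
        Complex.continuous_ofReal.comp ((contDiff_coord hU i).continuous)
      exact c1.aestronglyMeasurable.mul ((EuclideanSpace.proj (𝕜 :=
        ℂ) i).continuous.comp_aestronglyMeasurable (Lp.aestronglyMeasurable η))
    refine MemLp.of_le_mul (c := 3 * C) (Lp.memLp η) hm (ae_of_all _ fun x => ?_)
    rw [hq, norm_smul, complexify.norm_map, norm_basisVec, mul_one]
    have hi : ∀ i ∈ (Finset.univ : Finset (Fin 3)),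
        ‖((biotSavart Ωb x i : ℝ) : ℂ) * η x i‖ ≤ C * ‖η x‖ := fun i _ => by
      rw [norm_mul, Complex.norm_real]
      have e1 : ‖biotSavart Ωb x i‖ ≤ C := (PiLp.norm_apply_le _ i).trans (hC x)
      have e2 := norm_coord_le (η x) i
      have e3 : 0 ≤ C := (norm_nonneg _).trans e1
      gcongr
    refine (norm_sum_le_of_le _ hi).trans (le_of_eq ?_)
    simp
    ring
  have hsum : ∀ᵐ x, (∑ j, (∑ i, (((fderiv ℝ (biotSavart Ωb) x (basisVec j) i : ℝ) : ℂ) * η x i +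
      ((biotSavart Ωb x i : ℝ) : ℂ) * D j x i)) • complexify (basisVec j)) =
      (N + G : L2Field) x := by
    filter_upwards [hN, hG, Lp.coeFn_add N G, hcurl.eq_sum_partial hD] with x e1 e2 e3 e4
    rw [e3, Pi.add_apply, e1, e2, e4, ← curl_biotSavart h1 h2 hdiv x]
    simp only [curlSym_apply]
    refine C3.ext ?_ ?_ ?_ <;>
      simp [dotGrad, Fin.sum_univ_three, basisVec, cross_zero_apply, cross_one_apply,
        cross_two_apply] <;> ring
  have hP : lerayProj (N + G) = 0 :=
    lerayProj_grad (q := hqL.toLp q) (hgrad.congr_ae hqL.coeFn_toLp.symm hsum)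
  rw [map_add] at hP
  exact eq_neg_of_add_eq_zero_left hP

lemma memLp_sum_smul (h1 : ContDiff ℝ ∞ Ωb) (h2 : HasCompactSupport Ωb) (D : Fin 3 → L2Field) :
    MemLp (fun x => ∑ i, biotSavart Ωb x i • D i x) 2 volume := by
  obtain ⟨C, hC⟩ := norm_biotSavart_le h1 h2
  refine memLp_finsetSum _ fun i _ => ?_
  refine MemLp.of_le_mul (c := C) (Lp.memLp (D i)) ?_ (ae_of_all _ fun x => ?_)
  · exact (contDiff_coord (contDiff_biotSavart h1 h2) i).continuous.aestronglyMeasurable.smul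
      (Lp.aestronglyMeasurable _)
  · rw [norm_smul]
    have e1 : ‖biotSavart Ωb x i‖ ≤ C := (PiLp.norm_apply_le _ i).trans (hC x)
    gcongr

/-- A right inverse of the curl on the eigenvalue equation: given the curl form `curl H = R` of the
remainder in `ξ · ∇ζ = c ζ + R`, the field `η = -∫₁^∞ s^{-c-2} H (s ·) ds` is the Biot–Savart
velocity of `ζ`. -/
lemma exists_velocity_of_curl {c : ℂ} (hc : -(3 / 2) < c.re) {H R ζ X : L2Field}
    (hsol : H ∈ solenoidal) (hHR : IsWeakDeriv curlSym (fun x => H x) (fun x => R x))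
    (hX : IsAdvection (fun ξ => ξ) (fun x => ζ x) X) (hXeq : X = c • ζ + R) :
    ∃ η : L2Field, IsWeakDeriv curlSym (fun x => η x) (fun x => ζ x) ∧
      (∀ᵐ k, (𝓕 η : L2Field) k = velocityMultiplier k ((𝓕 ζ : L2Field) k)) ∧
      IsAdvection (fun ξ => ξ) (fun x => η x) ((c + 1) • η + H) := by
  have ha : 1 / 2 < (c + 2).re := by simp; linarith
  have hL : MemLp (fun x => -scaleInt (c + 2) H x) 2 volume := (memLp_scaleInt ha H).neg
  have hη := hL.coeFn_toLp
  set η : L2Field := hL.toLp _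
  have hcurl : IsWeakDeriv curlSym (fun x => η x) (fun x => ζ x) :=
    IsWeakDeriv.of_scaleInt hc hη hHR hX hXeq
  have hdiv : η ∈ solenoidal := (mem_solenoidal_iff η).2
    (IsWeakDeriv.zero_of_scaleInt hc hη ((mem_solenoidal_iff H).1 hsol))
  refine ⟨η, hcurl, ?_, isAdvection_of_scaleInt hc hη⟩
  filter_upwards [hcurl.fourier, (mem_solenoidal_iff_fourier η).1 hdiv, ae_ne_zero] with k e1 e2 e3
  rw [e1, weakSymbol_curl, velocityMultiplier_cross e3 e2]

/-- The Biot–Savart operator maps eigenfunctions of the vorticity operator with `Re λ > 1 - 3/(4α)`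
to eigenfunctions of the velocity operator. Neither the sign of `Re λ` nor the size of `β` matters
here. -/
theorem velocity_eigenvector {α β : ℝ} (hα : 1 / 2 < α) (h1 : ContDiff ℝ ∞ Ωb)
    (h2 : HasCompactSupport Ωb) (hdiv : ∀ x, divergence Ωb x = 0) {lam : ℂ}
    (hlam : 1 - 3 / (4 * α) < lam.re) {ζ : L2Field}
    (hζ : IsEigenvector (VorticityOp α β Ωb) lam ζ) :
    ∃ hL2 : MemLp (biotSavart fun x => ζ x) 2 (volume : Measure E3),
      IsEigenvector (VelocityOp α β Ωb) lam (hL2.toLp _) := by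
  obtain ⟨hζ0, ⟨hsol, -⟩, -, X, F, N, hX, hF, hN, heq⟩ := hζ
  have hα0 : 0 < α := by linarith
  have hαC : (α : ℂ) ≠ 0 := by exact_mod_cast hα0.ne'
  have hk := memLp_norm_mul_fourier hα hF
  -- `F = curl Fη` and `N = curl (ℙ G)`, where `Fη = (-Δ)^α BS ζ`
  obtain ⟨G, hG, hGcurl⟩ := exists_curl_eq_euler h1 h2 hdiv hk hN
  obtain ⟨Fη, hFη⟩ := exists_fracLaplacian_velocity hα hF
  have hζk := (mem_solenoidal_iff_fourier ζ).1 hsol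
  have hFcurl : IsWeakDeriv curlSym (fun x => Fη x) (fun x => F x) := by
    refine isWeakDeriv_of_fourier ?_
    filter_upwards [hFη, hF, hζk, ae_ne_zero] with k e1 e2 e3 e4
    rw [e1, e2, weakSymbol_curl,
      ← Complex.coe_smul _ (velocityMultiplier k ((𝓕 ζ : L2Field) k)), cross_smul_right, smul_comm,
      cross_velocityMultiplier e4 e3, Complex.coe_smul]
  have hPcurl : IsWeakDeriv curlSym (fun x => lerayProj G x) (fun x => N x) := by
    refine isWeakDeriv_of_fourier ?_
    filter_upwards [hGcurl.fourier, cross_fourier_lerayProj G] with k e1 e2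
    rw [e1, weakSymbol_curl, weakSymbol_curl, e2]
  have hFsol : Fη ∈ solenoidal := by
    rw [mem_solenoidal_iff_fourier]
    filter_upwards [hFη] with k e1
    have h := dot_velocityMultiplier k ((𝓕 ζ : L2Field) k)
    have e : ∑ j, ((k j : ℝ) : ℂ) * (𝓕 Fη : L2Field) k j =
        (((2 * Real.pi * ‖k‖) ^ (2 * α) : ℝ) : ℂ) *
          ∑ j, ((k j : ℝ) : ℂ) * velocityMultiplier k ((𝓕 ζ : L2Field) k) j := by
      rw [Finset.mul_sum, e1]
      refine Finset.sum_congr rfl fun j _ => ?_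
      rw [PiLp.smul_apply, Complex.real_smul]
      ring
    rw [e, h, mul_zero]
  -- the eigenvalue equation reads `ξ · ∇ζ = c ζ + curl H`
  set c : ℂ := 2 * α * (lam - 1) with hcdef
  set H : L2Field := (2 * α : ℂ) • Fη + (-(2 * α * β) : ℂ) • lerayProj G with hH
  set R : L2Field := (2 * α : ℂ) • F + (-(2 * α * β) : ℂ) • N with hR
  have hHsol : H ∈ solenoidal := Submodule.add_mem _ (Submodule.smul_mem _ _ hFsol)
    (Submodule.smul_mem _ _ (lerayProj_mem G))
  have hc : -(3 / 2) < c.re := by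
    have e : c.re = 2 * α * (lam.re - 1) := by simp [hcdef]
    have e2 : 2 * α * (3 / (4 * α)) = 3 / 2 := by field_simp; norm_num
    rw [e]
    nlinarith
  have hXeq : X = c • ζ + R := by
    simp only [← L2Field.coe_real_smul] at heq
    have e : X = (2 * α : ℂ) • (((1 / (2 * α) : ℝ) : ℂ) • X) := by
      rw [smul_smul]
      push_cast
      rw [mul_one_div_cancel (by simp [hαC]), one_smul]
    have e2 : ((1 / (2 * α) : ℝ) : ℂ) • X = lam • ζ - ζ + F - (β : ℂ) • N := by
      have := sub_eq_zero.2 heq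
      rw [← sub_eq_zero]
      rw [← this]
      abel
    rw [e, e2, hR, hcdef]
    module
  obtain ⟨η, hcurl, hηk, hadv⟩ :=
    exists_velocity_of_curl hc hHsol (hFcurl.smul_add_smul _ _ hPcurl) hX hXeq
  have hηvel : ∀ᵐ x, η x = velocity ζ x := ae_eq_fourierInv (integrable_velocityMultiplier hk) hηk
  have hBS : (biotSavart fun x => ζ x) =ᵐ[volume] fun x => η x := by
    filter_upwards [biotSavart_ae_eq_velocity hk, hηvel] with x e1 e2
    rw [e1, e2]
  refine ⟨(memLp_congr_ae hBS).2 (Lp.memLp η), ?_⟩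
  have hηeq : ((memLp_congr_ae hBS).2 (Lp.memLp η)).toLp _ = η :=
    Lp.ext (((memLp_congr_ae hBS).2 (Lp.memLp η)).coeFn_toLp.trans hBS)
  rw [hηeq]
  have hFrac : IsFracLaplacian α η Fη := by
    filter_upwards [hFη, hηk] with k e1 e2
    rw [e1, e2]
  -- `η ≠ 0` because its curl is `ζ`
  refine ⟨fun h0 => hζ0 ?_, hFrac.memHs hα0, ?_⟩
  · refine L2Field.ext_fourier ?_
    filter_upwards [hcurl.fourier, coe_fourier_zero] with k e1 e2
    rw [h0, e2] at e1
    rw [e1, e2]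
    simp [weakSymbol]
  -- the eigenvalue equation for `η`, from `ξ · ∇η = (c + 1) η + H`
  choose D hD using exists_partial hηk
  obtain ⟨C, hC⟩ := norm_fderiv_biotSavart_le h1 h2
  have mA := memLp_sum_smul h1 h2 D
  have mN := memLp_dotGrad (contDiff_biotSavart h1 h2) hC η
  have hAN : ∀ᵐ x, (mA.toLp _ + mN.toLp _ : L2Field) x =
      (mA.toLp _ : L2Field) x + dotGrad (fun y => η y) (biotSavart Ωb) x := by
    filter_upwards [Lp.coeFn_add (mA.toLp _) (mN.toLp _), mN.coeFn_toLp] with x e1 e2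
    rw [e1, Pi.add_apply, e2]
  refine ⟨(c + 1) • η + H, Fη, mA.toLp _, mA.toLp _ + mN.toLp _, hadv, hFrac,
    isAdvection_of_partial (contDiff_biotSavart h1 h2) hD mA.coeFn_toLp, hAN, ?_⟩
  have hP : lerayProj (mA.toLp _ + mN.toLp _) = -lerayProj G := by
    refine lerayProj_convection h1 h2 hdiv hcurl ?_ hD ?_
    · filter_upwards [hG, hηvel] with x e1 e2
      rw [e1, e2]
    · filter_upwards [hAN, mA.coeFn_toLp] with x e1 e2
      rw [e1, e2]
  simp only [← L2Field.coe_real_smul]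
  rw [hP, hH, hcdef]
  push_cast
  match_scalars <;> field_simp <;> ring

end Background

end

theorem mainTheorem3 (α : ℝ) (hα : 1 / 2 < α) (hα' : α < 5 / 4)
    (Ωb : E3 → E3) (hsmooth : ContDiff ℝ ∞ Ωb) (hsupp : HasCompactSupport Ωb)
    (hdiv : ∀ x, divergence Ωb x = 0) (hswirl : IsAxisymPureSwirl (𝕜 := ℝ) Ωb) :
    -- every unstable eigenvalue to the right of `1 - 3/(4α)` is shared, for every `β > 0`
    (∀ β : ℝ, 0 < β → ∀ lam : ℂ, 0 < lam.re → 1 - 3 / (4 * α) < lam.re →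
      ∀ ζ : L2Field, IsEigenvector (VorticityOp α β Ωb) lam ζ →
        ∃ hL2 : MemLp (biotSavart fun x => ζ x) 2 (volume : Measure E3),
          IsEigenvector (VelocityOp α β Ωb) lam (hL2.toLp _)) ∧
    -- for `β ≫ 1` this covers the eigenvalues bifurcating from an unstable eigenvalue of Euler
    (∀ lamE : ℂ, 0 < lamE.re → IsEigenvalue (EulerOp Ωb) lamE →
      ∀ ε : ℝ, 0 < ε → ε < lamE.re →
        ∃ β₀ : ℝ, 0 < β₀ ∧ ∀ β : ℝ, β₀ < β → ∀ lam' : ℂ, ‖lamE - lam'‖ < ε →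
          ∀ lam : ℂ, lam = (β : ℂ) * lam' + ((1 - 3 / (4 * α) : ℝ) : ℂ) →
          ∀ ζ : L2Field, IsEigenvector (VorticityOp α β Ωb) lam ζ →
            0 < lam.re ∧
            ∃ hL2 : MemLp (biotSavart fun x => ζ x) 2 (volume : Measure E3),
              IsEigenvector (VelocityOp α β Ωb) lam (hL2.toLp _)) := by
  have hα0 : 0 < α := by linarith
  refine ⟨fun β _ lam _ hlam ζ hζ =>
    velocity_eigenvector hα hsmooth hsupp hdiv hlam hζ, fun lamE hE _ ε _ hεE => ?_⟩
  have hd : 0 < lamE.re - ε := by linarith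
  have hq : 0 < 3 / (4 * α) := by positivity
  -- `β₀` is chosen so that `β Re lam' > 3 / (4 α)` for all `β > β₀`
  refine ⟨3 / (4 * α) / (lamE.re - ε), by positivity, fun β hβ lam' hlam' lam hlam ζ hζ => ?_⟩
  have h1 : lamE.re - ε < lam'.re := by
    have h := (Complex.abs_re_le_norm (lamE - lam')).trans_lt hlam'
    rw [Complex.sub_re] at h
    linarith [le_abs_self (lamE.re - lam'.re)]
  have h2 : 3 / (4 * α) < β * (lamE.re - ε) := (div_lt_iff₀ hd).1 hβ
  have hβ0 : 0 < β := lt_trans (by positivity) hβ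
  have h3 : β * (lamE.re - ε) < β * lam'.re := by gcongr
  have h4 : lam.re = β * lam'.re + (1 - 3 / (4 * α)) := by
    rw [hlam, Complex.add_re, Complex.re_ofReal_mul, Complex.ofReal_re]
  exact ⟨by linarith, velocity_eigenvector hα hsmooth hsupp hdiv (by linarith) hζ⟩
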